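/- \textbf{Model.} Let $\lambda_1,\lambda_2,P_1,P_2,D,\gamma>0$ and $\alpha>2$. Let $\Phi_1$ (the macro base stations) and $\Omega$ be independent homogeneous Poisson point processes on $\mathbb{R}^2$ with densities $\lambda_1$ and $\lambda_2$, and let $\Phi_2=\Omega\setminus\bigcup_{\mathbf{x}\in\Phi_1}\mathbf{b}(\mathbf{x},D)$ (the small-cell base stations; a Poisson hole process), where $\mathbf{b}(\mathbf{x},D)$ is the disc of radius $D$ centred at $\mathbf{x}$. Attach to the points of $\Phi_1$ and $\Omega$ i.i.d. fading gains $h_{\mathbf{x}}\sim\exp(1)$, independent of all locations. The typical user is at the origin and is served by the point $\mathbf{x}_1^*$ of $\Phi_1$ closest to the origin; its signal to interference ratio and coverage probability are \[ \mathtt{SIR}=\frac{P_1h_{\mathbf{x}_1^*}\|\mathbf{x}_1^*\|^{-\alpha}}{\sum_{\mathbf{x}\in\Phi_1\setminus\{\mathbf{x}_1^*\}}P_1h_{\mathbf{x}}\|\mathbf{x}\|^{-\alpha}+\sum_{\mathbf{x}\in\Phi_2}P_2h_{\mathbf{x}}\|\mathbf{x}\|^{-\alpha}},\qquad \mathtt{P_c}_1=\mathbb{P}(\mathtt{SIR}\ge\gamma).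 \] \textbf{Theorem.} With $s=s(z_1)=\gamma z_1^{\alpha}/P_1$, \[ \mathtt{P_c}_1\le\int_0^D \mathcal{G}_1(s,z_1)\,\mathcal{G}_2(s,z_1)\,\mathcal{G}_4(s,z_1)\,f_{Z_1}(z_1)\,dz_1+\int_D^\infty\hat{\mathcal{G}}_1(s)\,\mathcal{G}_2(s,z_1)\,\mathcal{G}_4(s,z_1)\,f_{Z_1}(z_1)\,dz_1 , \] where $f_{Z_1}(z_1)=2\pi\lambda_1z_1e^{-\pi\lambda_1z_1^2}$ and \[ \mathcal{G}_1(s,z_1)=\exp\Big(\int_{D-z_1}^\infty\frac{-2\pi\lambda_2r\,dr}{1+\frac{r^\alpha}{sP_2}}\Big),\quad \hat{\mathcal{G}}_1(s)=\exp\Big(-\pi\lambda_2\frac{(sP_2)^{2/\alpha}}{\mathrm{sinc}(2/\alpha)}\Big),\quad \mathcal{G}_2(s,z_1)=e^{f(s,z_1)}, \] \[ \mathcal{G}_4(s,z_1)=\exp\Big(-2\pi\lambda_1\int_{z_1}^\infty\big(1-e^{f(s,v)}\zeta(s,v)\big)v\,dv\Big), \] \[ f(s,u)=\int_{|u-D|}^{u+D}\arccos\Big(\frac{r^2+u^2-D^2}{2ur}\Big)\frac{2\lambda_2}{1+\frac{r^\alpha}{P_2s}}\,r\,dr,\qquad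 \zeta(s,v)=\frac{1}{1+sP_1v^{-\alpha}},\qquad \mathrm{sinc}(x)=\frac{\sin\pi x}{\pi x}. \] For every $z_1>0$ the integrals inside $\mathcal{G}_1$ (for $z_1\le D$), $\mathcal{G}_2$ and $\mathcal{G}_4$ converge absolutely; the two outer integrals are integrals of non-negative functions, with values in $[0,\infty]$. -/

import Mathlib

open MeasureTheory ProbabilityTheory Set
open scoped ENNReal NNReal

noncomputable section

namespace HoleNetwork

/-- The Euclidean plane. -/
abbrev Plane : Type := EuclideanSpace ℝ (Fin 2)

/-- The counting measure `B ↦ #{i | x i ∈ B}` of a configuration of points listed as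
`x 0, x 1, x 2, …`. -/
def pointMeasure (x : ℕ → Plane) : Measure Plane :=
  Measure.sum fun i => Measure.dirac (x i)

/-- `X 0, X 1, X 2, …` is a measurable enumeration (in no particular order) of the points of a
homogeneous Poisson point process on the plane with density `lam`: the number of points in a Borel
set of finite area is Poisson with mean `lam` times the area, and the numbers of points in pairwise
disjoint sets are independent. (For `lam > 0` such a process has almost surely infinitely many
points, and they are almost surely distinct, so listing them by `ℕ` loses nothing.) -/
structure IsPoissonProcess {W : Type*} [MeasurableSpace W] (lam : ℝ) (X : ℕ → W → Plane)
    (μ : Measure W) : Prop where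
  measurable : ∀ i, Measurable (X i)
  count_law : ∀ B : Set Plane, MeasurableSet B → volume B ≠ ∞ →
    HasLaw (fun w => pointMeasure (fun i => X i w) B)
      ((poissonMeasure (lam * (volume B).toReal).toNNReal).map (Nat.cast : ℕ → ℝ≥0∞)) μ
  count_indep : ∀ (n : ℕ) (B : Fin n → Set Plane), (∀ k, MeasurableSet (B k)) →
    (∀ k, volume (B k) ≠ ∞) → Pairwise (fun k l => Disjoint (B k) (B l)) →
    iIndepFun (fun k w => pointMeasure (fun i => X i w) (B k)) μ

/-- The random ingredients of the two-tier network: macro base stations `X i` forming a Poisson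
process of density `lam₁`, an independent baseline Poisson process `Y j` of density `lam₂`, and
i.i.d. `exp(1)` (Rayleigh) fading gains `h i` (of `X i`) and `g j` (of `Y j`), independent of all
locations. -/
structure IsTwoTierNetwork {W : Type*} [MeasurableSpace W] (lam₁ lam₂ : ℝ)
    (X Y : ℕ → W → Plane) (h g : ℕ → W → ℝ) (μ : Measure W) : Prop where
  macro_poisson : IsPoissonProcess lam₁ X μ
  baseline_poisson : IsPoissonProcess lam₂ Y μ
  locations_indep : IndepFun (fun w i => X i w) (fun w j => Y j w) μ
  macro_fading : ∀ i, HasLaw (h i) (expMeasure 1) μ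
  small_fading : ∀ j, HasLaw (g j) (expMeasure 1) μ
  fading_indep : iIndepFun (fun k : ℕ ⊕ ℕ => Sum.elim h g k) μ
  fading_locations_indep :
    IndepFun (fun w => ((fun i => X i w : ℕ → Plane), (fun j => Y j w : ℕ → Plane)))
      (fun w => ((fun i => h i w : ℕ → ℝ), (fun j => g j w : ℕ → ℝ))) μ

/-- The union of the holes: the discs of radius `D` around the macro base stations. -/
def holes (D : ℝ) (x : ℕ → Plane) : Set Plane := ⋃ i, Metric.ball (x i) D

/-- Index of a point closest to the origin (the typical user). For a Poisson process of positive
density the closest point almost surely exists and is unique. -/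
def nearest (x : ℕ → Plane) : ℕ := sInf {i | ∀ j, ‖x i‖ ≤ ‖x j‖}

/-- Power received at the origin from a transmitter at `p` with power `P` and fading gain `a`. -/
def rxPower (α P a : ℝ) (p : Plane) : ℝ≥0∞ := ENNReal.ofReal (P * a * ‖p‖ ^ (-α))

/-- Interference at the typical user served by the nearest macro base station: the other macro base
stations, and the points of the Poisson hole process, i.e. the baseline points outside every
hole. -/
def interference (α P₁ P₂ D : ℝ) (x y : ℕ → Plane) (h g : ℕ → ℝ) : ℝ≥0∞ :=
  (∑' i : {i : ℕ // i ≠ nearest x}, rxPower α P₁ (h i) (x i)) +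
    ∑' j : {j : ℕ // y j ∉ holes D x}, rxPower α P₂ (g j) (y j)

/-- Signal to interference ratio of the typical user served by the nearest macro base station. -/
def sir (α P₁ P₂ D : ℝ) (x y : ℕ → Plane) (h g : ℕ → ℝ) : ℝ≥0∞ :=
  rxPower α P₁ (h (nearest x)) (x (nearest x)) / interference α P₁ P₂ D x y h g

/-- Coverage probability of the typical user served by its nearest macro base station. -/
def macroCoverage {W : Type*} [MeasurableSpace W] (μ : Measure W) (α P₁ P₂ D γ : ℝ)
    (X Y : ℕ → W → Plane) (h g : ℕ → W → ℝ) : ℝ≥0∞ :=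
  μ {w | ENNReal.ofReal γ ≤
    sir α P₁ P₂ D (fun i => X i w) (fun j => Y j w) (fun i => h i w) (fun j => g j w)}

/-- Density of the distance to the nearest macro base station. -/
def servingPDF (lam₁ z : ℝ) : ℝ :=
  2 * Real.pi * lam₁ * z * Real.exp (-(Real.pi * lam₁ * z ^ 2))

/-- The normalized cardinal sine `sin (π x) / (π x)`. -/
def nsinc (x : ℝ) : ℝ := Real.sinc (Real.pi * x)

/-- Laplace factor of one macro interferer at distance `v`. -/
def zeta (α P₁ s v : ℝ) : ℝ := 1 / (1 + s * P₁ * v ^ (-α))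

/-- The integrand of the per-hole correction, for a hole whose centre is at distance `u`. -/
def holeIntegrand (lam₂ α P₂ D s u r : ℝ) : ℝ :=
  Real.arccos ((r ^ 2 + u ^ 2 - D ^ 2) / (2 * u * r)) * (2 * lam₂ / (1 + r ^ α / (P₂ * s))) * r

/-- The per-hole correction. -/
def holeTerm (lam₂ α P₂ D s u : ℝ) : ℝ :=
  ∫ r in |u - D|..(u + D), holeIntegrand lam₂ α P₂ D s u r

/-- The integrand of the exponent of `G₁`. -/
def farIntegrand (lam₂ α P₂ s r : ℝ) : ℝ :=
  -2 * Real.pi * lam₂ * r / (1 + r ^ α / (s * P₂))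

def G₁ (lam₂ α P₂ D s z : ℝ) : ℝ :=
  Real.exp (∫ r in Ioi (D - z), farIntegrand lam₂ α P₂ s r)

def G₁hat (lam₂ α P₂ s : ℝ) : ℝ :=
  Real.exp (-(Real.pi * lam₂ * ((s * P₂) ^ (2 / α) / nsinc (2 / α))))

def G₂ (lam₂ α P₂ D s z : ℝ) : ℝ := Real.exp (holeTerm lam₂ α P₂ D s z)

/-- The integrand of the exponent of `G₄`. -/
def pgflIntegrand (lam₂ α P₁ P₂ D s v : ℝ) : ℝ :=
  (1 - Real.exp (holeTerm lam₂ α P₂ D s v) * zeta α P₁ s v) * v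

def G₄ (lam₁ lam₂ α P₁ P₂ D s z : ℝ) : ℝ :=
  Real.exp (-2 * Real.pi * lam₁ * ∫ v in Ioi z, pgflIntegrand lam₂ α P₁ P₂ D s v)

end HoleNetwork

end

namespace HoleNetwork

open Filter Topology

/-! Given all locations, coverage asks one exp(1) variable to dominate a nonnegative combination of
independent exp(1) variables. Its probability is therefore at most the product of the Laplace
factors 1 / (1 + s P v ^ (-α)) of the interferers, with s = γ z ^ α / P₁ (`measure_le_sir_le`).
Averaging over the baseline process, with the holes fixed, turns the small-cell factors into exp
(-λ₂ ∫ `lossKernel`) over the complement of the holes (`lintegral_small_cells_le`).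

The geometric loss occurs in `IsGood.farMass_le`. The mass outside the holes is at least the mass
outside the disc of radius D - z around the origin, minus the sum of the masses of all holes;
overlaps are subtracted repeatedly, but the disc near the origin is left out on both sides. The
exponent thereby becomes additive over the macro points. In polar coordinates each hole contributes
`holeTerm` (`holeTerm_eq_holeMass`), so the conditional bound is a function C z of the serving
distance times the product over the other macro points of e^f ζ = exp (Ψ z v).

It remains to bound the expectation of C z * exp (∑ Ψ z ‖x i‖) over the macro process
(`IsPoissonProcess.lintegral_nearest_le`). The serving distance is rounded down to a grid k / n. The
corresponding event, an empty disc of radius k / n and an occupied next annulus, involves only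
points closer than (k + 1) / n, hence is independent of a potential supported beyond; the
expectation factors and the event has the mass of a cell of `servingPDF`. Then n tends to infinity,
with Fatou on the probability side and dominated convergence on the other.

Since e^f ζ may exceed 1, the Laplace functional is needed for signed functions. It is exact for
simple functions, by independence of counts, and extends to integrable functions bounded above as an
inequality, by Fatou (`IsPoissonProcess.setLIntegral_exp_le`); this direction suffices throughout.
-/

/-! ### Counts and the Laplace functional of a Poisson process. -/

theorem pointMeasure_apply (x : ℕ → Plane) {B : Set Plane} (hB : MeasurableSet B) :
    pointMeasure x B = ∑' i, B.indicator (1 : Plane → ℝ≥0∞) (x i) := by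
  simp [pointMeasure, Measure.sum_apply _ hB, Measure.dirac_apply' _ hB]

theorem pointMeasure_eq_zero_iff (x : ℕ → Plane) {B : Set Plane} (hB : MeasurableSet B) :
    pointMeasure x B = 0 ↔ ∀ i, x i ∉ B := by
  simp [pointMeasure_apply x hB, ENNReal.tsum_eq_zero]

/-- The exponential series. Over a level set `B` of value `c` it yields the factor exp (λ |B| (e^c -
1)) of the Laplace functional. -/
theorem lintegral_exp_mul_poissonMeasure (m : ℝ≥0) (c : ℝ) :
    ∫⁻ n : ℕ, ENNReal.ofReal (Real.exp (c * n)) ∂poissonMeasure m =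
      ENNReal.ofReal (Real.exp (m * (Real.exp c - 1))) := by
  have hs : HasSum (fun n : ℕ => Real.exp (-m) * (m * Real.exp c) ^ n / n.factorial)
      (Real.exp (m * (Real.exp c - 1))) := by
    have h := (NormedSpace.expSeries_div_hasSum_exp ((m : ℝ) * Real.exp c)).mul_left
      (Real.exp (-m))
    rw [← Real.exp_eq_exp_ℝ, ← Real.exp_add] at h
    convert! h using 1
    · ext n; ring
    · congr 1; ring
  rw [poissonMeasure, lintegral_sum_measure]
  simp_rw [lintegral_smul_measure, lintegral_dirac, smul_eq_mul]
  rw [← hs.tsum_eq, ENNReal.ofReal_tsum_of_nonneg (fun n => by positivity) hs.summable]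
  refine tsum_congr fun n => ?_
  rw [← ENNReal.ofReal_mul (by positivity)]
  congr 1
  rw [mul_pow, ← Real.exp_nat_mul, mul_comm c]
  ring

namespace IsPoissonProcess

variable {W : Type*} [MeasurableSpace W] {μ : Measure W} {lam : ℝ} {X : ℕ → W → Plane}

theorem measurable_count (hX : IsPoissonProcess lam X μ) {B : Set Plane} (hB : MeasurableSet B) :
    Measurable fun w => pointMeasure (fun i => X i w) B := by
  simp_rw [pointMeasure_apply _ hB]
  exact Measurable.tsum fun i => (measurable_one.indicator hB).comp (hX.measurable i)

theorem lintegral_count (hX : IsPoissonProcess lam X μ) {B : Set Plane} (hB : MeasurableSet B)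
    (hv : volume B ≠ ∞) {u : ℝ≥0∞ → ℝ≥0∞} (hu : Measurable u) :
    ∫⁻ w, u (pointMeasure (fun i => X i w) B) ∂μ =
      ∫⁻ n : ℕ, u n ∂poissonMeasure (lam * (volume B).toReal).toNNReal := by
  rw [(hX.count_law B hB hv).lintegral_comp hu.aemeasurable,
    lintegral_map hu (by fun_prop)]

theorem ae_count_lt_top (hX : IsPoissonProcess lam X μ) {B : Set Plane} (hB : MeasurableSet B)
    (hv : volume B ≠ ∞) : ∀ᵐ w ∂μ, pointMeasure (fun i => X i w) B < ∞ := by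
  have h := (hX.count_law B hB hv).ae_iff (p := fun t => t < ∞)
    (measurableSet_setOfPred.1 measurableSet_Iio)
  rw [h, ae_map_iff (by fun_prop) measurableSet_Iio]
  simp

theorem iIndepFun_count (hX : IsPoissonProcess lam X μ) {ι : Type*} [Fintype ι]
    {B : ι → Set Plane} (hB : ∀ k, MeasurableSet (B k)) (hv : ∀ k, volume (B k) ≠ ∞)
    (hd : Pairwise fun k l => Disjoint (B k) (B l)) :
    iIndepFun (fun k w => pointMeasure (fun i => X i w) (B k)) μ := by
  have e := Fintype.equivFin ι
  have h := hX.count_indep (Fintype.card ι) (fun k => B (e.symm k)) (fun k => hB _)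
    (fun k => hv _) (fun k l hkl => hd (e.symm.injective.ne hkl))
  simpa using! h.precomp e.injective

theorem lintegral_prod_count (hX : IsPoissonProcess lam X μ) {ι : Type*} [Fintype ι]
    {B : ι → Set Plane} (hB : ∀ k, MeasurableSet (B k)) (hv : ∀ k, volume (B k) ≠ ∞)
    (hd : Pairwise fun k l => Disjoint (B k) (B l)) {u : ι → ℝ≥0∞ → ℝ≥0∞}
    (hu : ∀ k, Measurable (u k)) :
    ∫⁻ w, ∏ k, u k (pointMeasure (fun i => X i w) (B k)) ∂μ =
      ∏ k, ∫⁻ w, u k (pointMeasure (fun i => X i w) (B k)) ∂μ :=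
    lintegral_prod_eq_prod_lintegral_of_indepFun (μ := μ) Finset.univ
    (fun k w => u k (pointMeasure (fun i => X i w) (B k)))
    ((hX.iIndepFun_count hB hv hd).comp u hu)
    (fun k => (hu k).comp (hX.measurable_count (hB k)))

end IsPoissonProcess

/-- Grouping points by the value of `σ` leaves finitely many counts. The zero fibre may hold
infinitely many points, but its count is multiplied by 0, so finiteness is asked only for nonzero
values. -/
theorem tsum_simpleFunc_comp (x : ℕ → Plane) (σ : SimpleFunc Plane ℝ)
    (hx : ∀ c ∈ σ.range, c ≠ 0 → pointMeasure x (σ ⁻¹' {c}) < ∞) :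
    ∑' i, σ (x i) = ∑ c ∈ σ.range, c * (pointMeasure x (σ ⁻¹' {c})).toReal := by
  classical
  have h1 : ∀ i, σ (x i) =
      ∑ c ∈ σ.range, c * ((σ ⁻¹' {c}).indicator (1 : Plane → ℝ≥0∞) (x i)).toReal := by
    intro i
    rw [Finset.sum_eq_single (σ (x i))]
    · simp
    · intro c _ hc
      simp [indicator, Ne.symm hc]
    · intro h
      exact absurd (σ.mem_range_self _) h
  have h2 : ∀ c ∈ σ.range, Summable fun i =>
      c * ((σ ⁻¹' {c}).indicator (1 : Plane → ℝ≥0∞) (x i)).toReal := by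
    intro c hc
    by_cases h0 : c = 0
    · simp [h0, summable_zero]
    · refine (ENNReal.summable_toReal ?_).mul_left _
      rw [← pointMeasure_apply x (σ.measurableSet_fiber c)]
      exact (hx c hc h0).ne
  simp_rw [h1]
  rw [Summable.tsum_finsetSum h2]
  refine Finset.sum_congr rfl fun c _ => ?_
  rw [tsum_mul_left, pointMeasure_apply x (σ.measurableSet_fiber c), ENNReal.tsum_toReal_eq]
  intro i
  simp only [indicator]
  split_ifs <;> simp

theorem lintegral_natCast_poissonMeasure (m : ℝ≥0) :
    ∫⁻ n : ℕ, (n : ℝ≥0∞) ∂poissonMeasure m = m := by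
  have hs := (hasSum_one_poissonMeasure m).mul_left (m : ℝ)
  rw [poissonMeasure, lintegral_sum_measure]
  simp_rw [lintegral_smul_measure, lintegral_dirac, smul_eq_mul]
  rw [tsum_eq_zero_add' ENNReal.summable, Nat.cast_zero, mul_zero, zero_add]
  have h : ∀ n : ℕ, ENNReal.ofReal (Real.exp (-m) * m ^ (n + 1) / (n + 1).factorial) *
      ((n + 1 : ℕ) : ℝ≥0∞) =
      ENNReal.ofReal (m * (Real.exp (-m) * m ^ n / n.factorial)) := fun n => by
    rw [← ENNReal.ofReal_natCast, ← ENNReal.ofReal_mul (by positivity)]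
    congr 1
    rw [Nat.factorial_succ]
    push_cast
    have : (n.factorial : ℝ) ≠ 0 := by positivity
    field_simp
    ring
  simp_rw [h]
  rw [← ENNReal.ofReal_tsum_of_nonneg (fun n => by positivity) hs.summable, hs.tsum_eq, mul_one,
    ENNReal.ofReal_coe_nnreal]

/-- A mean value bound that uses only an upper bound on `t`; it supplies the dominating functions
for e^ψ - 1. -/
theorem abs_exp_sub_one_le_of_le {t M : ℝ} (hM : 0 ≤ M) (h : t ≤ M) :
    |Real.exp t - 1| ≤ Real.exp M * |t| := by
  rcases le_or_gt 0 t with h0 | h0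
  · rw [abs_of_nonneg (by linarith [Real.one_le_exp h0]), abs_of_nonneg h0]
    have h1 : Real.exp t * Real.exp (-t) = 1 := by rw [← Real.exp_add]; simp
    have h2 := Real.add_one_le_exp (-t)
    have h3 := Real.exp_le_exp.2 h
    nlinarith [Real.exp_pos t]
  · rw [abs_of_nonpos (by linarith [Real.exp_le_one_iff.2 h0.le]), abs_of_neg h0]
    nlinarith [Real.add_one_le_exp t, Real.one_le_exp hM]

namespace IsPoissonProcess

variable {W : Type*} [MeasurableSpace W] {μ : Measure W} {lam : ℝ} {X : ℕ → W → Plane}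

theorem ae_tsum_simpleFunc (hX : IsPoissonProcess lam X μ) {σ : SimpleFunc Plane ℝ}
    (hσ : Integrable σ) : ∀ᵐ w ∂μ, ∑' i, σ (X i w) =
      ∑ c ∈ σ.range, c * (pointMeasure (fun i => X i w) (σ ⁻¹' {c})).toReal := by
  have h : ∀ᵐ w ∂μ, ∀ c ∈ σ.range, c ≠ 0 →
      pointMeasure (fun i => X i w) (σ ⁻¹' {c}) < ∞ := by
    rw [Filter.eventually_all_finset]
    intro c _
    by_cases h0 : c = 0
    · simp [h0]
    · filter_upwards [hX.ae_count_lt_top (σ.measurableSet_fiber c)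
        (SimpleFunc.measure_preimage_lt_top_of_integrable σ hσ h0).ne] with w hw _ using hw
  filter_upwards [h] with w hw
  exact tsum_simpleFunc_comp _ σ hw

theorem aemeasurable_tsum_simpleFunc (hX : IsPoissonProcess lam X μ) {σ : SimpleFunc Plane ℝ}
    (hσ : Integrable σ) : AEMeasurable (fun w => ∑' i, σ (X i w)) μ := by
  refine AEMeasurable.congr ?_ ((hX.ae_tsum_simpleFunc hσ).mono fun w hw => hw.symm)
  refine Measurable.aemeasurable (Finset.measurable_sum _ fun c _ => ?_)
  exact (hX.measurable_count (σ.measurableSet_fiber c)).ennreal_toReal.const_mul c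

theorem measurableSet_count (hX : IsPoissonProcess lam X μ) {A B : Set Plane}
    (hA : MeasurableSet A) (hB : MeasurableSet B) {S T : Set ℝ≥0∞} (hS : MeasurableSet S)
    (hT : MeasurableSet T) :
    MeasurableSet {w | pointMeasure (fun i => X i w) A ∈ S ∧ pointMeasure (fun i => X i w) B ∈ T} :=
  ((hX.measurable_count hA) hS).inter ((hX.measurable_count hB) hT)

/-- `A`, `B` and the nonzero level sets of `σ` are pairwise disjoint, so their counts are
independent and the expectation factors. Carrying the events on `A` and `B` along is what later
localises the nearest point. -/
theorem setLIntegral_exp_simpleFunc (hlam : 0 ≤ lam) (hX : IsPoissonProcess lam X μ)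
    {A B : Set Plane} (hA : MeasurableSet A) (hB : MeasurableSet B) (hvA : volume A ≠ ∞)
    (hvB : volume B ≠ ∞) (hAB : Disjoint A B) {S T : Set ℝ≥0∞}
    (hS : MeasurableSet S) (hT : MeasurableSet T) {σ : SimpleFunc Plane ℝ} (hσ : Integrable σ)
    (hσA : ∀ y ∈ A, σ y = 0) (hσB : ∀ y ∈ B, σ y = 0) :
    ∫⁻ w in {w | pointMeasure (fun i => X i w) A ∈ S ∧ pointMeasure (fun i => X i w) B ∈ T},
        ENNReal.ofReal (Real.exp (∑' i, σ (X i w))) ∂μ =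
      μ {w | pointMeasure (fun i => X i w) A ∈ S} *
        μ {w | pointMeasure (fun i => X i w) B ∈ T} *
        ENNReal.ofReal (Real.exp (lam * ∫ y, (Real.exp (σ y) - 1))) := by
  classical
  -- The zero fibre has infinite area and contributes nothing, so it is excluded.
  let R := σ.range.filter (fun c => c ≠ 0)
  let C : Bool ⊕ R → Set Plane := Sum.elim (fun b => cond b A B) (fun c => σ ⁻¹' {c.1})
  let u : Bool ⊕ R → ℝ≥0∞ → ℝ≥0∞ := Sum.elim
    (fun b t => cond b (S.indicator 1 t) (T.indicator 1 t))
    (fun c t => ENNReal.ofReal (Real.exp (c.1 * t.toReal)))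
  have hR : ∀ c : R, c.1 ≠ 0 := fun c => (Finset.mem_filter.1 c.2).2
  have hC : ∀ k, MeasurableSet (C k) := by
    rintro ((_ | _) | c)
    exacts [hB, hA, σ.measurableSet_fiber _]
  have hv : ∀ k, volume (C k) ≠ ∞ := by
    rintro ((_ | _) | c)
    exacts [hvB, hvA, (SimpleFunc.measure_preimage_lt_top_of_integrable σ hσ (hR c)).ne]
  have hdA : ∀ c : R, Disjoint A (σ ⁻¹' {c.1}) := fun c => Set.disjoint_left.2 fun y hy hy' =>
    hR c (by rw [← hσA y hy]; exact hy'.symm)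
  have hdB : ∀ c : R, Disjoint B (σ ⁻¹' {c.1}) := fun c => Set.disjoint_left.2 fun y hy hy' =>
    hR c (by rw [← hσB y hy]; exact hy'.symm)
  have hd : Pairwise fun k l => Disjoint (C k) (C l) := by
    rintro ((_ | _) | c) ((_ | _) | c') hkl
    · exact absurd rfl hkl
    · exact hAB.symm
    · exact hdB _
    · exact hAB
    · exact absurd rfl hkl
    · exact hdA _
    · exact (hdB _).symm
    · exact (hdA _).symm
    · refine Set.disjoint_left.2 fun y hy hy' => hkl ?_
      rw [Subtype.ext (hy.symm.trans hy' : c.1 = c'.1)]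
  have hu : ∀ k, Measurable (u k) := by
    rintro ((_ | _) | c)
    · exact measurable_one.indicator hT
    · exact measurable_one.indicator hS
    · exact (Real.measurable_exp.comp (ENNReal.measurable_toReal.const_mul _)).ennreal_ofReal
  have key := hX.lintegral_prod_count hC hv hd hu
  have hl : ∀ B : Set Plane, ((lam * (volume B).toReal).toNNReal : ℝ) = lam * volume.real B :=
    fun B => Real.coe_toNNReal _ (by positivity)
  have hsum : ∀ f : ℝ → ℝ, f 0 = 0 → ∑ c ∈ σ.range, f c = ∑ c : R, f c.1 := by
    intro f hf
    rw [Finset.sum_coe_sort R f, Finset.sum_filter_of_ne]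
    rintro c _ hc rfl
    exact hc hf
  rw [← lintegral_indicator (hX.measurableSet_count hA hB hS hT)]
  calc _ = ∫⁻ w, ∏ k, u k (pointMeasure (fun i => X i w) (C k)) ∂μ := by
        refine lintegral_congr_ae ?_
        filter_upwards [hX.ae_tsum_simpleFunc hσ] with w hw
        rw [Fintype.prod_sum_type, Fintype.prod_bool]
        simp only [C, u, Sum.elim_inl, Sum.elim_inr, cond_true, cond_false, indicator,
          mem_ofPred_eq, hw]
        rw [← ENNReal.ofReal_prod_of_nonneg (fun _ _ => (Real.exp_pos _).le), ← Real.exp_sum,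
          hsum (fun c => c * (pointMeasure (fun i => X i w) (σ ⁻¹' {c})).toReal) (by simp)]
        by_cases h1 : pointMeasure (fun i => X i w) A ∈ S <;>
        by_cases h2 : pointMeasure (fun i => X i w) B ∈ T <;> simp [h1, h2]
    _ = _ := by
        rw [key, Fintype.prod_sum_type, Fintype.prod_bool]
        have hind : ∀ {C : Set Plane} {U : Set ℝ≥0∞}, MeasurableSet C → MeasurableSet U →
            ∫⁻ w, U.indicator 1 (pointMeasure (fun i => X i w) C) ∂μ =
              μ {w | pointMeasure (fun i => X i w) C ∈ U} := fun hC hU =>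
          lintegral_indicator_one (hX.measurable_count hC hU)
        have hexp : ∀ c : R, ∫⁻ w, ENNReal.ofReal (Real.exp (c.1 *
            (pointMeasure (fun i => X i w) (σ ⁻¹' {c.1})).toReal)) ∂μ =
              ENNReal.ofReal (Real.exp (lam * volume.real (σ ⁻¹' {c.1}) *
                (Real.exp c - 1))) := fun c => by
          refine (hX.lintegral_count (hC (Sum.inr c)) (hv (Sum.inr c)) (hu (Sum.inr c))).trans ?_
          simp only [u, C, Sum.elim_inr, ENNReal.toReal_natCast,
            lintegral_exp_mul_poissonMeasure, hl]
        simp only [C, u, Sum.elim_inl, Sum.elim_inr, cond_true, cond_false, hind hA hS,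
          hind hB hT, hexp]
        rw [← ENNReal.ofReal_prod_of_nonneg (fun _ _ => (Real.exp_pos _).le), ← Real.exp_sum]
        have hi : ∫ y, (Real.exp (σ y) - 1) =
            ∑ c ∈ σ.range, volume.real (σ ⁻¹' {c}) • (Real.exp c - 1) := by
          rw [← SimpleFunc.map_integral σ (fun c => Real.exp c - 1) hσ (by simp),
            SimpleFunc.integral_eq_integral _ ?_]
          · rfl
          · have := (SimpleFunc.integrable_iff_finMeasSupp.1 hσ).map
              (g := fun c => Real.exp c - 1) (by simp)
            exact SimpleFunc.integrable_iff_finMeasSupp.2 this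
        rw [hi, hsum (fun c => volume.real (σ ⁻¹' {c}) • (Real.exp c - 1)) (by simp),
          Finset.mul_sum]
        simp only [smul_eq_mul, mul_assoc]

/-- Campbell's formula. -/
theorem lintegral_tsum_comp (hlam : 0 ≤ lam) (hX : IsPoissonProcess lam X μ) {f : Plane → ℝ≥0∞}
    (hf : Measurable f) :
    ∫⁻ w, ∑' i, f (X i w) ∂μ = ENNReal.ofReal lam * ∫⁻ y, f y := by
  -- The Poisson mean identifies the intensity measure with `lam` times area on sets of finite area;
  -- exhaustion by balls extends this to all Borel sets.
  have h1 : ∀ B : Set Plane, MeasurableSet B → volume B ≠ ∞ →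
      Measure.sum (fun i => μ.map (X i)) B = (ENNReal.ofReal lam • volume) B := by
    intro B hB hv
    rw [Measure.sum_apply _ hB]
    simp_rw [Measure.map_apply (hX.measurable _) hB]
    have h2 := hX.lintegral_count hB hv measurable_id
    simp_rw [id, lintegral_natCast_poissonMeasure, pointMeasure_apply _ hB] at h2
    rw [lintegral_tsum (f := fun i w => B.indicator (1 : Plane → ℝ≥0∞) (X i w)) fun i =>
      ((measurable_one.indicator hB).comp (hX.measurable i)).aemeasurable] at h2
    have h3 : ∀ i, ∫⁻ w, B.indicator (1 : Plane → ℝ≥0∞) (X i w) ∂μ =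
        μ (X i ⁻¹' B) := fun i => lintegral_indicator_one (hX.measurable i hB)
    simp_rw [h3] at h2
    rw [h2, Measure.smul_apply, smul_eq_mul, ← ENNReal.ofReal_toReal hv, ENNReal.toReal_ofReal
      ENNReal.toReal_nonneg, ← ENNReal.ofReal_mul hlam]
    rfl
  have h4 : Measure.sum (fun i => μ.map (X i)) = ENNReal.ofReal lam • volume := by
    ext B hB
    have hmono : Monotone fun n : ℕ => B ∩ Metric.ball (0 : Plane) n := fun m n hmn =>
      inter_subset_inter_right _ (Metric.ball_subset_ball (by exact_mod_cast hmn))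
    have hU : B = ⋃ n : ℕ, B ∩ Metric.ball (0 : Plane) n := by
      rw [← inter_iUnion, Metric.iUnion_ball_nat, inter_univ]
    rw [hU, hmono.measure_iUnion, hmono.measure_iUnion]
    refine iSup_congr fun n => h1 _ (hB.inter measurableSet_ball) ?_
    exact ((measure_mono inter_subset_right).trans_lt measure_ball_lt_top).ne
  rw [lintegral_tsum (f := fun i w => f (X i w)) fun i => (hf.comp (hX.measurable i)).aemeasurable,
    ← smul_eq_mul, ← lintegral_smul_measure, ← h4, lintegral_sum_measure]
  exact tsum_congr fun i => (lintegral_map hf (hX.measurable i)).symm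

theorem ae_summable (hlam : 0 ≤ lam) (hX : IsPoissonProcess lam X μ) {ψ : Plane → ℝ}
    (hm : Measurable ψ) (hi : Integrable ψ) : ∀ᵐ w ∂μ, Summable fun i => |ψ (X i w)| := by
  have h := hX.lintegral_tsum_comp hlam hm.enorm
  have h2 : ∫⁻ w, ∑' i, ‖ψ (X i w)‖ₑ ∂μ ≠ ∞ := by
    rw [h]
    exact ENNReal.mul_ne_top ENNReal.ofReal_ne_top hi.2.ne
  filter_upwards [ae_lt_top (Measurable.tsum fun i => (hm.comp (hX.measurable i)).enorm) h2]
    with w hw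
  simpa [enorm] using! ENNReal.summable_toReal hw.ne

/-- The simple approximants satisfy |σ k| ≤ 2 |ψ|, hence vanish wherever ψ does, and the exact
formula applies to them. The right sides converge by domination; on the left the sums converge
almost surely, by Campbell's formula, and Fatou gives the inequality. -/
theorem setLIntegral_exp_le [IsFiniteMeasure μ] (hlam : 0 ≤ lam) (hX : IsPoissonProcess lam X μ)
    {A B : Set Plane} (hA : MeasurableSet A) (hB : MeasurableSet B) (hvA : volume A ≠ ∞)
    (hvB : volume B ≠ ∞) (hAB : Disjoint A B) {S T : Set ℝ≥0∞}
    (hS : MeasurableSet S) (hT : MeasurableSet T) {ψ : Plane → ℝ} (hm : Measurable ψ)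
    (hi : Integrable ψ) {M : ℝ} (hM : ∀ y, ψ y ≤ M)
    (hψA : ∀ y ∈ A, ψ y = 0) (hψB : ∀ y ∈ B, ψ y = 0) :
    ∫⁻ w in {w | pointMeasure (fun i => X i w) A ∈ S ∧ pointMeasure (fun i => X i w) B ∈ T},
        ENNReal.ofReal (Real.exp (∑' i, ψ (X i w))) ∂μ ≤
      μ {w | pointMeasure (fun i => X i w) A ∈ S} *
        μ {w | pointMeasure (fun i => X i w) B ∈ T} *
        ENNReal.ofReal (Real.exp (lam * ∫ y, (Real.exp (ψ y) - 1))) := by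
  let σ : ℕ → SimpleFunc Plane ℝ := SimpleFunc.approxOn ψ hm univ 0 (mem_univ _)
  have hσ2 : ∀ k y, |σ k y| ≤ 2 * |ψ y| := fun k y => by
    simpa [two_mul] using SimpleFunc.norm_approxOn_zero_le hm (mem_univ (0 : ℝ)) y k
  have hσlim : ∀ y, Tendsto (fun k => σ k y) atTop (𝓝 (ψ y)) := fun y =>
    SimpleFunc.tendsto_approxOn hm (mem_univ _) (by simp)
  -- Dominating e^(σ k) needs an upper bound uniform in `k`. Where ψ < 0, the approximant is no
  -- farther from ψ than 0 is, hence is at most 0.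
  have hσM : ∀ k y, σ k y ≤ 2 * |M| := by
    intro k y
    rcases le_or_gt 0 (ψ y) with h | h
    · have := hσ2 k y
      rw [abs_of_nonneg h] at this
      linarith [le_abs_self (σ k y), hM y, le_abs_self M]
    · have h3 := SimpleFunc.nnnorm_approxOn_le hm (mem_univ (0 : ℝ)) y k
      have h3 : |σ k y - ψ y| ≤ |ψ y - 0| := by exact_mod_cast h3
      rw [sub_zero, abs_of_neg h] at h3
      linarith [abs_le.1 h3, abs_nonneg M]
  have hσi : ∀ k, Integrable (σ k) := fun k =>
    (hi.norm.const_mul 2).mono' (σ k).aestronglyMeasurable (ae_of_all _ fun y => hσ2 k y)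
  have hz : ∀ k y, ψ y = 0 → σ k y = 0 := fun k y h => by
    have := hσ2 k y
    rw [h, abs_zero, mul_zero] at this
    exact abs_nonpos_iff.1 this
  have hI : Tendsto (fun k => ∫ y, (Real.exp (σ k y) - 1)) atTop
      (𝓝 (∫ y, (Real.exp (ψ y) - 1))) := by
    refine tendsto_integral_of_dominated_convergence
      (fun y => Real.exp (2 * |M|) * (2 * |ψ y|)) (fun k => ?_) ?_ ?_ ?_
    · exact ((Real.measurable_exp.comp (σ k).measurable).sub_const 1).aestronglyMeasurable
    · exact (hi.norm.const_mul 2).const_mul _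
    · intro k
      refine ae_of_all _ fun y => ?_
      exact (abs_exp_sub_one_le_of_le (by positivity) (hσM k y)).trans
        (mul_le_mul_of_nonneg_left (hσ2 k y) (Real.exp_pos _).le)
    · refine ae_of_all _ fun y => ?_
      exact ((Real.continuous_exp.tendsto _).comp (hσlim y)).sub_const 1
  have hL : Tendsto (fun k => μ {w | pointMeasure (fun i => X i w) A ∈ S} *
        μ {w | pointMeasure (fun i => X i w) B ∈ T} *
        ENNReal.ofReal (Real.exp (lam * ∫ y, (Real.exp (σ k y) - 1)))) atTop
      (𝓝 (μ {w | pointMeasure (fun i => X i w) A ∈ S} *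
        μ {w | pointMeasure (fun i => X i w) B ∈ T} *
        ENNReal.ofReal (Real.exp (lam * ∫ y, (Real.exp (ψ y) - 1))))) := by
    refine ENNReal.Tendsto.const_mul ?_ (Or.inr ?_)
    · exact ENNReal.tendsto_ofReal ((Real.continuous_exp.tendsto _).comp (hI.const_mul lam))
    · exact ENNReal.mul_ne_top (measure_ne_top _ _) (measure_ne_top _ _)
  rw [← hL.liminf_eq]
  simp_rw [← fun k => hX.setLIntegral_exp_simpleFunc hlam hA hB hvA hvB hAB hS hT (hσi k)
    (fun y hy => hz k y (hψA y hy)) (fun y hy => hz k y (hψB y hy))]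
  refine le_trans (lintegral_mono_ae ?_) (lintegral_liminf_le' fun k =>
    (Real.measurable_exp.comp_aemeasurable
      (hX.aemeasurable_tsum_simpleFunc (hσi k))).ennreal_ofReal.restrict)
  filter_upwards [ae_restrict_of_ae (hX.ae_summable hlam hm hi)] with w hw
  have ht : Tendsto (fun k => ∑' i, σ k (X i w)) atTop (𝓝 (∑' i, ψ (X i w))) :=
    tendsto_tsum_of_dominated_convergence (bound := fun i => 2 * |ψ (X i w)|) (hw.mul_left 2)
      (fun i => hσlim _) (Eventually.of_forall fun k i => hσ2 k _)
  exact (ENNReal.tendsto_ofReal ((Real.continuous_exp.tendsto _).comp ht)).liminf_eq.ge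

theorem aemeasurable_tsum (hlam : 0 ≤ lam) (hX : IsPoissonProcess lam X μ) {ψ : Plane → ℝ}
    (hm : Measurable ψ) (hi : Integrable ψ) : AEMeasurable (fun w => ∑' i, ψ (X i w)) μ := by
  let σ : ℕ → SimpleFunc Plane ℝ := SimpleFunc.approxOn ψ hm univ 0 (mem_univ _)
  have hσ2 : ∀ k y, |σ k y| ≤ 2 * |ψ y| := fun k y => by
    simpa [two_mul] using SimpleFunc.norm_approxOn_zero_le hm (mem_univ (0 : ℝ)) y k
  have hσi : ∀ k, Integrable (σ k) := fun k =>
    (hi.norm.const_mul 2).mono' (σ k).aestronglyMeasurable (ae_of_all _ fun y => hσ2 k y)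
  refine aemeasurable_of_tendsto_metrizable_ae' (f := fun k w => ∑' i, σ k (X i w))
    (fun k => hX.aemeasurable_tsum_simpleFunc (hσi k)) ?_
  filter_upwards [hX.ae_summable hlam hm hi] with w hw
  exact tendsto_tsum_of_dominated_convergence (bound := fun i => 2 * |ψ (X i w)|)
    (hw.mul_left 2) (fun i => SimpleFunc.tendsto_approxOn hm (mem_univ _) (by simp))
    (Eventually.of_forall fun k i => hσ2 k _)

/-- Upper bound for the Laplace functional of a signed function. -/
theorem lintegral_exp_le [IsProbabilityMeasure μ] (hlam : 0 ≤ lam) (hX : IsPoissonProcess lam X μ)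
    {ψ : Plane → ℝ} (hm : Measurable ψ) (hi : Integrable ψ) {M : ℝ} (hM : ∀ y, ψ y ≤ M) :
    ∫⁻ w, ENNReal.ofReal (Real.exp (∑' i, ψ (X i w))) ∂μ ≤
      ENNReal.ofReal (Real.exp (lam * ∫ y, (Real.exp (ψ y) - 1))) := by
  simpa using hX.setLIntegral_exp_le hlam .empty .empty (by simp) (by simp)
    (disjoint_empty ∅) .univ .univ hm hi hM (by simp) (by simp)

theorem measure_count_eq_zero (hlam : 0 ≤ lam) (hX : IsPoissonProcess lam X μ) {B : Set Plane}
    (hB : MeasurableSet B) (hv : volume B ≠ ∞) :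
    μ {w | pointMeasure (fun i => X i w) B = 0} =
      ENNReal.ofReal (Real.exp (-(lam * volume.real B))) := by
  rw [(hX.count_law B hB hv).measure_eq (p := fun t => t = 0) (measurableSet_singleton 0),
    Measure.map_apply (by fun_prop) (by exact measurableSet_singleton 0)]
  have : (Nat.cast : ℕ → ℝ≥0∞) ⁻¹' {x | x = 0} = {0} := by ext; simp
  rw [this, poissonMeasure_singleton, Real.coe_toNNReal _ (by positivity)]
  simp [measureReal_def]

theorem measure_count_ne_zero [IsProbabilityMeasure μ] (hlam : 0 ≤ lam)
    (hX : IsPoissonProcess lam X μ) {B : Set Plane} (hB : MeasurableSet B)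
    (hv : volume B ≠ ∞) :
    μ {w | pointMeasure (fun i => X i w) B ≠ 0} =
      1 - ENNReal.ofReal (Real.exp (-(lam * volume.real B))) := by
  rw [← hX.measure_count_eq_zero hlam hB hv]
  exact prob_compl_eq_one_sub (hX.measurable_count hB (measurableSet_singleton 0))

/-- 1 - e^(-m) (1 + m) ≤ m ^ 2 since e^(-m) ≥ 1 - m. The quadratic order makes a union bound over
thin annuli vanish. -/
theorem measure_two_le_count (hlam : 0 ≤ lam) (hX : IsPoissonProcess lam X μ) {B : Set Plane}
    (hB : MeasurableSet B) (hv : volume B ≠ ∞) :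
    μ {w | 2 ≤ pointMeasure (fun i => X i w) B} ≤
      ENNReal.ofReal ((lam * volume.real B) ^ 2) := by
  rw [measureReal_def]
  have hm : 0 ≤ lam * (volume B).toReal := by positivity
  have hs : MeasurableSet {t : ℝ≥0∞ | 2 ≤ t} := measurableSet_Ici
  rw [(hX.count_law B hB hv).measure_eq (p := fun t => 2 ≤ t) hs,
    Measure.map_apply (by fun_prop) hs]
  have : (Nat.cast : ℕ → ℝ≥0∞) ⁻¹' {x | 2 ≤ x} = (({0, 1} : Finset ℕ) : Set ℕ)ᶜ := by
    ext n
    have : (2 : ℝ≥0∞) ≤ n ↔ 2 ≤ n := by exact_mod_cast Iff.rfl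
    simp only [mem_preimage, mem_ofPred_eq, this, mem_compl_iff, SetLike.mem_coe,
      Finset.mem_insert, Finset.mem_singleton]
    lia
  rw [this, prob_compl_eq_one_sub (Finset.measurableSet _), ← sum_measure_singleton,
    Finset.sum_pair (by norm_num), poissonMeasure_singleton, poissonMeasure_singleton,
    Real.coe_toNNReal _ hm, ← ENNReal.ofReal_add (by positivity) (by positivity),
    ← ENNReal.ofReal_one, ← ENNReal.ofReal_sub _ (by positivity)]
  refine ENNReal.ofReal_le_ofReal ?_
  have h := Real.add_one_le_exp (-(lam * (volume B).toReal))
  simp only [pow_zero, Nat.factorial_zero, Nat.factorial_one, pow_one, Nat.cast_one] at *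
  nlinarith

end IsPoissonProcess

/-! ### Annuli, good configurations and the nearest point. -/

/-- The half-open annulus of radii `a` and `b` around the origin. -/
def annulus (a b : ℝ) : Set Plane := Metric.ball 0 b \ Metric.ball 0 a

theorem mem_annulus {a b : ℝ} {y : Plane} : y ∈ annulus a b ↔ ‖y‖ < b ∧ a ≤ ‖y‖ := by
  simp [annulus]

theorem measurableSet_annulus (a b : ℝ) : MeasurableSet (annulus a b) :=
  measurableSet_ball.diff measurableSet_ball

theorem volume_annulus_ne_top (a b : ℝ) : volume (annulus a b) ≠ ∞ :=
  ((measure_mono sdiff_subset).trans_lt measure_ball_lt_top).ne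

theorem volume_real_ball {r : ℝ} (hr : 0 ≤ r) (x : Plane) :
    volume.real (Metric.ball x r) = Real.pi * r ^ 2 := by
  rw [measureReal_def, EuclideanSpace.volume_ball_fin_two]
  simp [hr, mul_comm, Real.pi_pos.le]

theorem volume_real_annulus {a b : ℝ} (ha : 0 ≤ a) (hab : a ≤ b) :
    volume.real (annulus a b) = Real.pi * (b ^ 2 - a ^ 2) := by
  rw [annulus, measureReal_sdiff (Metric.ball_subset_ball hab) measurableSet_ball
    measure_ball_lt_top.ne, volume_real_ball ha, volume_real_ball (ha.trans hab)]
  ring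

/-- Configurations with summable weights `(1 + ‖x i‖) ^ (-α)`, no point at the origin, and
pairwise distinct distances to the origin. -/
structure IsGood (α : ℝ) (x : ℕ → Plane) : Prop where
  summable : Summable fun i => (1 + ‖x i‖) ^ (-α)
  ne_zero : ∀ i, x i ≠ 0
  norm_injective : Function.Injective fun i => ‖x i‖

/-- By summability only finitely many points have weight at least that of `x 0`, that is, lie no
farther from the origin; among them a minimum is attained. -/
theorem IsGood.exists_nearest {α : ℝ} (hα : 0 < α) {x : ℕ → Plane} (hx : IsGood α x) :
    ∃ i, ∀ j, ‖x i‖ ≤ ‖x j‖ := by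
  have h := hx.summable.tendsto_cofinite_zero.eventually_lt_const
    (u := (1 + ‖x 0‖) ^ (-α)) (by positivity)
  rw [Filter.eventually_cofinite] at h
  obtain ⟨i, hi, hmin⟩ := h.exists_minimalFor (fun i => ‖x i‖) _ ⟨0, by simp⟩
  refine ⟨i, fun j => ?_⟩
  by_cases hj : (1 + ‖x j‖) ^ (-α) < (1 + ‖x 0‖) ^ (-α)
  · have h0 : ‖x 0‖ < ‖x j‖ := by
      by_contra! hle
      exact hj.not_ge (Real.rpow_le_rpow_of_nonpos (by positivity) (by linarith) (by linarith))
    rcases le_total ‖x i‖ ‖x 0‖ with h1 | h1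
    · exact h1.trans h0.le
    · exact (hmin (j := 0) (by simp) h1).trans h0.le
  · rcases le_total ‖x i‖ ‖x j‖ with h1 | h1
    · exact h1
    · exact hmin hj h1

theorem IsGood.norm_nearest_le {α : ℝ} (hα : 0 < α) {x : ℕ → Plane} (hx : IsGood α x) (j : ℕ) :
    ‖x (nearest x)‖ ≤ ‖x j‖ :=
  Nat.sInf_mem (s := {i | ∀ j, ‖x i‖ ≤ ‖x j‖}) (hx.exists_nearest hα) j

theorem IsGood.norm_nearest_lt {α : ℝ} (hα : 0 < α) {x : ℕ → Plane} (hx : IsGood α x) {j : ℕ}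
    (hj : j ≠ nearest x) : ‖x (nearest x)‖ < ‖x j‖ :=
  (hx.norm_nearest_le hα j).lt_of_ne fun h => hj (hx.norm_injective h).symm

theorem measurable_nearest : Measurable nearest := by
  have hm : ∀ i, MeasurableSet {x : ℕ → Plane | ∀ j, ‖x i‖ ≤ ‖x j‖} := fun i => by
    rw [ofPred_forall]
    exact MeasurableSet.iInter fun j => measurableSet_le
      (measurable_pi_apply i).norm (measurable_pi_apply j).norm
  refine measurable_to_countable' fun n => ?_
  -- `sInf ∅ = 0`, so configurations without a closest point belong to the fibre over 0.
  have : nearest ⁻¹' {n} =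
      ({x | ∀ j, ‖x n‖ ≤ ‖x j‖} ∩ ⋂ m : Fin n, {x | ∀ j, ‖x m‖ ≤ ‖x j‖}ᶜ) ∪
      (if n = 0 then ⋂ m, {x | ∀ j, ‖x m‖ ≤ ‖x j‖}ᶜ else ∅) := by
    ext x
    simp only [mem_preimage, mem_singleton_iff, mem_union, mem_inter_iff, mem_iInter,
      mem_compl_iff, mem_ofPred_eq]
    constructor
    · intro h
      by_cases hne : {i | ∀ j, ‖x i‖ ≤ ‖x j‖}.Nonempty
      · left
        exact ⟨by rw [← h]; exact Nat.sInf_mem hne,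
          fun m hm => (Nat.sInf_le (s := {i | ∀ j, ‖x i‖ ≤ ‖x j‖}) hm).not_gt
            (m.2.trans_eq h.symm)⟩
      · right
        rw [not_nonempty_iff_eq_empty] at hne
        have h0 : n = 0 := by rw [← h, nearest, hne, Nat.sInf_empty]
        rw [if_pos h0, mem_iInter]
        intro m hm
        exact (hne ▸ hm : m ∈ (∅ : Set ℕ))
    · rintro (⟨h1, h2⟩ | h)
      · refine le_antisymm (Nat.sInf_le h1) ?_
        by_contra! hlt
        exact h2 ⟨_, hlt⟩ (Nat.sInf_mem (s := {i | ∀ j, ‖x i‖ ≤ ‖x j‖}) ⟨n, h1⟩)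
      · split_ifs at h with h0
        · rw [mem_iInter] at h
          have he : {i | ∀ j, ‖x i‖ ≤ ‖x j‖} = ∅ := eq_empty_of_forall_notMem h
          rw [nearest, he, Nat.sInf_empty, h0]
        · exact h.elim
  rw [this]
  refine ((hm n).inter (MeasurableSet.iInter fun m : Fin n => (hm m).compl)).union ?_
  split_ifs
  · exact MeasurableSet.iInter fun m => (hm m).compl
  · exact MeasurableSet.empty

theorem integrable_one_add_norm_rpow {α : ℝ} (hα : 2 < α) :
    Integrable fun y : Plane => (1 + ‖y‖) ^ (-α) :=
  integrable_one_add_norm (by simpa using hα)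

theorem two_le_pointMeasure {x : ℕ → Plane} {B : Set Plane} (hB : MeasurableSet B) {i j : ℕ}
    (hij : i ≠ j) (hi : x i ∈ B) (hj : x j ∈ B) : 2 ≤ pointMeasure x B := by
  rw [pointMeasure_apply x hB]
  refine le_trans ?_ (ENNReal.sum_le_tsum {i, j})
  rw [Finset.sum_pair hij]
  simp [hi, hj, one_add_one_eq_two]

/-! ### A Poisson process is almost surely a good configuration. -/

namespace IsPoissonProcess

variable {W : Type*} [MeasurableSpace W] {μ : Measure W} {lam : ℝ} {X : ℕ → W → Plane}

theorem ae_ne_zero [IsProbabilityMeasure μ] (hlam : 0 ≤ lam) (hX : IsPoissonProcess lam X μ) :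
    ∀ᵐ w ∂μ, ∀ i, X i w ≠ 0 := by
  have h := hX.measure_count_ne_zero hlam (measurableSet_singleton (0 : Plane)) (by simp)
  simp only [measureReal_def, measure_singleton, ENNReal.toReal_zero, mul_zero, neg_zero, Real.exp_zero,
    ENNReal.ofReal_one,
    tsub_self] at h
  filter_upwards [measure_eq_zero_iff_ae_notMem.1 h] with w hw i hi
  exact (pointMeasure_eq_zero_iff _ (measurableSet_singleton 0)).1 (not_not.1 hw) i hi

/-- Two points of equal norm below `K` share one of the K n annuli of width 1 / n. Each has area at
most 2 π K / n, so holds two points with probability O(1 / n ^ 2). -/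
theorem measure_norm_eq_lt (hlam : 0 ≤ lam) (hX : IsPoissonProcess lam X μ) (K : ℕ) {n : ℕ}
    (hn : 0 < n) :
    μ {w | ∃ i j, i ≠ j ∧ ‖X i w‖ = ‖X j w‖ ∧ ‖X i w‖ < K} ≤
      ENNReal.ofReal (4 * lam ^ 2 * Real.pi ^ 2 * K ^ 3 / n) := by
  have hn' : (0 : ℝ) < n := by exact_mod_cast hn
  have hsub : {w | ∃ i j, i ≠ j ∧ ‖X i w‖ = ‖X j w‖ ∧ ‖X i w‖ < K} ⊆
      ⋃ k ∈ Finset.range (K * n), {w | 2 ≤ pointMeasure (fun i => X i w)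
        (annulus (k / n) ((k + 1) / n))} := by
    rintro w ⟨i, j, hij, he, hK⟩
    have hk1 := Nat.floor_le (a := ‖X i w‖ * n) (by positivity)
    have hk2 := Nat.lt_floor_add_one (‖X i w‖ * n)
    simp only [mem_iUnion, Finset.mem_range, mem_ofPred_eq]
    refine ⟨⌊‖X i w‖ * n⌋₊, ?_, two_le_pointMeasure (measurableSet_annulus _ _) hij ?_ ?_⟩
    · rw [Nat.floor_lt (by positivity)]
      push_cast
      exact mul_lt_mul_of_pos_right hK hn'
    · exact mem_annulus.2 ⟨(lt_div_iff₀ hn').2 hk2, (div_le_iff₀ hn').2 hk1⟩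
    · exact mem_annulus.2 ⟨(lt_div_iff₀ hn').2 (he ▸ hk2), (div_le_iff₀ hn').2 (he ▸ hk1)⟩
  refine (measure_mono hsub).trans ((measure_biUnion_finset_le _ _).trans ?_)
  calc _ ≤ ∑ k ∈ Finset.range (K * n), ENNReal.ofReal ((lam * (Real.pi * (2 * K / n))) ^ 2) := by
        refine Finset.sum_le_sum fun k hk => ?_
        refine (hX.measure_two_le_count hlam (measurableSet_annulus _ _)
          (volume_annulus_ne_top _ _)).trans (ENNReal.ofReal_le_ofReal ?_)
        rw [volume_real_annulus (by positivity) (by gcongr; linarith)]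
        have hk' : (k : ℝ) + 1 ≤ K * n := by exact_mod_cast Finset.mem_range.1 hk
        have h1 : ((k + 1 : ℝ) / n) ^ 2 - (k / n) ^ 2 = (2 * k + 1) / n ^ 2 := by
          field_simp; ring
        have h2 : (2 * K / n : ℝ) = 2 * (K * n) / n ^ 2 := by field_simp
        rw [h1, h2]
        gcongr
        linarith
    _ = _ := by
        rw [Finset.sum_const, Finset.card_range, nsmul_eq_mul, ← ENNReal.ofReal_natCast,
          ← ENNReal.ofReal_mul (by positivity)]
        congr 1
        push_cast
        field_simp
        ring

theorem ae_norm_injective (hlam : 0 ≤ lam) (hX : IsPoissonProcess lam X μ) :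
    ∀ᵐ w ∂μ, Function.Injective fun i => ‖X i w‖ := by
  have h : ∀ K : ℕ, μ {w | ∃ i j, i ≠ j ∧ ‖X i w‖ = ‖X j w‖ ∧ ‖X i w‖ < K} = 0 := by
    intro K
    refine le_antisymm (ge_of_tendsto (x := atTop) (f := fun n : ℕ =>
      ENNReal.ofReal (4 * lam ^ 2 * Real.pi ^ 2 * K ^ 3 / n)) ?_ ?_) zero_le
    · simpa using ENNReal.tendsto_ofReal (tendsto_const_div_atTop_nhds_zero_nat
        (4 * lam ^ 2 * Real.pi ^ 2 * K ^ 3))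
    · filter_upwards [eventually_gt_atTop 0] with n hn using hX.measure_norm_eq_lt hlam K hn
  filter_upwards [ae_all_iff.2 fun K => measure_eq_zero_iff_ae_notMem.1 (h K)] with w hw i j hij
  by_contra hne
  obtain ⟨K, hK⟩ := exists_nat_gt ‖X i w‖
  exact hw K ⟨i, j, hne, hij, hK⟩

theorem ae_isGood [IsProbabilityMeasure μ] (hlam : 0 ≤ lam) (hX : IsPoissonProcess lam X μ)
    {α : ℝ} (hα : 2 < α) : ∀ᵐ w ∂μ, IsGood α fun i => X i w := by
  have hi := integrable_one_add_norm_rpow hα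
  filter_upwards [hX.ae_ne_zero hlam, hX.ae_norm_injective hlam,
    hX.ae_summable hlam (by fun_prop) hi] with w h0 h1 h2
  refine ⟨h2.congr fun i => abs_of_nonneg (by positivity), h0, h1⟩

end IsPoissonProcess

/-! ### The density of the serving distance. -/

theorem servingPDF_nonneg {lam z : ℝ} (hlam : 0 ≤ lam) (hz : 0 ≤ z) : 0 ≤ servingPDF lam z := by
  unfold servingPDF
  have := Real.pi_pos
  positivity

theorem continuous_servingPDF (lam : ℝ) : Continuous (servingPDF lam) := by
  unfold servingPDF
  fun_prop

theorem integrable_servingPDF {lam : ℝ} (hlam : 0 < lam) : Integrable (servingPDF lam) := by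
  have h := (integrable_mul_exp_neg_mul_sq (b := Real.pi * lam) (by positivity)).const_mul
    (2 * Real.pi * lam)
  refine h.congr (ae_of_all _ fun z => ?_)
  simp only [servingPDF]
  rw [neg_mul]
  ring

/-- The right side is the probability that the disc of radius `a` is empty times the probability
that the annulus up to `b` is not: the form in which grid events produce the density. -/
theorem lintegral_servingPDF {lam a b : ℝ} (hlam : 0 ≤ lam) (ha : 0 ≤ a) (hab : a ≤ b) :
    ∫⁻ z in Ico a b, ENNReal.ofReal (servingPDF lam z) =
      ENNReal.ofReal (Real.exp (-(lam * (Real.pi * a ^ 2)))) *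
        (1 - ENNReal.ofReal (Real.exp (-(lam * (Real.pi * (b ^ 2 - a ^ 2)))))) := by
  have hF : ∀ z, HasDerivAt (fun z => -Real.exp (-(Real.pi * lam * z ^ 2)))
      (servingPDF lam z) z := by
    intro z
    have h1 : HasDerivAt (fun z : ℝ => -(Real.pi * lam * z ^ 2))
        (-(Real.pi * lam * (2 * z))) z := by
      simpa using ((hasDerivAt_pow 2 z).const_mul (Real.pi * lam)).fun_neg
    refine h1.exp.neg.congr_deriv ?_
    simp only [servingPDF]
    ring
  have hI := intervalIntegral.integral_eq_sub_of_hasDerivAt (fun z _ => hF z)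
    ((continuous_servingPDF lam).intervalIntegrable a b)
  rw [setLIntegral_congr Ico_ae_eq_Ioc, ← ofReal_integral_eq_lintegral_ofReal,
    ← intervalIntegral.integral_of_le hab, hI, ← ENNReal.ofReal_one,
    ← ENNReal.ofReal_sub _ (Real.exp_pos _).le, ← ENNReal.ofReal_mul (Real.exp_pos _).le,
    mul_sub, ← Real.exp_add]
  · congr 1
    ring_nf
  · exact ((continuous_servingPDF lam).intervalIntegrable a b).1
  · refine (ae_restrict_iff' measurableSet_Ioc).2 (ae_of_all _ fun z hz => ?_)
    exact servingPDF_nonneg hlam (ha.trans hz.1.le)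

/-! ### Discretisation of the nearest distance. -/

/-- A family of radial potentials `Ψ z`, indexed by the distance `z` of the nearest point and
evaluated at distances `v ≥ z`, with uniform polynomial decay. -/
structure IsRadialPotential (α : ℝ) (Ψ : ℝ → ℝ → ℝ) : Prop where
  measurable : ∀ z, 0 < z → Measurable ((Ici z).indicator (Ψ z))
  continuousOn : ∀ v, 0 < v → ContinuousOn (fun z => Ψ z v) (Ioc 0 v)
  bound : ∀ a b, 0 < a → a < b → ∃ K, 0 ≤ K ∧
    ∀ z ∈ Icc a b, ∀ v, z ≤ v → |Ψ z v| ≤ K * (1 + v) ^ (-α)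

/-- The potential with index rounded down to `k / n`, supported at distances at least
`(k + 1) / n`. -/
noncomputable def gridPotential (Ψ : ℝ → ℝ → ℝ) (n k : ℕ) (y : Plane) : ℝ :=
  if ((k : ℝ) + 1) / n ≤ ‖y‖ then Ψ (k / n) ‖y‖ else 0

theorem div_le_succ_div (n k : ℕ) : (k : ℝ) / n ≤ (k + 1) / n := by
  gcongr; linarith

theorem IsRadialPotential.measurable_gridPotential {α : ℝ} {Ψ : ℝ → ℝ → ℝ}
    (hΨ : IsRadialPotential α Ψ) {n k : ℕ} (h : 0 < (k : ℝ) / n) :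
    Measurable (gridPotential Ψ n k) := by
  have : gridPotential Ψ n k = {y : Plane | ((k : ℝ) + 1) / n ≤ ‖y‖}.indicator
      (fun y => (Ici ((k : ℝ) / n)).indicator (Ψ (k / n)) ‖y‖) := by
    ext y
    simp only [gridPotential, indicator, mem_ofPred_eq, mem_Ici]
    split_ifs with h1 h2
    · rfl
    · exact absurd ((div_le_succ_div n k).trans h1) h2
    · rfl
  rw [this]
  exact ((hΨ.measurable _ h).comp measurable_norm).indicator
    (measurableSet_le measurable_const measurable_norm)

theorem abs_gridPotential_le {α a b K : ℝ} {Ψ : ℝ → ℝ → ℝ} (hK : 0 ≤ K)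
    (hb : ∀ z ∈ Icc a b, ∀ v, z ≤ v → |Ψ z v| ≤ K * (1 + v) ^ (-α)) {n k : ℕ}
    (h : (k : ℝ) / n ∈ Icc a b) (y : Plane) :
    |gridPotential Ψ n k y| ≤ K * (1 + ‖y‖) ^ (-α) := by
  unfold gridPotential
  split_ifs with h1
  · exact hb _ h _ ((div_le_succ_div n k).trans h1)
  · rw [abs_zero]; positivity

theorem tendsto_floor_mul_div (z : ℝ) (hz : 0 ≤ z) :
    Tendsto (fun n : ℕ => (⌊z * n⌋₊ : ℝ) / n) atTop (𝓝 z) :=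
  (tendsto_nat_floor_mul_div_atTop hz).comp tendsto_natCast_atTop_atTop

theorem tendsto_floor_mul_add_one_div (z : ℝ) (hz : 0 ≤ z) :
    Tendsto (fun n : ℕ => ((⌊z * n⌋₊ : ℝ) + 1) / n) atTop (𝓝 z) := by
  simpa [add_div] using (tendsto_floor_mul_div z hz).add tendsto_one_div_atTop_nhds_zero_nat

theorem floor_mul_div_le {z : ℝ} (hz : 0 ≤ z) (n : ℕ) : (⌊z * n⌋₊ : ℝ) / n ≤ z := by
  rcases n.eq_zero_or_pos with rfl | hn
  · simpa using hz
  · exact (div_le_iff₀ (by exact_mod_cast hn)).2 (Nat.floor_le (by positivity))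

theorem lt_floor_mul_add_one_div (z : ℝ) {n : ℕ} (hn : 0 < n) :
    z < ((⌊z * n⌋₊ : ℝ) + 1) / n :=
  (lt_div_iff₀ (by exact_mod_cast hn)).2 (Nat.lt_floor_add_one _)

/-- Rounding down keeps the index in (0, ‖y‖], the range where continuity in the index is assumed.
-/
theorem IsRadialPotential.tendsto_gridPotential {α : ℝ} {Ψ : ℝ → ℝ → ℝ}
    (hΨ : IsRadialPotential α Ψ) {z : ℝ} (hz : 0 < z) {y : Plane} (hy : z < ‖y‖) :
    Tendsto (fun n : ℕ => gridPotential Ψ n ⌊z * n⌋₊ y) atTop (𝓝 (Ψ z ‖y‖)) := by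
  have h1 := (tendsto_floor_mul_add_one_div z hz.le).eventually_lt_const hy
  have h2 := (tendsto_floor_mul_div z hz.le).eventually_const_lt hz
  have h3 : Tendsto (fun n : ℕ => Ψ ((⌊z * n⌋₊ : ℝ) / n) ‖y‖) atTop (𝓝 (Ψ z ‖y‖)) := by
    refine Tendsto.comp (hΨ.continuousOn ‖y‖ (hz.trans hy) z ⟨hz, hy.le⟩)
      (tendsto_nhdsWithin_iff.2 ⟨tendsto_floor_mul_div z hz.le, ?_⟩)
    filter_upwards [h2] with n hn using ⟨hn, (floor_mul_div_le hz.le n).trans hy.le⟩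
  refine h3.congr' ?_
  filter_upwards [h1] with n hn
  rw [gridPotential, if_pos hn.le]

theorem gridPotential_eq_zero {Ψ : ℝ → ℝ → ℝ} {z : ℝ} {n : ℕ} (hn : 0 < n) {y : Plane}
    (hy : ‖y‖ ≤ z) : gridPotential Ψ n ⌊z * n⌋₊ y = 0 :=
  if_neg (not_le.2 (hy.trans_lt (lt_floor_mul_add_one_div z hn)))

theorem IsRadialPotential.tendsto_integral_gridPotential {α : ℝ} (hα : 2 < α) {Ψ : ℝ → ℝ → ℝ}
    (hΨ : IsRadialPotential α Ψ) {z : ℝ} (hz : 0 < z) :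
    Tendsto (fun n : ℕ => ∫ y, (Real.exp (gridPotential Ψ n ⌊z * n⌋₊ y) - 1)) atTop
      (𝓝 (∫ y in {y : Plane | z ≤ ‖y‖}, (Real.exp (Ψ z ‖y‖) - 1))) := by
  obtain ⟨K, hK, hb⟩ := hΨ.bound (z / 2) (2 * z) (by positivity) (by linarith)
  have he : ∀ᶠ n : ℕ in atTop, (⌊z * n⌋₊ : ℝ) / n ∈ Icc (z / 2) (2 * z) :=
    (tendsto_floor_mul_div z hz.le).eventually (Icc_mem_nhds (by linarith) (by linarith))
  rw [← integral_indicator (measurableSet_le measurable_const measurable_norm)]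
  refine tendsto_integral_filter_of_dominated_convergence
    (fun y => Real.exp K * (K * (1 + ‖y‖) ^ (-α))) ?_ ?_ ?_ ?_
  · filter_upwards [he] with n hn
    exact ((Real.measurable_exp.comp (hΨ.measurable_gridPotential
      ((half_pos hz).trans_le hn.1))).sub_const 1).aestronglyMeasurable
  · filter_upwards [he] with n hn
    refine ae_of_all _ fun y => ?_
    have h := abs_gridPotential_le hK hb hn y
    have h1 : (1 + ‖y‖) ^ (-α) ≤ 1 := Real.rpow_le_one_of_one_le_of_nonpos
      (by linarith [norm_nonneg y]) (by linarith)
    refine (abs_exp_sub_one_le_of_le hK ?_).trans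
      (mul_le_mul_of_nonneg_left h (Real.exp_pos _).le)
    nlinarith [le_abs_self (gridPotential Ψ n ⌊z * n⌋₊ y)]
  · exact ((integrable_one_add_norm_rpow hα).const_mul K).const_mul _
  -- On the sphere of radius `z` the approximants are 0 while the limit need not be; the sphere is
  -- null.
  · have hs : ∀ᵐ y : Plane, y ∉ Metric.sphere (0 : Plane) z :=
      measure_eq_zero_iff_ae_notMem.1 (Measure.addHaar_sphere volume 0 z)
    filter_upwards [hs] with y hy
    rw [mem_sphere_zero_iff_norm] at hy
    rcases lt_or_gt_of_ne hy with h | h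
    · rw [indicator_of_notMem (by simpa using h)]
      refine tendsto_const_nhds.congr' ?_
      filter_upwards [eventually_gt_atTop 0] with n hn
      rw [gridPotential_eq_zero hn h.le, Real.exp_zero, sub_self]
    · rw [indicator_of_mem (by simpa using h.le)]
      exact ((Real.continuous_exp.tendsto _).comp
        (hΨ.tendsto_gridPotential hz h)).sub_const 1

/-- The event that the distance of the nearest point of `x` lies in `[k / n, (k + 1) / n)`. -/
def gridEvent (n k : ℕ) : Set (ℕ → Plane) :=
  {x | pointMeasure x (Metric.ball 0 ((k : ℝ) / n)) ∈ ({0} : Set ℝ≥0∞) ∧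
    pointMeasure x (annulus (k / n) ((k + 1) / n)) ∈ ({0}ᶜ : Set ℝ≥0∞)}

theorem IsGood.mem_gridEvent_iff {α : ℝ} (hα : 0 < α) {x : ℕ → Plane} (hx : IsGood α x) {n : ℕ}
    (hn : 0 < n) (k : ℕ) : x ∈ gridEvent n k ↔ k = ⌊‖x (nearest x)‖ * n⌋₊ := by
  have hn' : (0 : ℝ) < n := by exact_mod_cast hn
  rw [eq_comm, Nat.floor_eq_iff (by positivity), ← div_le_iff₀ hn', ← lt_div_iff₀ hn']
  simp only [gridEvent, mem_ofPred_eq, mem_compl_iff, mem_singleton_iff,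
    pointMeasure_eq_zero_iff x measurableSet_ball,
    pointMeasure_eq_zero_iff x (measurableSet_annulus _ _), mem_annulus, mem_ball_zero_iff]
  push Not
  constructor
  · rintro ⟨h1, i, h2, h3⟩
    exact ⟨h1 _, (hx.norm_nearest_le hα i).trans_lt h2⟩
  · rintro ⟨h1, h2⟩
    exact ⟨fun i => h1.trans (hx.norm_nearest_le hα i), _, h2, h1⟩

theorem IsRadialPotential.tendsto_tsum_gridPotential {α : ℝ} (hα : 0 < α) {Ψ : ℝ → ℝ → ℝ}
    (hΨ : IsRadialPotential α Ψ) {x : ℕ → Plane} (hx : IsGood α x) :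
    Tendsto (fun n : ℕ => ∑' i, gridPotential Ψ n ⌊‖x (nearest x)‖ * n⌋₊ (x i)) atTop
      (𝓝 (∑' i, if i = nearest x then 0 else Ψ ‖x (nearest x)‖ ‖x i‖)) := by
  have hz : 0 < ‖x (nearest x)‖ := norm_pos_iff.2 (hx.ne_zero _)
  set z := ‖x (nearest x)‖
  obtain ⟨K, hK, hb⟩ := hΨ.bound (z / 2) (2 * z) (by positivity) (by linarith)
  have he : ∀ᶠ n : ℕ in atTop, (⌊z * n⌋₊ : ℝ) / n ∈ Icc (z / 2) (2 * z) :=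
    (tendsto_floor_mul_div z hz.le).eventually (Icc_mem_nhds (by linarith) (by linarith))
  refine tendsto_tsum_of_dominated_convergence (hx.summable.mul_left K) (fun i => ?_) ?_
  · split_ifs with hi
    · subst hi
      refine tendsto_const_nhds.congr' ?_
      filter_upwards [eventually_gt_atTop 0] with n hn
      rw [gridPotential_eq_zero hn le_rfl]
    · exact hΨ.tendsto_gridPotential hz (hx.norm_nearest_lt hα hi)
  · filter_upwards [he] with n hn i using abs_gridPotential_le hK hb hn _

/-- The approximation of `C z * exp S` at index `k / n`, cut off outside `[a, b]`. -/
noncomputable def gridWeight (a b : ℝ) (C : ℝ → ℝ) (n k : ℕ) (S : ℝ) : ℝ≥0∞ :=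
  (Icc a b).indicator (fun t => ENNReal.ofReal (C t * Real.exp S)) ((k : ℝ) / n)

theorem tendsto_gridWeight {a b : ℝ} {C : ℝ → ℝ} (ha : 0 < a) (hC : ContinuousOn C (Ioi 0))
    {z : ℝ} (hz : z ∈ Ioo a b) {S : ℕ → ℝ} {T : ℝ} (hS : Tendsto S atTop (𝓝 T)) :
    Tendsto (fun n => gridWeight a b C n ⌊z * n⌋₊ (S n)) atTop
      (𝓝 (ENNReal.ofReal (C z * Real.exp T))) := by
  have hz0 : 0 < z := ha.trans hz.1
  have hq := tendsto_floor_mul_div z hz0.le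
  refine Tendsto.congr' ?_ (ENNReal.tendsto_ofReal
    (((hC.continuousAt (Ioi_mem_nhds hz0)).tendsto.comp hq).mul
      ((Real.continuous_exp.tendsto T).comp hS)))
  filter_upwards [hq.eventually (Icc_mem_nhds hz.1 hz.2)] with n hn
  rw [gridWeight, indicator_of_mem (show (⌊z * n⌋₊ : ℝ) / n ∈ Icc a b from hn)]
  rfl

theorem iUnion_Ico_div {n : ℕ} (hn : 0 < n) :
    ⋃ k : ℕ, Ico ((k : ℝ) / n) ((k + 1) / n) = Ici 0 := by
  have hn' : (0 : ℝ) < n := by exact_mod_cast hn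
  ext z
  simp only [mem_iUnion, mem_Ico, mem_Ici]
  constructor
  · rintro ⟨k, h1, h2⟩
    exact le_trans (by positivity) h1
  · intro hz
    exact ⟨⌊z * n⌋₊, floor_mul_div_le hz n, lt_floor_mul_add_one_div z hn⟩

theorem floor_mul_eq_of_mem_Ico {n k : ℕ} (hn : 0 < n) {z : ℝ}
    (hz : z ∈ Ico ((k : ℝ) / n) ((k + 1) / n)) : ⌊z * n⌋₊ = k := by
  have hn' : (0 : ℝ) < n := by exact_mod_cast hn
  have h0 : 0 ≤ z := le_trans (by positivity) hz.1
  exact (Nat.floor_eq_iff (by positivity)).2 ⟨(div_le_iff₀ hn').1 hz.1, (lt_div_iff₀ hn').1 hz.2⟩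

theorem tsum_mul_lintegral_servingPDF {lam : ℝ} {n : ℕ} (hn : 0 < n) (G : ℕ → ℝ≥0∞) :
    ∑' k : ℕ, G k * ∫⁻ z in Ico ((k : ℝ) / n) ((k + 1) / n), ENNReal.ofReal (servingPDF lam z) =
      ∫⁻ z in Ioi (0 : ℝ), G ⌊z * n⌋₊ * ENNReal.ofReal (servingPDF lam z) := by
  have hn' : (0 : ℝ) < n := by exact_mod_cast hn
  rw [setLIntegral_congr (Ioi_ae_eq_Ici (a := (0 : ℝ))), ← iUnion_Ico_div hn,
    lintegral_iUnion (fun k => measurableSet_Ico)]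
  · refine tsum_congr fun k => ?_
    rw [← lintegral_const_mul _ (continuous_servingPDF lam).measurable.ennreal_ofReal]
    refine setLIntegral_congr_fun measurableSet_Ico fun z hz => ?_
    simp only [floor_mul_eq_of_mem_Ico hn hz]
  · intro k l hkl
    refine Set.disjoint_left.2 fun z hk hl => hkl ?_
    rw [← floor_mul_eq_of_mem_Ico hn hk, floor_mul_eq_of_mem_Ico hn hl]

/-- A good configuration lies in exactly one grid event for each `n`, so the sum over `k` reduces to
the term at the rounded nearest distance. -/
theorem IsRadialPotential.tendsto_tsum_gridWeight {α a b : ℝ} (hα : 0 < α) (ha : 0 < a)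
    {C : ℝ → ℝ} (hC : ContinuousOn C (Ioi 0)) {Ψ : ℝ → ℝ → ℝ} (hΨ : IsRadialPotential α Ψ)
    {W : Type*} {X : ℕ → W → Plane} {w : W} (hg : IsGood α fun i => X i w)
    (hw : ‖X (nearest fun i => X i w) w‖ ∈ Ioo a b) :
    Tendsto (fun n => ∑' k, {w | (fun i => X i w) ∈ gridEvent n k}.indicator
        (fun w => gridWeight a b C n k (∑' i, gridPotential Ψ n k (X i w))) w) atTop
      (𝓝 (ENNReal.ofReal (C ‖X (nearest fun i => X i w) w‖ * Real.exp (∑' i,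
        if i = nearest (fun i => X i w) then 0
        else Ψ ‖X (nearest fun i => X i w) w‖ ‖X i w‖)))) := by
  refine Tendsto.congr' ?_ (tendsto_gridWeight ha hC hw (hΨ.tendsto_tsum_gridPotential hα hg))
  filter_upwards [eventually_gt_atTop 0] with n hn
  have he := fun k => hg.mem_gridEvent_iff hα hn k
  conv_rhs => rw [tsum_eq_single ⌊‖X (nearest fun i => X i w) w‖ * n⌋₊
    fun k hk => indicator_of_notMem (by exact fun hw => hk ((he k).1 hw)) _]
  rw [indicator_of_mem (by exact (he _).2 rfl)]

/-- Uniform domination in `n` and `k`: the weight vanishes off [a, b], and on [a, b] all potentials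
share one decay constant. -/
theorem IsRadialPotential.gridWeight_le {α a b lam : ℝ} (hlam : 0 ≤ lam) (hα : 2 < α)
    (ha : 0 < a) (hab : a < b) {C : ℝ → ℝ} (hC0 : ∀ z, 0 < z → 0 ≤ C z)
    (hC : ContinuousOn C (Ioi 0)) {Ψ : ℝ → ℝ → ℝ} (hΨ : IsRadialPotential α Ψ) :
    ∃ B : ℝ, ∀ n k, gridWeight a b C n k
      (lam * ∫ y, (Real.exp (gridPotential Ψ n k y) - 1)) ≤ ENNReal.ofReal B := by
  obtain ⟨K, hK, hb⟩ := hΨ.bound a b ha hab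
  obtain ⟨B, hB⟩ := isCompact_Icc.bddAbove_image (hC.mono fun z hz => ha.trans_le hz.1 :
    ContinuousOn C (Icc a b))
  refine ⟨B * Real.exp (lam * ∫ y : Plane, Real.exp K * (K * (1 + ‖y‖) ^ (-α))),
    fun n k => ?_⟩
  by_cases hk : (k : ℝ) / n ∈ Icc a b
  · have hQ : ∫ y, (Real.exp (gridPotential Ψ n k y) - 1) ≤
        ∫ y : Plane, Real.exp K * (K * (1 + ‖y‖) ^ (-α)) := by
      refine (le_abs_self _).trans (norm_integral_le_of_norm_le
        (f := fun y => Real.exp (gridPotential Ψ n k y) - 1)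
        (((integrable_one_add_norm_rpow hα).const_mul K).const_mul (Real.exp K))
        (ae_of_all _ fun y => ?_))
      have h := abs_gridPotential_le hK hb hk y
      have h1 : (1 + ‖y‖) ^ (-α) ≤ 1 := Real.rpow_le_one_of_one_le_of_nonpos
        (by linarith [norm_nonneg y]) (by linarith)
      refine (abs_exp_sub_one_le_of_le hK ?_).trans
        (mul_le_mul_of_nonneg_left h (Real.exp_pos _).le)
      nlinarith [le_abs_self (gridPotential Ψ n k y)]
    simp only [gridWeight, indicator_of_mem hk]
    have hCB : C ((k : ℝ) / n) ≤ B := hB (mem_image_of_mem _ hk)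
    have hB0 : 0 ≤ B := (hC0 _ (ha.trans_le hk.1)).trans hCB
    gcongr
  · simp [gridWeight, hk]

theorem IsRadialPotential.tendsto_lintegral_gridWeight {α a b lam : ℝ} (hlam : 0 < lam)
    (hα : 2 < α) (ha : 0 < a) (hab : a < b) {C : ℝ → ℝ} (hC0 : ∀ z, 0 < z → 0 ≤ C z)
    (hC : ContinuousOn C (Ioi 0)) {Ψ : ℝ → ℝ → ℝ} (hΨ : IsRadialPotential α Ψ) :
    Tendsto (fun n : ℕ => ∫⁻ z in Ioi (0 : ℝ), gridWeight a b C n ⌊z * n⌋₊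
        (lam * ∫ y, (Real.exp (gridPotential Ψ n ⌊z * n⌋₊ y) - 1)) *
          ENNReal.ofReal (servingPDF lam z)) atTop
      (𝓝 (∫⁻ z in Ioi 0, (Ioo a b).indicator (fun z => ENNReal.ofReal (C z * Real.exp (lam *
          ∫ y in {y : Plane | z ≤ ‖y‖}, (Real.exp (Ψ z ‖y‖) - 1)))) z *
          ENNReal.ofReal (servingPDF lam z))) := by
  obtain ⟨B, hB⟩ := hΨ.gridWeight_le hlam.le hα ha hab hC0 hC
  refine tendsto_lintegral_of_dominated_convergence (fun z =>
    ENNReal.ofReal B * ENNReal.ofReal (servingPDF lam z)) (fun n => ?_) (fun n => ?_) ?_ ?_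
  · refine Measurable.mul ?_ (continuous_servingPDF lam).measurable.ennreal_ofReal
    exact (measurable_from_nat (f := fun k => gridWeight a b C n k
      (lam * ∫ y, (Real.exp (gridPotential Ψ n k y) - 1)))).comp
        (Nat.measurable_floor.comp (measurable_id.mul_const (n : ℝ)))
  · exact ae_of_all _ fun z => mul_le_mul_left (hB n _) _
  · rw [lintegral_const_mul' _ _ ENNReal.ofReal_ne_top]
    refine ENNReal.mul_ne_top ENNReal.ofReal_ne_top ?_
    have h := (integrable_servingPDF hlam).integrableOn (s := Ioi 0)
    rw [← ofReal_integral_eq_lintegral_ofReal h]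
    · exact ENNReal.ofReal_ne_top
    · exact (ae_restrict_iff' measurableSet_Ioi).2
        (ae_of_all _ fun z hz => servingPDF_nonneg hlam.le (le_of_lt hz))
  -- The cut-off to [a, b] converges everywhere except possibly at the two endpoints.
  · have hna : ∀ c : ℝ, ∀ᵐ z ∂(volume.restrict (Ioi (0 : ℝ))), z ≠ c := fun c =>
      ae_restrict_of_ae (by simp [ae_iff])
    filter_upwards [hna a, hna b, ae_restrict_mem measurableSet_Ioi] with z hza hzb hz0
    refine ENNReal.Tendsto.mul_const ?_ (Or.inr ENNReal.ofReal_ne_top)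
    by_cases hz : z ∈ Ioo a b
    · rw [indicator_of_mem hz]
      exact tendsto_gridWeight ha hC hz
        ((hΨ.tendsto_integral_gridPotential hα hz0).const_mul lam)
    · rw [indicator_of_notMem hz]
      have hz' : z ∈ (Icc a b)ᶜ := fun h => hz
        ⟨lt_of_le_of_ne h.1 (Ne.symm hza), lt_of_le_of_ne h.2 hzb⟩
      refine tendsto_const_nhds.congr' ?_
      filter_upwards [(tendsto_floor_mul_div z (le_of_lt hz0)).eventually
        (isClosed_Icc.isOpen_compl.mem_nhds hz')] with n hn
      exact (indicator_of_notMem hn _).symm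

theorem measurable_norm_nearest : Measurable fun x : ℕ → Plane => ‖x (nearest x)‖ := by
  intro S hS
  have : (fun x : ℕ → Plane => ‖x (nearest x)‖) ⁻¹' S =
      ⋃ n : ℕ, nearest ⁻¹' {n} ∩ (fun x : ℕ → Plane => ‖x n‖) ⁻¹' S := by
    ext x; simp
  rw [this]
  exact MeasurableSet.iUnion fun n => (measurable_nearest (measurableSet_singleton n)).inter
    ((measurable_pi_apply n).norm hS)

namespace IsPoissonProcess

variable {W : Type*} [MeasurableSpace W] {μ : Measure W} {lam : ℝ} {X : ℕ → W → Plane}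

theorem measurableSet_gridEvent (hX : IsPoissonProcess lam X μ) (n k : ℕ) :
    MeasurableSet {w | (fun i => X i w) ∈ gridEvent n k} :=
  hX.measurableSet_count measurableSet_ball (measurableSet_annulus _ _)
    (measurableSet_singleton 0) (measurableSet_singleton 0).compl

/-- `gridPotential Ψ n k` vanishes on the disc and the annulus that define the event; this is why it
starts at (k + 1) / n. The Laplace bound then factors off the event, whose two probabilities
multiply to the mass of the cell. -/
theorem setLIntegral_gridEvent_le [IsProbabilityMeasure μ] (hlam : 0 ≤ lam)
    (hX : IsPoissonProcess lam X μ) {α a b : ℝ} (hα : 2 < α) (ha : 0 < a) (hab : a < b)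
    {C : ℝ → ℝ} (hC0 : ∀ z, 0 < z → 0 ≤ C z) {Ψ : ℝ → ℝ → ℝ} (hΨ : IsRadialPotential α Ψ)
    (n k : ℕ) :
    ∫⁻ w in {w | (fun i => X i w) ∈ gridEvent n k},
        gridWeight a b C n k (∑' i, gridPotential Ψ n k (X i w)) ∂μ ≤
      gridWeight a b C n k (lam * ∫ y, (Real.exp (gridPotential Ψ n k y) - 1)) *
        ∫⁻ z in Ico ((k : ℝ) / n) ((k + 1) / n), ENNReal.ofReal (servingPDF lam z) := by
  by_cases hk : (k : ℝ) / n ∈ Icc a b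
  swap
  · simp [gridWeight, hk]
  have hk0 : 0 < (k : ℝ) / n := ha.trans_le hk.1
  obtain ⟨K, hK, hb⟩ := hΨ.bound a b ha hab
  have hm := hΨ.measurable_gridPotential hk0
  have hle := abs_gridPotential_le hK hb hk
  have hi : Integrable (gridPotential Ψ n k) :=
    ((integrable_one_add_norm_rpow hα).const_mul K).mono' hm.aestronglyMeasurable
      (ae_of_all _ hle)
  have hKle : ∀ y, gridPotential Ψ n k y ≤ K := fun y => by
    have h1 : (1 + ‖y‖) ^ (-α) ≤ 1 := Real.rpow_le_one_of_one_le_of_nonpos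
      (by linarith [norm_nonneg y]) (by linarith)
    nlinarith [le_abs_self (gridPotential Ψ n k y), hle y]
  have h1 := hX.setLIntegral_exp_le hlam (measurableSet_ball (x := (0 : Plane)) (ε := k / n))
    (measurableSet_annulus (k / n) ((k + 1) / n)) measure_ball_lt_top.ne
    (volume_annulus_ne_top _ _)
    (Set.disjoint_left.2 fun y hy hy' => hy'.2 hy) (measurableSet_singleton 0)
    (measurableSet_singleton 0).compl hm hi hKle
    (fun y hy => if_neg (not_le.2 ((mem_ball_zero_iff.1 hy).trans_le (div_le_succ_div n k))))
    (fun y hy => if_neg (not_le.2 (mem_annulus.1 hy).1))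
  have h2 := hX.measure_count_eq_zero hlam (measurableSet_ball (x := (0 : Plane)) (ε := k / n))
    measure_ball_lt_top.ne
  have h3 := hX.measure_count_ne_zero hlam (measurableSet_annulus (k / n) ((k + 1) / n))
    (volume_annulus_ne_top _ _)
  rw [volume_real_ball hk0.le] at h2
  rw [volume_real_annulus hk0.le (div_le_succ_div n k)] at h3
  simp only [mem_singleton_iff, mem_compl_iff] at h1
  rw [h2, h3, ← lintegral_servingPDF hlam hk0.le (div_le_succ_div n k)] at h1
  simp only [gridWeight, indicator_of_mem hk, ENNReal.ofReal_mul (hC0 _ hk0)]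
  rw [lintegral_const_mul' _ _ ENNReal.ofReal_ne_top, mul_assoc, mul_comm (ENNReal.ofReal
    (Real.exp _))]
  gcongr
  exact h1

theorem measurable_norm_nearest (hX : IsPoissonProcess lam X μ) :
    Measurable fun w => ‖X (nearest fun i => X i w) w‖ := by
  have h : Measurable fun w i => X i w := measurable_pi_lambda _ hX.measurable
  simpa only [Function.comp_def] using HoleNetwork.measurable_norm_nearest.comp h

theorem aemeasurable_gridWeight (hlam : 0 ≤ lam)
    (hX : IsPoissonProcess lam X μ) {α a b : ℝ} (hα : 2 < α) (ha : 0 < a) (hab : a < b)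
    (C : ℝ → ℝ) {Ψ : ℝ → ℝ → ℝ} (hΨ : IsRadialPotential α Ψ) (n k : ℕ) :
    AEMeasurable (fun w => gridWeight a b C n k (∑' i, gridPotential Ψ n k (X i w))) μ := by
  obtain ⟨K, hK, hb⟩ := hΨ.bound a b ha hab
  by_cases hk : (k : ℝ) / n ∈ Icc a b
  · have hm := hΨ.measurable_gridPotential (ha.trans_le hk.1)
    have hi : Integrable (gridPotential Ψ n k) :=
      ((integrable_one_add_norm_rpow hα).const_mul K).mono' hm.aestronglyMeasurable
        (ae_of_all _ (abs_gridPotential_le hK hb hk))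
    simp only [gridWeight, indicator_of_mem hk]
    exact ((Real.measurable_exp.comp_aemeasurable
      (hX.aemeasurable_tsum hlam hm hi)).const_mul _).ennreal_ofReal
  · simp only [gridWeight, indicator_of_notMem hk]
    exact aemeasurable_const

/-- Fatou along the discretisation on the probability space, dominated convergence on the half-line.
Confining the nearest distance to (a, b) makes the potential bounds uniform. -/
theorem setLIntegral_nearest_le [IsProbabilityMeasure μ] (hlam : 0 < lam)
    (hX : IsPoissonProcess lam X μ) {α a b : ℝ} (hα : 2 < α) (ha : 0 < a) (hab : a < b)
    {C : ℝ → ℝ} (hC0 : ∀ z, 0 < z → 0 ≤ C z) (hC : ContinuousOn C (Ioi 0))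
    {Ψ : ℝ → ℝ → ℝ} (hΨ : IsRadialPotential α Ψ) :
    ∫⁻ w in {w | ‖X (nearest fun i => X i w) w‖ ∈ Ioo a b},
      ENNReal.ofReal (C ‖X (nearest fun i => X i w) w‖ * Real.exp (∑' i,
        if i = nearest (fun i => X i w) then 0
        else Ψ ‖X (nearest fun i => X i w) w‖ ‖X i w‖)) ∂μ ≤
      ∫⁻ z in Ioi 0, ENNReal.ofReal (C z * Real.exp (lam *
        ∫ y in {y : Plane | z ≤ ‖y‖}, (Real.exp (Ψ z ‖y‖) - 1))) *
          ENNReal.ofReal (servingPDF lam z) := by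
  let H : ℕ → W → ℝ≥0∞ := fun n w => ∑' k, {w | (fun i => X i w) ∈ gridEvent n k}.indicator
    (fun w => gridWeight a b C n k (∑' i, gridPotential Ψ n k (X i w))) w
  have hT : ∀ n k, AEMeasurable ({w | (fun i => X i w) ∈ gridEvent n k}.indicator
      (fun w => gridWeight a b C n k (∑' i, gridPotential Ψ n k (X i w)))) μ := fun n k =>
    (hX.aemeasurable_gridWeight hlam.le hα ha hab C hΨ n k).indicator
      (hX.measurableSet_gridEvent n k)
  have hH : ∀ n, AEMeasurable (H n) μ := fun n => AEMeasurable.tsum fun k => hT n k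
  have hHle : ∀ n, 0 < n → ∫⁻ w, H n w ∂μ ≤
      ∫⁻ z in Ioi (0 : ℝ), gridWeight a b C n ⌊z * n⌋₊
        (lam * ∫ y, (Real.exp (gridPotential Ψ n ⌊z * n⌋₊ y) - 1)) *
          ENNReal.ofReal (servingPDF lam z) := by
    intro n hn
    rw [lintegral_tsum fun k => hT n k, ← tsum_mul_lintegral_servingPDF hn fun k =>
      gridWeight a b C n k (lam * ∫ y, (Real.exp (gridPotential Ψ n k y) - 1))]
    refine ENNReal.tsum_le_tsum fun k => ?_
    rw [lintegral_indicator (hX.measurableSet_gridEvent n k)]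
    exact hX.setLIntegral_gridEvent_le hlam.le hα ha hab hC0 hΨ n k
  have hS := hX.measurable_norm_nearest (measurableSet_Ioo (a := a) (b := b))
  calc _ ≤ ∫⁻ w in {w | ‖X (nearest fun i => X i w) w‖ ∈ Ioo a b},
        liminf (fun n => H n w) atTop ∂μ := by
        refine lintegral_mono_ae ?_
        filter_upwards [ae_restrict_of_ae (hX.ae_isGood hlam.le hα), ae_restrict_mem hS]
          with w hw1 hw2
        exact (hΨ.tendsto_tsum_gridWeight (by linarith) ha hC hw1 hw2).liminf_eq.ge
    _ ≤ ∫⁻ w, liminf (fun n => H n w) atTop ∂μ := setLIntegral_le_lintegral _ _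
    _ ≤ liminf (fun n => ∫⁻ w, H n w ∂μ) atTop := lintegral_liminf_le' hH
    _ ≤ liminf (fun n : ℕ => ∫⁻ z in Ioi (0 : ℝ), gridWeight a b C n ⌊z * n⌋₊
        (lam * ∫ y, (Real.exp (gridPotential Ψ n ⌊z * n⌋₊ y) - 1)) *
          ENNReal.ofReal (servingPDF lam z)) atTop := by
        refine liminf_le_liminf ?_
        filter_upwards [eventually_gt_atTop 0] with n hn using hHle n hn
    _ ≤ _ := by
        rw [(hΨ.tendsto_lintegral_gridWeight hlam hα ha hab hC0 hC).liminf_eq]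
        refine lintegral_mono fun z => ?_
        gcongr
        exact indicator_le_self _ _ _

/-- Upper bound for the expectation of a functional of the nearest point and of the other points,
by integration over the distance of the nearest point. -/
theorem lintegral_nearest_le [IsProbabilityMeasure μ] (hlam : 0 < lam)
    (hX : IsPoissonProcess lam X μ) {α : ℝ} (hα : 2 < α)
    {C : ℝ → ℝ} (hC0 : ∀ z, 0 < z → 0 ≤ C z) (hC : ContinuousOn C (Ioi 0))
    {Ψ : ℝ → ℝ → ℝ} (hΨ : IsRadialPotential α Ψ) :
    ∫⁻ w, ENNReal.ofReal (C ‖X (nearest fun i => X i w) w‖ * Real.exp (∑' i,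
        if i = nearest (fun i => X i w) then 0
        else Ψ ‖X (nearest fun i => X i w) w‖ ‖X i w‖)) ∂μ ≤
      ∫⁻ z in Ioi 0, ENNReal.ofReal (C z * Real.exp (lam *
        ∫ y in {y : Plane | z ≤ ‖y‖}, (Real.exp (Ψ z ‖y‖) - 1))) *
          ENNReal.ofReal (servingPDF lam z) := by
  -- Monotone exhaustion removes the cut-off; the shift by 2 keeps the endpoints strictly ordered
  -- already at `j = 0`.
  let s : ℕ → Set W := fun j =>
    {w | ‖X (nearest fun i => X i w) w‖ ∈ Ioo (1 / ((j : ℝ) + 2)) (j + 2)}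
  have hs : Monotone s := fun i j hij w hw => by
    have : (i : ℝ) ≤ j := by exact_mod_cast hij
    refine ⟨lt_of_le_of_lt ?_ hw.1, hw.2.trans_le (by linarith)⟩
    exact one_div_le_one_div_of_le (by positivity) (by linarith)
  have hU : ∀ᵐ w ∂μ, w ∈ ⋃ j, s j := by
    filter_upwards [hX.ae_ne_zero hlam.le] with w hw
    have h0 : 0 < ‖X (nearest fun i => X i w) w‖ := norm_pos_iff.2 (hw _)
    obtain ⟨j₁, h1⟩ := exists_nat_one_div_lt h0
    obtain ⟨j₂, h2⟩ := exists_nat_gt ‖X (nearest fun i => X i w) w‖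
    refine mem_iUnion.2 ⟨max j₁ j₂, ?_, ?_⟩
    · refine lt_of_le_of_lt (one_div_le_one_div_of_le (by positivity) ?_) h1
      have : (j₁ : ℝ) ≤ (max j₁ j₂ : ℕ) := by exact_mod_cast le_max_left _ _
      linarith
    · have : (j₂ : ℝ) ≤ (max j₁ j₂ : ℕ) := by exact_mod_cast le_max_right _ _
      linarith
  rw [← setLIntegral_univ, ← setLIntegral_congr (s := ⋃ j, s j) (eventuallyEq_univ.2 hU),
    setLIntegral_iUnion_of_directed _ hs.directed_le]
  refine iSup_le fun j => hX.setLIntegral_nearest_le hlam hα (by positivity) ?_ hC0 hC hΨ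
  rw [div_lt_iff₀ (by positivity)]
  nlinarith [(Nat.cast_nonneg j : (0 : ℝ) ≤ j)]

end IsPoissonProcess

/-! ### Exponential fading and coverage for fixed locations. -/

theorem measurable_exponentialPDF (r : ℝ) : Measurable (exponentialPDF r) :=
  (measurable_exponentialPDFReal r).ennreal_ofReal

theorem lintegral_exp_neg_mul_expMeasure {c : ℝ} (hc : 0 ≤ c) :
    ∫⁻ a, ENNReal.ofReal (Real.exp (-c * a)) ∂expMeasure 1 = ENNReal.ofReal (1 / (1 + c)) := by
  have hm : expMeasure 1 = volume.withDensity (exponentialPDF 1) := rfl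
  have h1 : ∀ a, exponentialPDF 1 a * ENNReal.ofReal (Real.exp (-c * a)) =
      ENNReal.ofReal (1 / (1 + c)) * exponentialPDF (1 + c) a := by
    intro a
    rw [exponentialPDF_eq, exponentialPDF_eq, ← ENNReal.ofReal_mul' (Real.exp_pos _).le,
      ← ENNReal.ofReal_mul (by positivity)]
    congr 1
    split_ifs
    · have : 1 + c ≠ 0 := by positivity
      field_simp
      rw [← Real.exp_add]
      ring_nf
    · simp
  rw [hm, lintegral_withDensity_eq_lintegral_mul _
    (measurable_exponentialPDF 1) (by fun_prop)]
  simp only [Pi.mul_apply, h1]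
  rw [lintegral_const_mul _ (measurable_exponentialPDF _),
    lintegral_exponentialPDF_eq_one (by positivity), mul_one]

/-- The density is at most e^(-a) on the whole line, so `v` may have any sign. -/
theorem expMeasure_Ici_le (v : ℝ) : expMeasure 1 (Ici v) ≤ ENNReal.ofReal (Real.exp (-v)) := by
  have hm : expMeasure 1 = volume.withDensity (exponentialPDF 1) := rfl
  have h1 : ∫⁻ a in Ioi v, ENNReal.ofReal (Real.exp (-a)) = ENNReal.ofReal (Real.exp (-v)) := by
    rw [← ofReal_integral_eq_lintegral_ofReal (integrableOn_exp_neg_Ioi v)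
      (ae_of_all _ fun a => (Real.exp_pos _).le), integral_exp_neg_Ioi]
  rw [hm, withDensity_apply _ measurableSet_Ici, ← h1, setLIntegral_congr Ioi_ae_eq_Ici.symm]
  refine lintegral_mono fun a => ?_
  rw [exponentialPDF_eq]
  refine ENNReal.ofReal_le_ofReal ?_
  split_ifs
  · simp
  · positivity

theorem ae_nonneg_of_hasLaw_expMeasure {W : Type*} [MeasurableSpace W] {μ : Measure W}
    {U : W → ℝ} (hU : HasLaw U (expMeasure 1) μ) : ∀ᵐ w ∂μ, 0 ≤ U w := by
  rw [hU.ae_iff (p := fun a => 0 ≤ a) (measurableSet_setOfPred.1 measurableSet_Ici)]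
  have hm : expMeasure 1 = volume.withDensity (exponentialPDF 1) := rfl
  rw [hm, ae_withDensity_iff (measurable_exponentialPDF 1)]
  refine ae_of_all _ fun a ha => ?_
  by_contra! h
  exact ha (exponentialPDF_of_neg h)

/-- Comparison of a linear combination of i.i.d. `exp(1)` variables with another one. -/
theorem measure_sum_le_le {W : Type*} [MeasurableSpace W] {μ : Measure W} {κ : Type*}
    {U : κ → W → ℝ} (hind : iIndepFun U μ) (hU : ∀ k, HasLaw (U k) (expMeasure 1) μ)
    (K : Finset κ) {k₀ : κ} (hk₀ : k₀ ∉ K) {c : κ → ℝ} (hc : ∀ k, 0 ≤ c k) :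
    μ {w | ∑ k ∈ K, c k * U k w ≤ U k₀ w} ≤
      ENNReal.ofReal (Real.exp (-∑ k ∈ K, Real.log (1 + c k))) := by
  classical
  have hprob := hind.isProbabilityMeasure
  have hUm : ∀ k, AEMeasurable (U k) μ := fun k => (hU k).aemeasurable
  set V : W → ℝ := fun w => ∑ k ∈ K, c k * U k w with hV
  have hVm : AEMeasurable V μ := Finset.aemeasurable_fun_sum K fun k _ => (hUm k).const_mul _
  have hVU : IndepFun V (U k₀) μ := by
    have h := hind.indepFun_finset₀ K {k₀} (by simpa using hk₀) hUm
    have hψ : Measurable fun x : ({k₀} : Finset κ) → ℝ => x ⟨k₀, by simp⟩ :=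
      measurable_pi_apply _
    have hφ : Measurable fun x : K → ℝ => ∑ k, c k.1 * x k := by fun_prop
    have h2 := h.comp hφ hψ
    convert! h2 using 1
    ext w
    simp only [hV, Function.comp]
    exact (Finset.sum_coe_sort K fun k => c k * U k w).symm
  have hm1 : ∀ k, mgf (fun w => c k * U k w) μ (-1) = 1 / (1 + c k) := by
    intro k
    have h := (hU k).lintegral_comp (f := fun a => ENNReal.ofReal (Real.exp (-c k * a)))
      (by fun_prop)
    rw [lintegral_exp_neg_mul_expMeasure (hc k)] at h
    rw [mgf, integral_eq_lintegral_of_nonneg_ae (ae_of_all _ fun w => (Real.exp_pos _).le)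
      (((hUm k).const_mul _).const_mul _).exp.aestronglyMeasurable]
    have h2 : ∀ w, -1 * (c k * U k w) = -c k * U k w := fun w => by ring
    have hck := hc k
    simp_rw [h2, h]
    rw [ENNReal.toReal_ofReal (by positivity)]
  have hmgf : mgf V μ (-1) = ∏ k ∈ K, (1 / (1 + c k)) := by
    have h := (hind.comp (fun k a => c k * a) fun k => by fun_prop).mgf_sum₀
      (fun k => (hUm k).const_mul _) K (t := -1)
    have h2 : V = ∑ k ∈ K, (fun a => c k * a) ∘ U k := by
      ext w; simp [hV]
    rw [h2, h]
    exact Finset.prod_congr rfl fun k _ => hm1 k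
  have hexp : ∏ k ∈ K, (1 / (1 + c k)) = Real.exp (-∑ k ∈ K, Real.log (1 + c k)) := by
    rw [← Finset.sum_neg_distrib, Real.exp_sum]
    refine Finset.prod_congr rfl fun k _ => ?_
    have := hc k
    rw [Real.exp_neg, Real.exp_log (by positivity), one_div]
  -- A non-integrable function would have integral 0, whereas the product of Laplace factors is
  -- positive.
  have hint : Integrable (fun w => Real.exp (-1 * V w)) μ := by
    by_contra h
    have h0 : mgf V μ (-1) = 0 := integral_undef h
    rw [hmgf, hexp] at h0
    exact (Real.exp_pos _).ne' h0
  have hset : MeasurableSet {p : ℝ × ℝ | p.1 ≤ p.2} :=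
    measurableSet_le measurable_fst measurable_snd
  -- By independence `U k₀` is integrated first, at a fixed value v of `V`; its tail is at most
  -- e^(-v), which leaves the Laplace transform of `V` at 1.
  calc μ {w | V w ≤ U k₀ w} = (μ.map fun w => (V w, U k₀ w)) {p | p.1 ≤ p.2} := by
        rw [Measure.map_apply_of_aemeasurable (hVm.prodMk (hUm _)) hset]
        rfl
    _ = ((μ.map V).prod (expMeasure 1)) {p | p.1 ≤ p.2} := by
        rw [(indepFun_iff_map_prod_eq_prod_map_map hVm (hUm _)).1 hVU, (hU k₀).map_eq]
    _ ≤ ∫⁻ v, ENNReal.ofReal (Real.exp (-1 * v)) ∂(μ.map V) := by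
        have := isProbabilityMeasure_expMeasure one_pos
        rw [Measure.prod_apply hset]
        refine lintegral_mono fun v => ?_
        rw [neg_one_mul]
        exact expMeasure_Ici_le v
    _ = ∫⁻ w, ENNReal.ofReal (Real.exp (-1 * V w)) ∂μ := lintegral_map' (by fun_prop) hVm
    _ = _ := by
        rw [← ofReal_integral_eq_lintegral_ofReal hint (ae_of_all _ fun w => (Real.exp_pos _).le),
          ← hexp, ← hmgf]
        rfl

open scoped Classical in
theorem interference_eq (α P₁ P₂ D : ℝ) (x y : ℕ → Plane) (h g : ℕ → ℝ) :
    interference α P₁ P₂ D x y h g =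
      (∑' i, if i = nearest x then 0 else rxPower α P₁ (h i) (x i)) +
        ∑' j, if y j ∈ holes D x then 0 else rxPower α P₂ (g j) (y j) := by
  unfold interference
  congr 1
  · refine (tsum_subtype {i : ℕ | i ≠ nearest x} fun i => rxPower α P₁ (h i) (x i)).trans
      (tsum_congr fun i => ?_)
    by_cases hi : i = nearest x <;> simp [hi]
  · refine (tsum_subtype {j : ℕ | y j ∉ holes D x} fun j => rxPower α P₂ (g j) (y j)).trans
      (tsum_congr fun j => ?_)
    by_cases hj : y j ∈ holes D x <;> simp [hj]

/-- The exponent of the Laplace factor of one interferer of power `P` at distance `v`. -/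
noncomputable def fadingLoss (α P s v : ℝ) : ℝ := Real.log (1 + s * P * v ^ (-α))

open scoped Classical in
/-- For fixed locations, the probability of coverage is at most the product of the Laplace factors
of the interferers (here, small-cell interferers at distance less than `δ` are dropped). -/
theorem measure_le_sir_le {W : Type*} [MeasurableSpace W] {μ : Measure W} {h g : ℕ → W → ℝ}
    (hind : iIndepFun (fun k : ℕ ⊕ ℕ => Sum.elim h g k) μ)
    (hh : ∀ i, HasLaw (h i) (expMeasure 1) μ) (hg : ∀ j, HasLaw (g j) (expMeasure 1) μ)
    {α P₁ P₂ D γ : ℝ} (hP₁ : 0 < P₁) (hP₂ : 0 < P₂) (hγ : 0 < γ) (δ : ℝ) {x y : ℕ → Plane}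
    (hx : x (nearest x) ≠ 0) {s : ℝ} (hs : s = γ * ‖x (nearest x)‖ ^ α / P₁)
    (hsx : Summable fun i => if i = nearest x then 0 else fadingLoss α P₁ s ‖x i‖)
    (hsy : Summable fun j => if y j ∈ holes D x ∨ ‖y j‖ < δ then 0
      else fadingLoss α P₂ s ‖y j‖) :
    μ {w | ENNReal.ofReal γ ≤ sir α P₁ P₂ D x y (fun i => h i w) (fun j => g j w)} ≤
      ENNReal.ofReal (Real.exp
        (-((∑' i, if i = nearest x then 0 else fadingLoss α P₁ s ‖x i‖) +
          ∑' j, if y j ∈ holes D x ∨ ‖y j‖ < δ then 0 else fadingLoss α P₂ s ‖y j‖))) := by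
  set n := nearest x with hn
  set z := ‖x n‖ with hz
  have hz0 : 0 < z := norm_pos_iff.2 hx
  have hs0 : 0 < s := by rw [hs]; positivity
  let c : ℕ ⊕ ℕ → ℝ := Sum.elim (fun i => if i = n then 0 else s * P₁ * ‖x i‖ ^ (-α))
    (fun j => if y j ∈ holes D x ∨ ‖y j‖ < δ then 0 else s * P₂ * ‖y j‖ ^ (-α))
  have hc : ∀ k, 0 ≤ c k := by
    rintro (i | j)
    · simp only [c, Sum.elim_inl]; split_ifs <;> positivity
    · simp only [c, Sum.elim_inr]; split_ifs <;> positivity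
  have hU : ∀ k : ℕ ⊕ ℕ, HasLaw (Sum.elim h g k) (expMeasure 1) μ := by
    rintro (i | j)
    exacts [hh i, hg j]
  -- Discarding interferers only enlarges the event, so finite subfamilies suffice; the random
  -- interference series never has to be summed. The limit is taken in the deterministic exponents.
  have hfin : ∀ I J : Finset ℕ,
      μ {w | ENNReal.ofReal γ ≤ sir α P₁ P₂ D x y (fun i => h i w) (fun j => g j w)} ≤
        ENNReal.ofReal (Real.exp
          (-((∑ i ∈ I, if i = n then 0 else fadingLoss α P₁ s ‖x i‖) +
            ∑ j ∈ J, if y j ∈ holes D x ∨ ‖y j‖ < δ then 0 else fadingLoss α P₂ s ‖y j‖))) := by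
    intro I J
    have hK := measure_sum_le_le hind hU ((I.erase n).disjSum J) (k₀ := Sum.inl n) (by simp) hc
    have hsum : ∑ k ∈ (I.erase n).disjSum J, Real.log (1 + c k) =
        (∑ i ∈ I, if i = n then 0 else fadingLoss α P₁ s ‖x i‖) +
          ∑ j ∈ J, if y j ∈ holes D x ∨ ‖y j‖ < δ then 0 else fadingLoss α P₂ s ‖y j‖ := by
      rw [Finset.sum_disjSum]
      congr 1
      · rw [← Finset.sum_erase I (a := n) (by simp)]
        refine Finset.sum_congr rfl fun i hi => ?_
        simp [c, fadingLoss, Finset.ne_of_mem_erase hi]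
      · refine Finset.sum_congr rfl fun j _ => ?_
        simp only [c, Sum.elim_inr]
        split_ifs <;> simp [fadingLoss]
    rw [hsum] at hK
    refine (measure_mono_ae ?_).trans hK
    filter_upwards [ae_all_iff.2 fun i => ae_nonneg_of_hasLaw_expMeasure (hh i),
      ae_all_iff.2 fun j => ae_nonneg_of_hasLaw_expMeasure (hg j)] with w hw1 hw2 hw
    change ENNReal.ofReal γ ≤ sir α P₁ P₂ D x y (fun i => h i w) (fun j => g j w) at hw
    change ∑ k ∈ (I.erase n).disjSum J, c k * Sum.elim h g k w ≤ h n w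
    have h1 : ENNReal.ofReal γ * interference α P₁ P₂ D x y (fun i => h i w) (fun j => g j w) ≤
        rxPower α P₁ (h n w) (x n) := ENNReal.mul_le_of_le_div hw
    rw [interference_eq] at h1
    have h2 : ENNReal.ofReal ((∑ i ∈ I.erase n, P₁ * h i w * ‖x i‖ ^ (-α)) +
        ∑ j ∈ J, if y j ∈ holes D x ∨ ‖y j‖ < δ then 0 else P₂ * g j w * ‖y j‖ ^ (-α)) ≤
        (∑' i, if i = nearest x then 0 else rxPower α P₁ (h i w) (x i)) +
        ∑' j, if y j ∈ holes D x then 0 else rxPower α P₂ (g j w) (y j) := by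
      refine ENNReal.ofReal_add_le.trans (add_le_add ?_ ?_)
      · refine le_trans ?_ (ENNReal.sum_le_tsum (I.erase n))
        rw [ENNReal.ofReal_sum_of_nonneg fun i _ => mul_nonneg (mul_nonneg hP₁.le (hw1 i))
          (by positivity)]
        refine Finset.sum_le_sum fun i hi => ?_
        rw [if_neg (Finset.ne_of_mem_erase hi)]
        rfl
      · refine le_trans ?_ (ENNReal.sum_le_tsum J)
        rw [ENNReal.ofReal_sum_of_nonneg]
        · refine Finset.sum_le_sum fun j hj => ?_
          by_cases hjh : y j ∈ holes D x
          · simp [hjh]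
          · by_cases hjd : ‖y j‖ < δ
            · simp [hjd]
            · simp [hjh, hjd, rxPower]
        · intro j _
          have := hw2 j
          split_ifs <;> positivity
    have h3 := (mul_le_mul_right h2 (ENNReal.ofReal γ)).trans h1
    rw [← ENNReal.ofReal_mul hγ.le, rxPower, ENNReal.ofReal_le_ofReal_iff
      (mul_nonneg (mul_nonneg hP₁.le (hw1 n)) (by positivity))] at h3
    -- Scaling by z ^ α / P₁ isolates the serving gain and turns γ into `s` in the coefficients.
    have h4 : ∑ k ∈ (I.erase n).disjSum J, c k * Sum.elim h g k w =
        (z ^ α / P₁) * (γ * ((∑ i ∈ I.erase n, P₁ * h i w * ‖x i‖ ^ (-α)) +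
        ∑ j ∈ J, if y j ∈ holes D x ∨ ‖y j‖ < δ then 0 else P₂ * g j w * ‖y j‖ ^ (-α))) := by
      rw [Finset.sum_disjSum, mul_add, mul_add, Finset.mul_sum, Finset.mul_sum, Finset.mul_sum,
        Finset.mul_sum]
      congr 1
      · refine Finset.sum_congr rfl fun i hi => ?_
        simp only [c, Sum.elim_inl, if_neg (Finset.ne_of_mem_erase hi), hs]
        ring
      · refine Finset.sum_congr rfl fun j _ => ?_
        simp only [c, Sum.elim_inr, hs]
        split_ifs <;> ring
    rw [h4]
    refine (mul_le_mul_of_nonneg_left h3 (by positivity)).trans_eq ?_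
    rw [← hz, Real.rpow_neg hz0.le]
    have : z ^ α ≠ 0 := by positivity
    field_simp
  have hlim := (hsx.hasSum.tendsto_sum_nat.add hsy.hasSum.tendsto_sum_nat).neg
  exact ge_of_tendsto (ENNReal.tendsto_ofReal ((Real.continuous_exp.tendsto _).comp hlim))
    (Eventually.of_forall fun N => hfin (Finset.range N) (Finset.range N))

/-! ### The loss kernel and the mass of one hole in polar coordinates. -/

/-- The mean loss caused by an exponentially faded interferer at distance `r`, where `c` is the
product of its power and the Laplace variable. -/
noncomputable def lossKernel (α c r : ℝ) : ℝ := 1 / (1 + r ^ α / c)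

theorem lossKernel_nonneg {α c r : ℝ} (hc : 0 < c) (hr : 0 ≤ r) : 0 ≤ lossKernel α c r := by
  unfold lossKernel; positivity

theorem measurable_lossKernel (α c : ℝ) : Measurable (lossKernel α c) := by
  unfold lossKernel; fun_prop

theorem measurable_lossKernel_norm {E : Type*} [NormedAddCommGroup E] [MeasurableSpace E]
    [OpensMeasurableSpace E] (α c : ℝ) : Measurable fun y : E => lossKernel α c ‖y‖ :=
  (measurable_lossKernel α c).comp measurable_norm

theorem lossKernel_mono {α c c' r : ℝ} (hc : 0 < c) (hcc : c ≤ c') (hr : 0 ≤ r) :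
    lossKernel α c r ≤ lossKernel α c' r := by
  unfold lossKernel
  have := hc.trans_le hcc
  gcongr

theorem one_sub_exp_neg_fadingLoss {α P s v : ℝ} (hsP : 0 < s * P) (hv : 0 < v) :
    1 - Real.exp (-fadingLoss α P s v) = lossKernel α (s * P) v := by
  have h : 0 < v ^ α := by positivity
  rw [fadingLoss, lossKernel, Real.exp_neg, Real.exp_log (by positivity), Real.rpow_neg hv.le]
  generalize s * P = c at hsP
  field_simp
  ring

/-- From (1 + r) ^ α ≤ 2 ^ α (1 + r ^ α), by cases on r ≤ 1. It compares the kernel with the weight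
(1 + r) ^ (-α) used everywhere, integrable on the plane for α > 2. -/
theorem lossKernel_le {α c r : ℝ} (hα : 0 ≤ α) (hc : 0 < c) (hr : 0 ≤ r) :
    lossKernel α c r ≤ 2 ^ α * (c + 1) * (1 + r) ^ (-α) := by
  have h1 : (1 + r) ^ α ≤ 2 ^ α * (1 + r ^ α) := by
    rcases le_total r 1 with h | h
    · have : (1 + r) ^ α ≤ 2 ^ α := Real.rpow_le_rpow (by positivity) (by linarith) hα
      nlinarith [Real.rpow_nonneg hr α, Real.rpow_nonneg (zero_le_two (α := ℝ)) α]
    · have : (1 + r) ^ α ≤ (2 * r) ^ α := Real.rpow_le_rpow (by positivity) (by linarith) hα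
      rw [Real.mul_rpow zero_le_two hr] at this
      nlinarith [Real.rpow_nonneg hr α, Real.rpow_nonneg (zero_le_two (α := ℝ)) α]
  have h0 : 0 < (1 + r) ^ α := by positivity
  have hr' : 0 ≤ r ^ α := by positivity
  have h2 : (0 : ℝ) < 2 ^ α := by positivity
  rw [lossKernel, Real.rpow_neg (by positivity), ← div_eq_mul_inv,
    div_le_div_iff₀ (by positivity) h0, one_mul]
  have h3 : 1 + r ^ α ≤ (c + 1) * (1 + r ^ α / c) := by
    have : (c + 1) * (1 + r ^ α / c) = c + 1 + r ^ α + r ^ α / c := by field_simp; ring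
    rw [this]
    have : 0 ≤ r ^ α / c := by positivity
    linarith
  nlinarith

theorem integrable_lossKernel {α c : ℝ} (hα : 2 < α) (hc : 0 < c) :
    Integrable fun y : Plane => lossKernel α c ‖y‖ := by
  refine ((integrable_one_add_norm_rpow hα).const_mul (2 ^ α * (c + 1))).mono'
    (measurable_lossKernel_norm α c).aestronglyMeasurable
    (ae_of_all _ fun y => ?_)
  rw [Real.norm_of_nonneg (lossKernel_nonneg hc (norm_nonneg y))]
  exact lossKernel_le (by linarith) hc (norm_nonneg y)

/-- The cosine of the half-angle under which the circle of radius `r` around the origin meets a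
disc of radius `D` with centre at distance `u`. -/
noncomputable def holeCos (D u r : ℝ) : ℝ := (r ^ 2 + u ^ 2 - D ^ 2) / (2 * u * r)

/-- `Real.arccos` saturates at 0 and π, so no condition on `c` is needed: circles that miss the disc
or lie inside it are covered. -/
theorem volume_lt_cos (c : ℝ) :
    volume {θ : ℝ | θ ∈ Ioo (-Real.pi) Real.pi ∧ c < Real.cos θ} =
      ENNReal.ofReal (2 * Real.arccos c) := by
  have h : {θ : ℝ | θ ∈ Ioo (-Real.pi) Real.pi ∧ c < Real.cos θ} =
      Ioo (-Real.arccos c) (Real.arccos c) := by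
    ext θ
    simp only [mem_ofPred_eq, mem_Ioo, ← abs_lt]
    rw [← Real.cos_abs θ]
    constructor
    · rintro ⟨h1, h2⟩
      by_contra! h3
      rcases le_or_gt (-1) c with h4 | h4
      · have h5 := Real.cos_le_cos_of_nonneg_of_le_pi (Real.arccos_nonneg c) h1.le h3
        rw [Real.cos_arccos h4 (h2.le.trans (Real.cos_le_one _))] at h5
        linarith
      · rw [Real.arccos_of_le_neg_one h4.le] at h3
        linarith
    · intro h1
      have h2 := h1.trans_le (Real.arccos_le_pi c)
      refine ⟨h2, ?_⟩
      by_contra! h3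
      have h4 := Real.arccos_le_arccos h3
      rw [Real.arccos_cos (abs_nonneg θ) h2.le] at h4
      linarith
  rw [h, Real.volume_Ioo]
  congr 1
  ring

/-- Places the centre of a hole on the positive real axis, ready for complex polar coordinates. -/
theorem exists_linearIsometryEquiv_complex {x : Plane} (hx : x ≠ 0) :
    ∃ e : Plane ≃ₗᵢ[ℝ] ℂ, e x = (‖x‖ : ℂ) := by
  let e₀ : Plane ≃ₗᵢ[ℝ] ℂ := Complex.orthonormalBasisOneI.repr.symm
  have h0 : e₀ x ≠ 0 := by simpa using hx
  have hn : ‖e₀ x‖ = ‖x‖ := e₀.norm_map x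
  have hn0 : (‖x‖ : ℂ) ≠ 0 := by simpa using hx
  let a : Circle := ⟨(‖x‖ : ℂ) / e₀ x, by
    simp [Submonoid.unitSphere, hn, hx]⟩
  refine ⟨e₀.trans (rotation a), ?_⟩
  change ((‖x‖ : ℂ) / e₀ x) * e₀ x = _
  rw [div_mul_cancel₀ _ h0]

/-- The law of cosines. -/
theorem norm_polar_sub_lt_iff {D u r θ : ℝ} (hD : 0 < D) (hu : 0 < u) (hr : 0 < r) :
    ‖Complex.polarCoord.symm (r, θ) - u‖ < D ↔ holeCos D u r < Real.cos θ := by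
  have h1 : ‖Complex.polarCoord.symm (r, θ) - u‖ ^ 2 = r ^ 2 + u ^ 2 - 2 * u * r * Real.cos θ := by
    rw [← Complex.normSq_eq_norm_sq, Complex.polarCoord_symm_apply, Complex.normSq_apply]
    simp only [Complex.sub_re, Complex.mul_re, Complex.ofReal_re, Complex.add_re, Complex.I_re,
      Complex.ofReal_im, Complex.I_im, Complex.mul_im, Complex.add_im, Complex.sub_im]
    linear_combination r ^ 2 * Real.sin_sq_add_cos_sq θ
  rw [← sq_lt_sq₀ (norm_nonneg _) hD.le, h1, holeCos, div_lt_iff₀ (by positivity)]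
  constructor <;> intro h <;> linarith

/-- The radial form of the contribution of a hole. -/
noncomputable def holeRadial (α D c u r : ℝ) : ℝ :=
  if D - u ≤ r then Real.arccos (holeCos D u r) * (2 * lossKernel α c r) * r else 0

theorem holeRadial_nonneg {α D c u r : ℝ} (hc : 0 < c) (hr : 0 ≤ r) :
    0 ≤ holeRadial α D c u r := by
  have := lossKernel_nonneg (α := α) hc hr
  have := Real.arccos_nonneg (holeCos D u r)
  unfold holeRadial
  split_ifs <;> positivity

theorem measurable_holeRadial (α D c u : ℝ) : Measurable (holeRadial α D c u) := by
  unfold holeRadial holeCos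
  refine Measurable.ite measurableSet_Ici ?_ measurable_const
  have := measurable_lossKernel α c
  have := Real.continuous_arccos.measurable
  fun_prop

/-- The mass removed by the hole around `x`, outside the disc around the origin it covers. -/
noncomputable def holeMass (α D c : ℝ) (x : Plane) : ℝ :=
  ∫ y in Metric.ball x D \ Metric.ball 0 (D - ‖x‖), lossKernel α c ‖y‖

/-- The circle of radius `r` meets the hole in an arc of half-angle `arccos (holeCos D u r)`;
removing the central disc keeps or deletes the whole arc according to whether D - u ≤ r. -/
theorem lintegral_complex_hole {α D c u : ℝ} (hD : 0 < D) (hc : 0 < c) (hu : 0 < u) :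
    ∫⁻ ζ in Metric.ball (u : ℂ) D \ Metric.ball 0 (D - u),
      ENNReal.ofReal (lossKernel α c ‖ζ‖) =
      ∫⁻ r in Ioi 0, ENNReal.ofReal (holeRadial α D c u r) := by
  have hS : MeasurableSet (Metric.ball (u : ℂ) D \ Metric.ball 0 (D - u)) :=
    measurableSet_ball.diff measurableSet_ball
  have hH : Measurable ((Metric.ball (u : ℂ) D \ Metric.ball 0 (D - u)).indicator
      fun ζ => ENNReal.ofReal (lossKernel α c ‖ζ‖)) :=
    (measurable_lossKernel_norm α c).ennreal_ofReal.indicator hS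
  rw [← lintegral_indicator hS]
  generalize hHdef : (Metric.ball (u : ℂ) D \ Metric.ball 0 (D - u)).indicator
      (fun ζ => ENNReal.ofReal (lossKernel α c ‖ζ‖)) = H at hH
  have hcont : Continuous fun p : ℝ × ℝ => Complex.polarCoord.symm p := by
    simp only [Complex.polarCoord_symm_apply]
    fun_prop
  have hmeas : Measurable fun p : ℝ × ℝ => ENNReal.ofReal p.1 • H (Complex.polarCoord.symm p) :=
    measurable_fst.ennreal_ofReal.smul (hH.comp hcont.measurable)
  rw [← Complex.lintegral_comp_polarCoord_symm, polarCoord_target, Measure.volume_eq_prod,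
    ← Measure.prod_restrict, lintegral_prod _ hmeas.aemeasurable]
  refine setLIntegral_congr_fun measurableSet_Ioi fun r hr => ?_
  have hr : 0 < r := hr
  have hφ := lossKernel_nonneg (α := α) hc hr.le
  have hac := Real.arccos_nonneg (holeCos D u r)
  have hpt : ∀ θ, ENNReal.ofReal r • H (Complex.polarCoord.symm (r, θ)) =
      {θ : ℝ | holeCos D u r < Real.cos θ}.indicator (fun _ => if D - u ≤ r then
        ENNReal.ofReal (r * lossKernel α c r) else 0) θ := by
    intro θ
    have hn : ‖Complex.polarCoord.symm (r, θ)‖ = r := by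
      rw [Complex.norm_polarCoord_symm, abs_of_pos hr]
    have hmem : Complex.polarCoord.symm (r, θ) ∈
        Metric.ball (u : ℂ) D \ Metric.ball 0 (D - u) ↔
        holeCos D u r < Real.cos θ ∧ D - u ≤ r := by
      rw [Set.mem_sdiff, Metric.mem_ball, dist_eq_norm, norm_polar_sub_lt_iff hD hu hr,
        mem_ball_zero_iff, hn, not_lt]
    rw [← hHdef]
    by_cases h1 : holeCos D u r < Real.cos θ
    · by_cases h2 : D - u ≤ r
      · rw [indicator_of_mem (hmem.2 ⟨h1, h2⟩), indicator_of_mem (by exact h1), if_pos h2, hn,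
          smul_eq_mul, ENNReal.ofReal_mul hr.le]
      · rw [indicator_of_notMem (fun h => h2 (hmem.1 h).2), indicator_of_mem (by exact h1),
          if_neg h2, smul_zero]
    · rw [indicator_of_notMem (fun h => h1 (hmem.1 h).1), indicator_of_notMem (by exact h1),
        smul_zero]
  simp only [hpt]
  have hms : MeasurableSet {θ : ℝ | holeCos D u r < Real.cos θ} :=
    measurableSet_lt measurable_const Real.measurable_cos
  have hvol : volume ({θ : ℝ | holeCos D u r < Real.cos θ} ∩ Ioo (-Real.pi) Real.pi) =
      ENNReal.ofReal (2 * Real.arccos (holeCos D u r)) := by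
    rw [← volume_lt_cos]
    congr 1
    ext θ
    simp only [mem_inter_iff, mem_ofPred_eq, and_comm]
  rw [lintegral_indicator hms, setLIntegral_const, Measure.restrict_apply hms, hvol, holeRadial]
  split_ifs
  · rw [← ENNReal.ofReal_mul (by positivity)]
    congr 1
    ring
  · simp

theorem lintegral_plane_hole {α D c : ℝ} (hD : 0 < D) (hc : 0 < c) {x : Plane} (hx : x ≠ 0) :
    ∫⁻ y in Metric.ball x D \ Metric.ball 0 (D - ‖x‖), ENNReal.ofReal (lossKernel α c ‖y‖) =
      ∫⁻ r in Ioi 0, ENNReal.ofReal (holeRadial α D c ‖x‖ r) := by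
  obtain ⟨e, he⟩ := exists_linearIsometryEquiv_complex hx
  rw [← lintegral_complex_hole hD hc (norm_pos_iff.2 hx), ← he]
  have hp : e ⁻¹' (Metric.ball (e x) D \ Metric.ball 0 (D - ‖x‖)) =
      Metric.ball x D \ Metric.ball 0 (D - ‖x‖) := by
    ext y
    simp only [mem_preimage, Set.mem_sdiff, Metric.mem_ball, e.dist_map, dist_zero_right,
      e.norm_map]
  have h := e.measurePreserving.setLIntegral_comp_preimage
    (measurableSet_ball.diff measurableSet_ball :
      MeasurableSet (Metric.ball (e x) D \ Metric.ball 0 (D - ‖x‖)))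
    (measurable_lossKernel_norm (E := ℂ) α c).ennreal_ofReal
  rw [← hp, ← h]
  simp only [e.norm_map]

theorem holeMass_eq {α D c : ℝ} (hD : 0 < D) (hc : 0 < c) {x : Plane} (hx : x ≠ 0) :
    holeMass α D c x = ∫ r in Ioi 0, holeRadial α D c ‖x‖ r := by
  have h1 : ∀ y : Plane, 0 ≤ lossKernel α c ‖y‖ := fun y => lossKernel_nonneg hc (norm_nonneg y)
  rw [holeMass, integral_eq_lintegral_of_nonneg_ae (ae_of_all _ h1)
    (measurable_lossKernel_norm (E := Plane) α c).aestronglyMeasurable,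
    lintegral_plane_hole hD hc hx,
    integral_eq_lintegral_of_nonneg_ae _ (measurable_holeRadial α D c ‖x‖).aestronglyMeasurable]
  exact (ae_restrict_iff' measurableSet_Ioi).2 (ae_of_all _ fun r hr =>
    holeRadial_nonneg hc (le_of_lt hr))

/-- A circle outside this range either misses the hole, so the arccosine is 0, or lies in the
removed disc of radius D - u. This is why the lower limit |u - D| in `holeTerm` is correct also for
u < D. -/
theorem holeRadial_eq_zero {α D c u r : ℝ} (hu : 0 < u) (hr : 0 < r)
    (h : r < |u - D| ∨ u + D < r) (hD : 0 < D) : holeRadial α D c u r = 0 := by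
  rw [holeRadial]
  split_ifs with h1
  · have h2 : D ^ 2 ≤ (r - u) ^ 2 := by
      rcases h with h | h
      · rw [lt_abs] at h
        rcases h with h | h
        · nlinarith
        · linarith
      · nlinarith
    have h3 : 1 ≤ holeCos D u r := by
      rw [holeCos, le_div_iff₀ (by positivity)]
      nlinarith
    rw [Real.arccos_of_one_le h3]
    simp
  · rfl

theorem holeTerm_eq_integral {lam₂ α P₂ D s u : ℝ} (hD : 0 < D) (hu : 0 < u) :
    holeTerm lam₂ α P₂ D s u = lam₂ * ∫ r in Ioi 0, holeRadial α D (s * P₂) u r := by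
  have hle : |u - D| ≤ u + D := abs_le.2 ⟨by linarith, by linarith⟩
  rw [holeTerm, intervalIntegral.integral_of_le hle, ← integral_const_mul,
    ← integral_indicator measurableSet_Ioc, ← integral_indicator measurableSet_Ioi]
  have hne : ∀ᵐ r : ℝ, r ≠ |u - D| := by simp [ae_iff]
  refine integral_congr_ae ?_
  filter_upwards [hne] with r hr
  by_cases h1 : r ∈ Ioc |u - D| (u + D)
  · have h0 : 0 < r := (abs_nonneg _).trans_lt h1.1
    have h2 : D - u ≤ r := by linarith [neg_abs_le (u - D), h1.1]
    rw [indicator_of_mem h1, indicator_of_mem (by exact h0), holeRadial, if_pos h2,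
      holeIntegrand, lossKernel, holeCos, mul_comm P₂ s]
    ring
  · rw [indicator_of_notMem h1]
    by_cases h0 : 0 < r
    · rw [indicator_of_mem (by exact h0), holeRadial_eq_zero hu h0 _ hD, mul_zero]
      by_contra! h2
      exact h1 ⟨lt_of_le_of_ne h2.1 hr.symm, h2.2⟩
    · rw [indicator_of_notMem (by exact h0)]

theorem holeTerm_eq_holeMass {lam₂ α P₂ D s : ℝ} (hD : 0 < D) (hc : 0 < s * P₂) {x : Plane}
    (hx : x ≠ 0) : holeTerm lam₂ α P₂ D s ‖x‖ = lam₂ * holeMass α D (s * P₂) x := by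
  rw [holeTerm_eq_integral hD (norm_pos_iff.2 hx), holeMass_eq hD hc hx]

/-! ### Radial integrals, continuity, decay and the closed form of the total mass. -/

theorem integrable_norm_iff {f : ℝ → ℝ} :
    Integrable (fun y : Plane => f ‖y‖) ↔ IntegrableOn (fun r => r * f r) (Ioi 0) := by
  rw [integrable_fun_norm_addHaar volume]
  simp

theorem integral_norm (f : ℝ → ℝ) :
    ∫ y : Plane, f ‖y‖ = 2 * Real.pi * ∫ r in Ioi 0, r * f r := by
  rw [integral_fun_norm_addHaar volume, volume_real_ball zero_le_one]
  simp
  ring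

theorem setIntegral_norm {ρ : ℝ} (hρ : 0 ≤ ρ) (f : ℝ → ℝ) :
    ∫ y in {y : Plane | ρ ≤ ‖y‖}, f ‖y‖ = 2 * Real.pi * ∫ r in Ioi ρ, r * f r := by
  have h := integral_norm ((Ici ρ).indicator f)
  have h1 : ∫ r in Ioi 0, r * (Ici ρ).indicator f r = ∫ r in Ioi ρ, r * f r := by
    rw [← integral_Ici_eq_integral_Ioi (x := ρ), ← integral_Ici_eq_integral_Ioi (x := 0),
      ← integral_indicator measurableSet_Ici, ← integral_indicator measurableSet_Ici]
    refine integral_congr_ae (ae_of_all _ fun r => ?_)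
    by_cases h2 : ρ ≤ r
    · simp [h2, hρ.trans h2]
    · simp [h2]
  rw [h1] at h
  rw [← h, ← integral_indicator (measurableSet_le measurable_const measurable_norm)]
  rfl

theorem integrableOn_mul_of_integrable_norm {f : ℝ → ℝ} {ρ : ℝ} (hρ : 0 ≤ ρ)
    (h : IntegrableOn (fun y : Plane => f ‖y‖) {y | ρ ≤ ‖y‖}) :
    IntegrableOn (fun r => r * f r) (Ioi ρ) := by
  rw [← integrable_indicator_iff (measurableSet_le measurable_const measurable_norm)] at h
  have h2 : Integrable fun y : Plane => (Ici ρ).indicator f ‖y‖ := h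
  rw [integrable_norm_iff] at h2
  refine (h2.mono_set (Ioi_subset_Ioi hρ)).congr_fun (fun r hr => ?_) measurableSet_Ioi
  have hr' : r ∈ Ici ρ := Ioi_subset_Ici_self hr
  simp only [indicator_of_mem hr']

theorem integrableOn_mul_one_add_rpow {α : ℝ} (hα : 2 < α) :
    IntegrableOn (fun r : ℝ => r * (1 + r) ^ (-α)) (Ioi 0) :=
  integrable_norm_iff.1 (integrable_one_add_norm_rpow hα)

theorem abs_holeRadial_le {α D c c' u r : ℝ} (hα : 0 ≤ α) (hc : 0 < c) (hcc : c ≤ c')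
    (hr : 0 ≤ r) :
    |holeRadial α D c u r| ≤ 2 * Real.pi * (2 ^ α * (c' + 1)) * (r * (1 + r) ^ (-α)) := by
  have h1 := lossKernel_le hα (hc.trans_le hcc) hr
  have h2 := lossKernel_mono (α := α) hc hcc hr
  have h3 := lossKernel_nonneg (α := α) hc hr
  rw [abs_of_nonneg (holeRadial_nonneg hc hr), holeRadial]
  have hc' := hc.trans_le hcc
  split_ifs
  · calc Real.arccos (holeCos D u r) * (2 * lossKernel α c r) * r
        ≤ Real.pi * (2 * (2 ^ α * (c' + 1) * (1 + r) ^ (-α))) * r := by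
          gcongr
          · exact Real.arccos_le_pi _
          · exact h2.trans h1
      _ = _ := by ring
  · have := Real.pi_pos
    positivity

theorem continuousAt_lossKernel {α r : ℝ} {c : ℝ} (hc : 0 < c) (hr : 0 ≤ r) :
    ContinuousAt (fun c => lossKernel α c r) c := by
  unfold lossKernel
  have : 1 + r ^ α / c ≠ 0 := by positivity
  exact continuousAt_const.div (continuousAt_const.add (continuousAt_const.div continuousAt_id
    hc.ne')) this

theorem continuousAt_holeRadial {α D c u r : ℝ} (hc : 0 < c) (hu : 0 < u) (hr : 0 < r)
    (hne : r ≠ D - u) :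
    ContinuousAt (fun p : ℝ × ℝ => holeRadial α D p.1 p.2 r) (c, u) := by
  have hf : ContinuousAt (fun p : ℝ × ℝ =>
      Real.arccos (holeCos D p.2 r) * (2 * lossKernel α p.1 r) * r) (c, u) := by
    have h1 : ContinuousAt (fun p : ℝ × ℝ => holeCos D p.2 r) (c, u) := by
      unfold holeCos
      refine ContinuousAt.div (by fun_prop) (by fun_prop) ?_
      simp only
      positivity
    have h2 : ContinuousAt (fun p : ℝ × ℝ => lossKernel α p.1 r) (c, u) :=
      ContinuousAt.comp (f := Prod.fst) (x := (c, u)) (g := fun c => lossKernel α c r)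
        (continuousAt_lossKernel hc hr.le) continuousAt_fst
    exact ((Real.continuous_arccos.continuousAt.comp h1).mul (h2.const_mul 2)).mul_const r
  have hd : ContinuousAt (fun p : ℝ × ℝ => D - p.2) (c, u) := by fun_prop
  rcases lt_or_gt_of_ne hne with h | h
  · refine (continuousAt_const (y := (0 : ℝ))).congr ?_
    filter_upwards [hd.eventually_const_lt h] with p hp
    rw [holeRadial, if_neg (not_le.2 hp)]
  · refine hf.congr ?_
    filter_upwards [hd.eventually_lt_const h] with p hp
    rw [holeRadial, if_pos hp.le]

/-- The integrand is jointly continuous except at the single radius r = D - u. Near the base point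
the first variable stays below c + 1, which fixes the dominating function. -/
theorem continuousAt_integral_holeRadial {α D c u : ℝ} (hα : 2 < α) (hc : 0 < c) (hu : 0 < u) :
    ContinuousAt (fun p : ℝ × ℝ => ∫ r in Ioi 0, holeRadial α D p.1 p.2 r) (c, u) := by
  have hfst : ContinuousAt (Prod.fst : ℝ × ℝ → ℝ) (c, u) := continuousAt_fst
  refine continuousAt_of_dominated (bound := fun r =>
    2 * Real.pi * (2 ^ α * (c + 1 + 1)) * (r * (1 + r) ^ (-α))) ?_ ?_ ?_ ?_
  · exact Eventually.of_forall fun p => (measurable_holeRadial α D p.1 p.2).aestronglyMeasurable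
  · filter_upwards [hfst.eventually_const_lt hc, hfst.eventually_lt_const (lt_add_one c)]
      with p hp1 hp2
    refine (ae_restrict_iff' measurableSet_Ioi).2 (ae_of_all _ fun r hr => ?_)
    exact abs_holeRadial_le (by linarith) hp1 (le_of_lt hp2) (le_of_lt hr)
  · exact (integrableOn_mul_one_add_rpow hα).const_mul _
  · have hne : ∀ᵐ r ∂(volume.restrict (Ioi (0 : ℝ))), r ≠ D - u :=
      ae_restrict_of_ae (by simp [ae_iff])
    filter_upwards [hne, ae_restrict_mem measurableSet_Ioi] with r h1 h2
    exact continuousAt_holeRadial hc hu h2 h1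

theorem setIntegral_nonneg_lossKernel {α c : ℝ} (hc : 0 < c) (S : Set Plane) :
    0 ≤ ∫ y in S, lossKernel α c ‖y‖ :=
  integral_nonneg fun y => lossKernel_nonneg hc (norm_nonneg y)

/-- The area is at most π D ^ 2, and 1 + ‖x‖ ≤ (1 + D) (1 + ‖y‖) in the hole transfers the decay
from `y` to the centre. Hole masses are thus summable over good configurations. -/
theorem holeMass_le {α D c : ℝ} (hα : 2 < α) (hD : 0 < D) (hc : 0 < c) (x : Plane) :
    holeMass α D c x ≤ Real.pi * D ^ 2 * (2 ^ α * (c + 1) * (1 + D) ^ α) *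
      (1 + ‖x‖) ^ (-α) := by
  have hm : MeasurableSet (Metric.ball x D \ Metric.ball 0 (D - ‖x‖)) :=
    measurableSet_ball.diff measurableSet_ball
  have hK : 0 ≤ 2 ^ α * (c + 1) * (1 + D) ^ α * (1 + ‖x‖) ^ (-α) := by positivity
  have hb : ∀ y ∈ Metric.ball x D \ Metric.ball 0 (D - ‖x‖),
      ‖lossKernel α c ‖y‖‖ ≤ 2 ^ α * (c + 1) * (1 + D) ^ α * (1 + ‖x‖) ^ (-α) := by
    intro y hy
    rw [Real.norm_of_nonneg (lossKernel_nonneg hc (norm_nonneg y))]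
    refine (lossKernel_le (by linarith) hc (norm_nonneg y)).trans ?_
    rw [mul_assoc (2 ^ α * (c + 1))]
    refine mul_le_mul_of_nonneg_left ?_ (by positivity)
    have h1 : ‖x‖ ≤ ‖y‖ + D := by
      have h2 := norm_sub_norm_le x y
      have h3 := hy.1
      rw [Metric.mem_ball, dist_eq_norm, norm_sub_rev] at h3
      linarith
    have h4 : 1 + ‖x‖ ≤ (1 + D) * (1 + ‖y‖) := by nlinarith [norm_nonneg y]
    have h5 := Real.rpow_le_rpow (by positivity) h4 (by linarith : 0 ≤ α)
    rw [Real.mul_rpow (by positivity) (by positivity)] at h5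
    rw [Real.rpow_neg (by positivity), Real.rpow_neg (by positivity), ← div_eq_mul_inv,
      le_div_iff₀ (by positivity), inv_mul_le_iff₀ (by positivity)]
    linarith
  have hfin : volume (Metric.ball x D \ Metric.ball 0 (D - ‖x‖)) < ∞ :=
    (measure_mono sdiff_subset).trans_lt measure_ball_lt_top
  have h := norm_setIntegral_le_of_norm_le_const hfin hb
  rw [holeMass]
  refine (le_abs_self _).trans (h.trans ?_)
  have hv : volume.real (Metric.ball x D \ Metric.ball 0 (D - ‖x‖)) ≤ Real.pi * D ^ 2 := by
    rw [← volume_real_ball hD.le x]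
    exact measureReal_mono sdiff_subset measure_ball_lt_top.ne
  calc _ ≤ 2 ^ α * (c + 1) * (1 + D) ^ α * (1 + ‖x‖) ^ (-α) * (Real.pi * D ^ 2) :=
        mul_le_mul_of_nonneg_left hv hK
    _ = _ := by ring

/-- The mass of the loss kernel outside the disc of radius `ρ`. -/
noncomputable def farMass (α c ρ : ℝ) : ℝ :=
  ∫ y in {y : Plane | ρ ≤ ‖y‖}, lossKernel α c ‖y‖

theorem continuousAt_farMass {α : ℝ} (hα : 2 < α) {c ρ : ℝ → ℝ} {z : ℝ} (hcz : 0 < c z)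
    (hc : ContinuousAt c z) (hρ : ContinuousAt ρ z) :
    ContinuousAt (fun t => farMass α (c t) (ρ t)) z := by
  have hm : ∀ t, MeasurableSet {y : Plane | t ≤ ‖y‖} := fun t =>
    measurableSet_le measurable_const measurable_norm
  have h : ∀ t, farMass α (c t) (ρ t) = ∫ y, {y : Plane | ρ t ≤ ‖y‖}.indicator
      (fun y => lossKernel α (c t) ‖y‖) y := fun t => (integral_indicator (hm _)).symm
  simp only [h]
  refine continuousAt_of_dominated
    (bound := fun y => 2 ^ α * (c z + 1 + 1) * (1 + ‖y‖) ^ (-α)) ?_ ?_ ?_ ?_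
  · exact Eventually.of_forall fun t =>
      ((measurable_lossKernel_norm α _).indicator (hm _)).aestronglyMeasurable
  · filter_upwards [hc.eventually_const_lt hcz, hc.eventually_lt_const (lt_add_one (c z))]
      with t h1 h2
    refine ae_of_all _ fun y => ?_
    have h3 := lossKernel_nonneg (α := α) h1 (norm_nonneg y)
    refine (norm_indicator_le_norm_self _ _).trans ?_
    rw [Real.norm_of_nonneg h3]
    exact (lossKernel_mono h1 h2.le (norm_nonneg y)).trans
      (lossKernel_le (by linarith) (by linarith) (norm_nonneg y))
  · exact (integrable_one_add_norm_rpow hα).const_mul _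
  · have hs : ∀ᵐ y : Plane, y ∉ Metric.sphere (0 : Plane) (ρ z) :=
      measure_eq_zero_iff_ae_notMem.1 (Measure.addHaar_sphere volume 0 (ρ z))
    filter_upwards [hs] with y hy
    rw [mem_sphere_zero_iff_norm] at hy
    rcases lt_or_gt_of_ne hy with h | h
    · refine (continuousAt_const (y := (0 : ℝ))).congr ?_
      filter_upwards [hρ.eventually_const_lt h] with t ht
      rw [indicator_of_notMem (by simpa using ht)]
    · have h2 : ContinuousAt (fun t => lossKernel α (c t) ‖y‖) z :=
        ContinuousAt.comp (g := fun c => lossKernel α c ‖y‖)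
          (continuousAt_lossKernel hcz (norm_nonneg y)) hc
      refine h2.congr ?_
      filter_upwards [hρ.eventually_lt_const h] with t ht
      rw [indicator_of_mem (by simpa using ht.le)]

theorem lintegral_exp_neg_mul_Ioi {A : ℝ} (hA : 0 < A) :
    ∫⁻ t in Ioi (0 : ℝ), ENNReal.ofReal (Real.exp (-A * t)) = ENNReal.ofReal (1 / A) := by
  rw [← ofReal_integral_eq_lintegral_ofReal (integrableOn_exp_mul_Ioi (by linarith) 0)
    (ae_of_all _ fun t => (Real.exp_pos _).le), integral_exp_mul_Ioi (by linarith)]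
  congr 1
  simp

theorem lintegral_mul_exp_neg_mul_rpow_Ioi {α b : ℝ} (hα : 2 < α) (hb : 0 < b) :
    ∫⁻ r in Ioi (0 : ℝ), ENNReal.ofReal (r * Real.exp (-b * r ^ α)) =
      ENNReal.ofReal (b ^ (-(2 / α)) * (1 / α) * Real.Gamma (2 / α)) := by
  have h1 := integrableOn_rpow_mul_exp_neg_mul_rpow (s := 1) (p := α) (b := b) (by norm_num)
    (by linarith) hb
  have h2 := integral_rpow_mul_exp_neg_mul_rpow (q := 1) (p := α) (b := b) (by linarith)
    (by norm_num) hb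
  simp only [Real.rpow_one] at h1 h2
  rw [← ofReal_integral_eq_lintegral_ofReal h1, h2]
  · congr 3 <;> norm_num
    congr 1
    ring
  · exact (ae_restrict_iff' measurableSet_Ioi).2 (ae_of_all _ fun r hr =>
      mul_nonneg (le_of_lt hr) (Real.exp_pos _).le)

theorem lintegral_exp_neg_mul_rpow_Ioi {a : ℝ} (ha : a < 1) :
    ∫⁻ t in Ioi (0 : ℝ), ENNReal.ofReal (Real.exp (-t) * t ^ (-a)) =
      ENNReal.ofReal (Real.Gamma (1 - a)) := by
  have h1 := Real.GammaIntegral_convergent (s := 1 - a) (by linarith)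
  have h2 := Real.Gamma_eq_integral (s := 1 - a) (by linarith)
  have h3 : 1 - a - 1 = -a := by ring
  rw [h3] at h1 h2
  rw [h2, ofReal_integral_eq_lintegral_ofReal h1]
  exact (ae_restrict_iff' measurableSet_Ioi).2 (ae_of_all _ fun r hr =>
      mul_nonneg (Real.exp_pos _).le (Real.rpow_nonneg (le_of_lt hr) _))

/-- Write 1 / (1 + r ^ α / c) as the integral of e^(-(1 + r ^ α / c) t) over t > 0 and swap by
Tonelli. The two integrals give Γ(2 / α) and Γ(1 - 2 / α), both arguments positive as α > 2, and the
reflection formula gives the sinc. -/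
theorem integral_mul_lossKernel {α c : ℝ} (hα : 2 < α) (hc : 0 < c) :
    ∫ r in Ioi 0, r * lossKernel α c r = c ^ (2 / α) / nsinc (2 / α) / 2 := by
  have hα0 : 0 < α := by linarith
  have ha0 : 0 < 2 / α := by positivity
  have ha1 : 2 / α < 1 := (div_lt_one hα0).2 hα
  have hsin : 0 < Real.sin (Real.pi * (2 / α)) :=
    Real.sin_pos_of_pos_of_lt_pi (by positivity) (by nlinarith [Real.pi_pos])
  have hG := Real.Gamma_mul_Gamma_one_sub (2 / α)
  have hG1 := Real.Gamma_pos_of_pos ha0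
  have hG2 := Real.Gamma_pos_of_pos (sub_pos.2 ha1)
  have key : ∫⁻ r in Ioi (0 : ℝ), ENNReal.ofReal (r * lossKernel α c r) =
      ENNReal.ofReal (c ^ (2 / α) * (1 / α) * (Real.Gamma (2 / α) * Real.Gamma (1 - 2 / α))) := by
    calc _ = ∫⁻ r in Ioi (0 : ℝ), ∫⁻ t in Ioi (0 : ℝ),
          ENNReal.ofReal (r * Real.exp (-(1 + r ^ α / c) * t)) := by
          refine setLIntegral_congr_fun measurableSet_Ioi fun r hr => ?_
          have hr : 0 < r := hr
          simp only [ENNReal.ofReal_mul hr.le]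
          rw [lintegral_const_mul' _ _ ENNReal.ofReal_ne_top,
            lintegral_exp_neg_mul_Ioi (by positivity)]
          rfl
      _ = ∫⁻ t in Ioi (0 : ℝ), ∫⁻ r in Ioi (0 : ℝ),
          ENNReal.ofReal (r * Real.exp (-(1 + r ^ α / c) * t)) := by
          refine lintegral_lintegral_swap (Measurable.aemeasurable ?_)
          fun_prop
      _ = ∫⁻ t in Ioi (0 : ℝ), ENNReal.ofReal (c ^ (2 / α) * (1 / α) * Real.Gamma (2 / α)) *
          ENNReal.ofReal (Real.exp (-t) * t ^ (-(2 / α))) := by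
          refine setLIntegral_congr_fun measurableSet_Ioi fun t ht => ?_
          have ht : 0 < t := ht
          have h1 : ∀ r : ℝ, ENNReal.ofReal (r * Real.exp (-(1 + r ^ α / c) * t)) =
              ENNReal.ofReal (Real.exp (-t)) *
                ENNReal.ofReal (r * Real.exp (-(t / c) * r ^ α)) := fun r => by
            rw [← ENNReal.ofReal_mul (Real.exp_pos _).le, mul_left_comm, ← Real.exp_add]
            congr 3
            ring
          simp only [h1]
          rw [lintegral_const_mul' _ _ ENNReal.ofReal_ne_top,
            lintegral_mul_exp_neg_mul_rpow_Ioi hα (by positivity),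
            ← ENNReal.ofReal_mul (by positivity), ← ENNReal.ofReal_mul (by positivity),
            Real.div_rpow ht.le hc.le, Real.rpow_neg hc.le]
          congr 1
          field_simp
      _ = _ := by
          rw [lintegral_const_mul' _ _ ENNReal.ofReal_ne_top, lintegral_exp_neg_mul_rpow_Ioi ha1,
            ← ENNReal.ofReal_mul (by positivity), mul_assoc]
  rw [integral_eq_lintegral_of_nonneg_ae, key, ENNReal.toReal_ofReal (by positivity), hG, nsinc,
    Real.sinc_of_ne_zero (by positivity)]
  · field_simp
  · exact (ae_restrict_iff' measurableSet_Ioi).2 (ae_of_all _ fun r hr =>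
      mul_nonneg (le_of_lt hr) (lossKernel_nonneg hc (le_of_lt hr)))
  · exact (measurable_id.mul (measurable_lossKernel α c)).aestronglyMeasurable

theorem fadingLoss_nonneg {α P s v : ℝ} (hsP : 0 ≤ s * P) (hv : 0 ≤ v) :
    0 ≤ fadingLoss α P s v :=
  Real.log_nonneg (by have : 0 ≤ s * P * v ^ (-α) := by positivity
                      linarith)

/-- log (1 + t) ≤ t, together with 1 + v ≤ (1 + a) / a * v for v ≥ a. The constant blows up as a
tends to 0, hence the cut-off δ for small cells near the user. -/
theorem fadingLoss_le {α P s v a : ℝ} (hα : 0 ≤ α) (hsP : 0 ≤ s * P) (ha : 0 < a) (hv : a ≤ v) :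
    fadingLoss α P s v ≤ s * P * ((1 + a) / a) ^ α * (1 + v) ^ (-α) := by
  have hv0 : 0 < v := ha.trans_le hv
  have h1 : fadingLoss α P s v ≤ s * P * v ^ (-α) := by
    have h : 0 ≤ s * P * v ^ (-α) := by positivity
    have := Real.log_le_sub_one_of_pos (by linarith : 0 < 1 + s * P * v ^ (-α))
    unfold fadingLoss
    linarith
  have h2 : v ^ (-α) ≤ ((1 + a) / a) ^ α * (1 + v) ^ (-α) := by
    have h3 : 1 + v ≤ (1 + a) / a * v := by
      rw [div_mul_eq_mul_div, le_div_iff₀ ha]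
      nlinarith
    have h4 := Real.rpow_le_rpow (by positivity) h3 hα
    rw [Real.mul_rpow (by positivity) hv0.le] at h4
    rw [Real.rpow_neg hv0.le, Real.rpow_neg (by positivity), ← div_eq_mul_inv,
      le_div_iff₀ (by positivity), inv_mul_le_iff₀ (by positivity)]
    linarith
  calc _ ≤ _ := h1
    _ ≤ _ := by
      rw [mul_assoc (s * P)]
      exact mul_le_mul_of_nonneg_left h2 hsP

theorem exists_norm_eq_plane {v : ℝ} (hv : 0 ≤ v) : ∃ x : Plane, ‖x‖ = v :=
  ⟨EuclideanSpace.single 0 v, by simp [abs_of_nonneg hv]⟩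

theorem holeTerm_bounds {lam₂ α P₂ D s v : ℝ} (hlam₂ : 0 ≤ lam₂) (hα : 2 < α) (hD : 0 < D)
    (hc : 0 < s * P₂) (hv : 0 < v) :
    0 ≤ holeTerm lam₂ α P₂ D s v ∧ holeTerm lam₂ α P₂ D s v ≤
      lam₂ * (Real.pi * D ^ 2 * (2 ^ α * (s * P₂ + 1) * (1 + D) ^ α)) * (1 + v) ^ (-α) := by
  obtain ⟨x, rfl⟩ := exists_norm_eq_plane hv.le
  rw [holeTerm_eq_holeMass hD hc (norm_pos_iff.1 hv), mul_assoc lam₂]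
  exact ⟨mul_nonneg hlam₂ (setIntegral_nonneg_lossKernel hc _),
    mul_le_mul_of_nonneg_left (holeMass_le hα hD hc x) hlam₂⟩

theorem continuousAt_holeTerm {lam₂ α P₂ D : ℝ} (hα : 2 < α) (hD : 0 < D) {s u : ℝ → ℝ} {z : ℝ}
    (hs : ContinuousAt s z) (hu : ContinuousAt u z) (hc : 0 < s z * P₂) (huz : 0 < u z) :
    ContinuousAt (fun t => holeTerm lam₂ α P₂ D (s t) (u t)) z := by
  have h1 : ContinuousAt (fun t => lam₂ * ∫ r in Ioi 0, holeRadial α D (s t * P₂) (u t) r) z := by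
    have h2 : ContinuousAt (fun t => (s t * P₂, u t)) z := (hs.mul_const P₂).prodMk hu
    exact (ContinuousAt.comp (f := fun t => (s t * P₂, u t)) (x := z)
      (g := fun p : ℝ × ℝ => ∫ r in Ioi 0, holeRadial α D p.1 p.2 r)
      (continuousAt_integral_holeRadial hα hc huz) h2).const_mul lam₂
  refine h1.congr ?_
  filter_upwards [hu.eventually_const_lt huz] with t ht
  exact (holeTerm_eq_integral hD ht).symm

/-! ### The macro potential and the exponents of the G factors. -/

/-- The potential of the macro interferers seen from a user at distance `z` from its server: the
hole correction minus the fading loss. -/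
noncomputable def macroPotential (lam₂ α P₁ P₂ D γ z v : ℝ) : ℝ :=
  holeTerm lam₂ α P₂ D (γ * z ^ α / P₁) v - fadingLoss α P₁ (γ * z ^ α / P₁) v

theorem exp_macroPotential {lam₂ α P₁ P₂ D γ z v : ℝ} (hP₁ : 0 < P₁) (hγ : 0 < γ) (hz : 0 < z)
    (hv : 0 < v) :
    Real.exp (macroPotential lam₂ α P₁ P₂ D γ z v) =
      Real.exp (holeTerm lam₂ α P₂ D (γ * z ^ α / P₁) v) * zeta α P₁ (γ * z ^ α / P₁) v := by
  rw [macroPotential, sub_eq_add_neg, Real.exp_add, fadingLoss, Real.exp_neg,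
    Real.exp_log (by positivity), zeta, one_div]

theorem continuousAt_laplaceVar {α P₁ γ z : ℝ} (hz : 0 < z) :
    ContinuousAt (fun z : ℝ => γ * z ^ α / P₁) z :=
  ((Real.continuousAt_rpow_const z α (Or.inl hz.ne')).const_mul γ).div_const P₁

theorem isRadialPotential_macroPotential {lam₂ α P₁ P₂ D γ : ℝ} (hlam₂ : 0 ≤ lam₂) (hα : 2 < α)
    (hP₁ : 0 < P₁) (hP₂ : 0 < P₂) (hD : 0 < D) (hγ : 0 < γ) :
    IsRadialPotential α (macroPotential lam₂ α P₁ P₂ D γ) where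
  measurable z hz := by
    classical
    have hs : 0 < γ * z ^ α / P₁ := by positivity
    rw [← piecewise_eq_indicator]
    refine ContinuousOn.measurable_piecewise (fun v hv => ContinuousAt.continuousWithinAt ?_)
      continuousOn_const measurableSet_Ici
    have hv0 : 0 < v := hz.trans_le hv
    refine (continuousAt_holeTerm hα hD continuousAt_const continuousAt_id
      (mul_pos hs hP₂) hv0).sub ?_
    refine ContinuousAt.log ?_ (by positivity)
    exact continuousAt_const.add ((Real.continuousAt_rpow_const v (-α)
      (Or.inl hv0.ne')).const_mul _)
  continuousOn v hv z hz := by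
    have hz0 : 0 < z := hz.1
    have hs : 0 < γ * z ^ α / P₁ := by positivity
    have hc := continuousAt_laplaceVar (α := α) (P₁ := P₁) (γ := γ) hz0
    refine ContinuousAt.continuousWithinAt ?_
    refine (continuousAt_holeTerm hα hD hc continuousAt_const (mul_pos hs hP₂) hv).sub ?_
    refine ContinuousAt.log ?_ (by positivity)
    exact continuousAt_const.add ((hc.mul_const P₁).mul_const _)
  bound a b ha hab := by
    -- The Laplace variable increases with `z`, so its value at `b` serves the whole interval.
    set S := γ * b ^ α / P₁ with hS
    have hb : 0 < b := ha.trans hab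
    have hS0 : 0 < S := by positivity
    refine ⟨lam₂ * (Real.pi * D ^ 2 * (2 ^ α * (S * P₂ + 1) * (1 + D) ^ α)) +
      S * P₁ * ((1 + a) / a) ^ α, by have := Real.pi_pos; positivity, fun z hz v hv => ?_⟩
    have hz0 : 0 < z := ha.trans_le hz.1
    have hv0 : 0 < v := hz0.trans_le hv
    have hs : 0 < γ * z ^ α / P₁ := by positivity
    have hsS : γ * z ^ α / P₁ ≤ S := by
      have := Real.rpow_le_rpow hz0.le hz.2 (by linarith : 0 ≤ α)
      rw [hS]
      gcongr
    obtain ⟨h1, h2⟩ := holeTerm_bounds (α := α) hlam₂ hα hD (mul_pos hs hP₂) hv0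
    have h3 := fadingLoss_nonneg (α := α) (mul_pos hs hP₁).le hv0.le
    have h4 := fadingLoss_le (α := α) (by linarith) (mul_pos hs hP₁).le ha (hz.1.trans hv)
    have h5 : lam₂ * (Real.pi * D ^ 2 * (2 ^ α * (γ * z ^ α / P₁ * P₂ + 1) * (1 + D) ^ α)) *
        (1 + v) ^ (-α) ≤ lam₂ * (Real.pi * D ^ 2 * (2 ^ α * (S * P₂ + 1) * (1 + D) ^ α)) *
        (1 + v) ^ (-α) := by
      have := Real.pi_pos
      gcongr
    have h6 : γ * z ^ α / P₁ * P₁ * ((1 + a) / a) ^ α * (1 + v) ^ (-α) ≤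
        S * P₁ * ((1 + a) / a) ^ α * (1 + v) ^ (-α) := by gcongr
    have h7 : 0 ≤ S * P₁ * ((1 + a) / a) ^ α * (1 + v) ^ (-α) := by positivity
    have h8 : 0 ≤ lam₂ * (Real.pi * D ^ 2 * (2 ^ α * (S * P₂ + 1) * (1 + D) ^ α)) *
        (1 + v) ^ (-α) := h1.trans (h2.trans h5)
    rw [macroPotential, add_mul, abs_le]
    constructor <;> linarith

theorem IsRadialPotential.integrableOn_exp_sub_one {α : ℝ} (hα : 2 < α) {Ψ : ℝ → ℝ → ℝ}
    (hΨ : IsRadialPotential α Ψ) {z : ℝ} (hz : 0 < z) :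
    IntegrableOn (fun y : Plane => Real.exp (Ψ z ‖y‖) - 1) {y | z ≤ ‖y‖} := by
  obtain ⟨K, hK, hb⟩ := hΨ.bound z (z + 1) hz (by linarith)
  have hm : MeasurableSet {y : Plane | z ≤ ‖y‖} :=
    measurableSet_le measurable_const measurable_norm
  have hmeas : Measurable fun y : Plane => Real.exp ((Ici z).indicator (Ψ z) ‖y‖) - 1 :=
    ((hΨ.measurable z hz).comp measurable_norm).exp.sub_const 1
  have hint : IntegrableOn (fun y : Plane => Real.exp ((Ici z).indicator (Ψ z) ‖y‖) - 1)
      {y | z ≤ ‖y‖} := by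
    refine Integrable.mono' (((integrable_one_add_norm_rpow hα).const_mul K).const_mul
      (Real.exp K)).integrableOn hmeas.aestronglyMeasurable
      ((ae_restrict_iff' hm).2 (ae_of_all _ fun y hy => ?_))
    rw [indicator_of_mem (by exact hy)]
    have h := hb z ⟨le_rfl, by linarith⟩ ‖y‖ hy
    have h1 : (1 + ‖y‖) ^ (-α) ≤ 1 := Real.rpow_le_one_of_one_le_of_nonpos
      (by linarith [norm_nonneg y]) (by linarith)
    refine (abs_exp_sub_one_le_of_le hK ?_).trans
      (mul_le_mul_of_nonneg_left h (Real.exp_pos _).le)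
    nlinarith [le_abs_self (Ψ z ‖y‖)]
  refine hint.congr_fun (fun y hy => ?_) hm
  simp only
  rw [indicator_of_mem (by exact hy)]

section Exponents

variable {lam₁ lam₂ α P₁ P₂ D γ z : ℝ}

theorem pgflIntegrand_eq (hP₁ : 0 < P₁) (hγ : 0 < γ) (hz : 0 < z) {v : ℝ} (hv : 0 < v) :
    pgflIntegrand lam₂ α P₁ P₂ D (γ * z ^ α / P₁) v =
      -(v * (Real.exp (macroPotential lam₂ α P₁ P₂ D γ z v) - 1)) := by
  rw [exp_macroPotential hP₁ hγ hz hv, pgflIntegrand]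
  ring

theorem integrableOn_pgflIntegrand (hlam₂ : 0 ≤ lam₂) (hα : 2 < α)
    (hP₁ : 0 < P₁) (hP₂ : 0 < P₂) (hD : 0 < D) (hγ : 0 < γ) (hz : 0 < z) :
    IntegrableOn (pgflIntegrand lam₂ α P₁ P₂ D (γ * z ^ α / P₁)) (Ioi z) := by
  have h := (integrableOn_mul_of_integrable_norm
    (f := fun v => Real.exp (macroPotential lam₂ α P₁ P₂ D γ z v) - 1) hz.le
    ((isRadialPotential_macroPotential hlam₂ hα hP₁ hP₂ hD hγ).integrableOn_exp_sub_one
      hα hz)).neg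
  exact h.congr_fun (fun v hv => (pgflIntegrand_eq hP₁ hγ hz (hz.trans hv)).symm)
    measurableSet_Ioi

theorem G₄_eq (hP₁ : 0 < P₁) (hγ : 0 < γ) (hz : 0 < z) :
    G₄ lam₁ lam₂ α P₁ P₂ D (γ * z ^ α / P₁) z = Real.exp (lam₁ *
      ∫ y in {y : Plane | z ≤ ‖y‖}, (Real.exp (macroPotential lam₂ α P₁ P₂ D γ z ‖y‖) - 1)) := by
  rw [G₄, setIntegral_norm hz.le
    (fun v => Real.exp (macroPotential lam₂ α P₁ P₂ D γ z v) - 1),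
    setIntegral_congr_fun measurableSet_Ioi
    fun v hv => pgflIntegrand_eq hP₁ hγ hz (hz.trans hv), integral_neg]
  congr 1
  ring

theorem farIntegrand_eq (lam₂ α P₂ s r : ℝ) :
    farIntegrand lam₂ α P₂ s r = -(2 * Real.pi * lam₂) * (r * lossKernel α (s * P₂) r) := by
  rw [farIntegrand, lossKernel]
  ring

theorem integrableOn_farIntegrand (hα : 2 < α) {s : ℝ} (hc : 0 < s * P₂) {ρ : ℝ} (hρ : 0 ≤ ρ) :
    IntegrableOn (farIntegrand lam₂ α P₂ s) (Ioi ρ) := by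
  have h : IntegrableOn (fun r => -(2 * Real.pi * lam₂) * (r * lossKernel α (s * P₂) r)) (Ioi ρ) :=
    (integrableOn_mul_of_integrable_norm hρ
      (integrable_lossKernel hα hc).integrableOn).const_mul _
  exact h.congr_fun (fun r _ => (farIntegrand_eq lam₂ α P₂ s r).symm) measurableSet_Ioi

theorem G₁_eq {s : ℝ} (hzD : z ≤ D) :
    G₁ lam₂ α P₂ D s z = Real.exp (-(lam₂ * farMass α (s * P₂) (D - z))) := by
  rw [G₁, farMass, setIntegral_norm (by linarith)]
  simp only [farIntegrand_eq]
  rw [integral_const_mul]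
  congr 1
  ring

/-- For z > D the radius D - z is negative and `farMass` is the mass of the whole plane; both
regimes of the theorem are thus one function of `z`. -/
theorem G₁hat_eq (hα : 2 < α) {s : ℝ} (hc : 0 < s * P₂) (hzD : D < z) :
    G₁hat lam₂ α P₂ s = Real.exp (-(lam₂ * farMass α (s * P₂) (D - z))) := by
  have h : {y : Plane | D - z ≤ ‖y‖} = univ :=
    eq_univ_of_forall fun y => by
      have := norm_nonneg y
      change D - z ≤ ‖y‖
      linarith
  rw [G₁hat, farMass, h, setIntegral_univ, integral_norm, integral_mul_lossKernel hα hc]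
  congr 1
  ring

theorem intervalIntegrable_holeIntegrand (hα : 2 < α) {s : ℝ} (hD : 0 < D)
    (hc : 0 < s * P₂) {u : ℝ} (hu : 0 < u) :
    IntervalIntegrable (holeIntegrand lam₂ α P₂ D s u) volume |u - D| (u + D) := by
  have hle : |u - D| ≤ u + D := abs_le.2 ⟨by linarith, by linarith⟩
  rw [intervalIntegrable_iff_integrableOn_Ioc_of_le hle]
  have h1 : IntegrableOn (holeRadial α D (s * P₂) u) (Ioi 0) := by
    refine Integrable.mono' ((integrableOn_mul_one_add_rpow hα).const_mul
      (2 * Real.pi * (2 ^ α * (s * P₂ + 1)))) (measurable_holeRadial _ _ _ _).aestronglyMeasurable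
      ((ae_restrict_iff' measurableSet_Ioi).2 (ae_of_all _ fun r hr => ?_))
    exact abs_holeRadial_le (by linarith) hc le_rfl (le_of_lt hr)
  have h2 : IntegrableOn (fun r => lam₂ * holeRadial α D (s * P₂) u r) (Ioc |u - D| (u + D)) :=
    (h1.mono_set fun r hr => (abs_nonneg _).trans_lt hr.1).const_mul lam₂
  refine h2.congr_fun (fun r hr => ?_) measurableSet_Ioc
  have h3 : D - u ≤ r := by linarith [neg_abs_le (u - D), hr.1]
  simp only
  rw [holeRadial, if_pos h3, holeIntegrand, lossKernel, holeCos, mul_comm P₂ s]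
  ring

end Exponents

/-! ### Geometry of the holes and averaging over the baseline process. -/

theorem isOpen_holes (D : ℝ) (x : ℕ → Plane) : IsOpen (holes D x) :=
  isOpen_iUnion fun _ => Metric.isOpen_ball

theorem ofReal_setIntegral_lossKernel {α c : ℝ} (hα : 2 < α) (hc : 0 < c) (S : Set Plane) :
    ENNReal.ofReal (∫ y in S, lossKernel α c ‖y‖) =
      ∫⁻ y in S, ENNReal.ofReal (lossKernel α c ‖y‖) :=
  ofReal_integral_eq_lintegral_ofReal (integrable_lossKernel hα hc).integrableOn
    (ae_of_all _ fun y => lossKernel_nonneg hc (norm_nonneg y))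

theorem IsGood.summable_holeMass {α D c : ℝ} (hα : 2 < α) (hD : 0 < D) (hc : 0 < c)
    {x : ℕ → Plane} (hx : IsGood α x) : Summable fun i => holeMass α D c (x i) :=
  .of_nonneg_of_le (fun _ => setIntegral_nonneg_lossKernel hc _)
    (fun i => holeMass_le hα hD hc (x i)) (hx.summable.mul_left _)

/-- Overlaps between holes are counted with multiplicity, and the part of each hole that is too
close to the origin to be possible is left out. -/
theorem IsGood.farMass_le {α D c : ℝ} (hα : 2 < α) (hD : 0 < D) (hc : 0 < c)
    {x : ℕ → Plane} (hx : IsGood α x) :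
    farMass α c (D - ‖x (nearest x)‖) ≤
      (∫ y in (holes D x)ᶜ, lossKernel α c ‖y‖) + ∑' i, holeMass α D c (x i) := by
  have h0 : ∀ i, 0 ≤ holeMass α D c (x i) := fun i => setIntegral_nonneg_lossKernel hc _
  have h1 := setIntegral_nonneg_lossKernel (α := α) hc (holes D x)ᶜ
  rw [← ENNReal.ofReal_le_ofReal_iff (add_nonneg h1 (tsum_nonneg h0)),
    ENNReal.ofReal_add h1 (tsum_nonneg h0),
    ENNReal.ofReal_tsum_of_nonneg h0 (hx.summable_holeMass hα hD hc), farMass,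
    ofReal_setIntegral_lossKernel hα hc, ofReal_setIntegral_lossKernel hα hc]
  simp only [holeMass, ofReal_setIntegral_lossKernel hα hc]
  -- Every ‖x i‖ is at least the nearest norm, so a point beyond D - ‖x (nearest x)‖ is also beyond
  -- D - ‖x i‖ and survives in the truncated hole.
  have hsub : {y : Plane | D - ‖x (nearest x)‖ ≤ ‖y‖} ⊆
      (holes D x)ᶜ ∪ ⋃ i, Metric.ball (x i) D \ Metric.ball 0 (D - ‖x i‖) := by
    intro y hy
    by_cases hh : y ∈ holes D x
    · obtain ⟨i, hi⟩ := mem_iUnion.1 hh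
      refine Or.inr (mem_iUnion.2 ⟨i, hi, ?_⟩)
      have h2 := hx.norm_nearest_le (by linarith) i
      have h3 : D - ‖x (nearest x)‖ ≤ ‖y‖ := hy
      rw [mem_ball_zero_iff, not_lt]
      linarith
    · exact Or.inl hh
  calc _ ≤ _ := lintegral_mono_set hsub
    _ ≤ _ := lintegral_union_le _ _ _
    _ ≤ _ := by gcongr; exact lintegral_iUnion_le _ _

section Conditional

variable {W : Type*} [MeasurableSpace W] {μ : Measure W} [IsProbabilityMeasure μ]
  {lam₁ lam₂ P₁ P₂ D α γ : ℝ} {X Y : ℕ → W → Plane} {h g : ℕ → W → ℝ}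

open scoped Classical in
theorem measurable_ite_fadingLoss (α P₂ D s δ : ℝ) (x : ℕ → Plane) :
    Measurable fun y : Plane =>
      if y ∈ holes D x ∨ ‖y‖ < δ then 0 else fadingLoss α P₂ s ‖y‖ := by
  refine Measurable.ite ((isOpen_holes D x).measurableSet.union
    (measurableSet_lt measurable_norm measurable_const)) measurable_const ?_
  unfold fadingLoss
  fun_prop

open scoped Classical in
theorem integrable_ite_fadingLoss (hα : 2 < α) (D : ℝ) {s δ : ℝ} (hc : 0 < s * P₂) (hδ : 0 < δ)
    (x : ℕ → Plane) :
    Integrable fun y : Plane =>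
      if y ∈ holes D x ∨ ‖y‖ < δ then 0 else fadingLoss α P₂ s ‖y‖ := by
  refine ((integrable_one_add_norm_rpow hα).const_mul (s * P₂ * ((1 + δ) / δ) ^ α)).mono'
    (measurable_ite_fadingLoss α P₂ D s δ x).aestronglyMeasurable (ae_of_all _ fun y => ?_)
  split_ifs with hy
  · rw [norm_zero]
    positivity
  · rw [not_or, not_lt] at hy
    rw [Real.norm_of_nonneg (fadingLoss_nonneg hc.le (norm_nonneg y))]
    exact fadingLoss_le (by linarith) hc.le hδ hy.2

open scoped Classical in
-- The Laplace bound for the potential minus the loss, which is at most 0. The configuration `x` is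
-- fixed, so the holes form a deterministic set, and 1 - e^(-loss) is the loss kernel.
theorem lintegral_small_cells_le (hlam₂ : 0 ≤ lam₂) (hY : IsPoissonProcess lam₂ Y μ) (hα : 2 < α)
    {s δ : ℝ} (hc : 0 < s * P₂) (hδ : 0 < δ) (x : ℕ → Plane) :
    ∫⁻ w, ENNReal.ofReal (Real.exp (-∑' j, if Y j w ∈ holes D x ∨ ‖Y j w‖ < δ then 0
      else fadingLoss α P₂ s ‖Y j w‖)) ∂μ ≤
    ENNReal.ofReal (Real.exp
      (-(lam₂ * ∫ y in (holes D x)ᶜ ∩ {y | δ ≤ ‖y‖}, lossKernel α (s * P₂) ‖y‖))) := by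
  set ψ : Plane → ℝ := fun y =>
    -(if y ∈ holes D x ∨ ‖y‖ < δ then 0 else fadingLoss α P₂ s ‖y‖) with hψ
  have hm : MeasurableSet ((holes D x)ᶜ ∩ {y : Plane | δ ≤ ‖y‖}) :=
    (isOpen_holes D x).measurableSet.compl.inter (measurableSet_le measurable_const measurable_norm)
  have h := hY.lintegral_exp_le hlam₂ (ψ := ψ) (measurable_ite_fadingLoss α P₂ D s δ x).neg
    (integrable_ite_fadingLoss hα D hc hδ x).neg (M := 0) fun y => by
      have := fadingLoss_nonneg (α := α) hc.le (norm_nonneg y)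
      simp only [hψ]
      split_ifs <;> linarith
  simp only [hψ, tsum_neg] at h
  refine h.trans_eq ?_
  rw [← integral_indicator hm, ← mul_neg, ← integral_neg]
  congr 4
  ext y
  by_cases hy : y ∈ holes D x ∨ ‖y‖ < δ
  · rw [if_pos hy, indicator_of_notMem]
    · simp
    · rintro ⟨h1, h2⟩
      rcases hy with hy | hy
      exacts [h1 hy, (not_lt.2 h2) hy]
  · rw [if_neg hy]
    rw [not_or, not_lt] at hy
    rw [indicator_of_mem (show y ∈ (holes D x)ᶜ ∩ {y : Plane | δ ≤ ‖y‖} from hy),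
      ← one_sub_exp_neg_fadingLoss hc (hδ.trans_le hy.2)]
    ring

/-- Removes the cut-off near the origin: the loss kernel is integrable there, and only the origin
itself is lost in the union. -/
theorem tendsto_setIntegral_lossKernel_inter (hα : 2 < α) {c : ℝ} (hc : 0 < c) (S : Set Plane)
    (hS : MeasurableSet S) :
    Tendsto (fun k : ℕ => ∫ y in S ∩ {y | 1 / ((k : ℝ) + 1) ≤ ‖y‖}, lossKernel α c ‖y‖) atTop
      (𝓝 (∫ y in S, lossKernel α c ‖y‖)) := by
  have hm : ∀ k : ℕ, MeasurableSet (S ∩ {y : Plane | 1 / ((k : ℝ) + 1) ≤ ‖y‖}) := fun k =>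
    hS.inter (measurableSet_le measurable_const measurable_norm)
  have hU : (⋃ k : ℕ, S ∩ {y : Plane | 1 / ((k : ℝ) + 1) ≤ ‖y‖}) =ᵐ[volume] S := by
    refine ae_eq_set.2 ⟨?_, ?_⟩
    · rw [sdiff_eq_empty.2 (iUnion_subset fun k => inter_subset_left), measure_empty]
    · refine measure_mono_null (t := {0}) (fun y hy => ?_) (measure_singleton _)
      by_contra h0
      obtain ⟨k, hk⟩ := exists_nat_one_div_lt (norm_pos_iff.2 h0)
      exact hy.2 (mem_iUnion.2 ⟨k, hy.1, hk.le⟩)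
  rw [← setIntegral_congr_set hU]
  refine tendsto_setIntegral_of_monotone hm (fun k l hkl => inter_subset_inter_right _ ?_)
    (integrable_lossKernel hα hc).integrableOn
  intro y hy
  have hkl' : (k : ℝ) ≤ l := by exact_mod_cast hkl
  have h : 1 / ((l : ℝ) + 1) ≤ 1 / ((k : ℝ) + 1) := by gcongr
  exact h.trans hy

/-- The factor contributed by the baseline points and by the hole of the serving station, when the
latter is at distance `z`. -/
noncomputable def servingFactor (lam₂ α P₁ P₂ D γ z : ℝ) : ℝ :=
  Real.exp (-(lam₂ * farMass α (γ * z ^ α / P₁ * P₂) (D - z)) +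
    holeTerm lam₂ α P₂ D (γ * z ^ α / P₁) z)

theorem continuousOn_servingFactor (hα : 2 < α) (hP₁ : 0 < P₁) (hP₂ : 0 < P₂) (hD : 0 < D)
    (hγ : 0 < γ) : ContinuousOn (servingFactor lam₂ α P₁ P₂ D γ) (Ioi 0) := by
  intro z hz
  have hz0 : 0 < z := hz
  have hs := continuousAt_laplaceVar (α := α) (P₁ := P₁) (γ := γ) hz0
  have hc : 0 < γ * z ^ α / P₁ * P₂ := by positivity
  refine ContinuousAt.continuousWithinAt (ContinuousAt.rexp (ContinuousAt.add ?_ ?_))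
  · exact ((continuousAt_farMass (c := fun t => γ * t ^ α / P₁ * P₂) (ρ := fun t => D - t) hα hc
      (hs.mul_const P₂) (continuousAt_const.sub continuousAt_id)).const_mul lam₂).neg
  · exact continuousAt_holeTerm hα hD hs continuousAt_id hc hz0

open scoped Classical in
/-- For a fixed configuration of macro stations, the coverage probability averaged over the fading
and over the baseline process. -/
theorem lintegral_measure_le_sir_le (hlam₂ : 0 < lam₂) (hP₁ : 0 < P₁) (hP₂ : 0 < P₂) (hD : 0 < D)
    (hα : 2 < α) (hγ : 0 < γ) (hY : IsPoissonProcess lam₂ Y μ)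
    (hind : iIndepFun (fun k : ℕ ⊕ ℕ => Sum.elim h g k) μ)
    (hh : ∀ i, HasLaw (h i) (expMeasure 1) μ) (hg : ∀ j, HasLaw (g j) (expMeasure 1) μ)
    {x : ℕ → Plane} (hx : IsGood α x) :
    ∫⁻ w, μ {w' | ENNReal.ofReal γ ≤ sir α P₁ P₂ D x (fun j => Y j w) (fun i => h i w')
        (fun j => g j w')} ∂μ ≤
      ENNReal.ofReal (servingFactor lam₂ α P₁ P₂ D γ ‖x (nearest x)‖ *
        Real.exp (∑' i, if i = nearest x then 0
          else macroPotential lam₂ α P₁ P₂ D γ ‖x (nearest x)‖ ‖x i‖)) := by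
  set n := nearest x with hn
  set z := ‖x n‖ with hz
  have hz0 : 0 < z := norm_pos_iff.2 (hx.ne_zero n)
  set s := γ * z ^ α / P₁ with hs
  have hs0 : 0 < s := by positivity
  have hc : 0 < s * P₂ := by positivity
  have hc₁ : 0 ≤ s * P₁ := by positivity
  have hsx : Summable fun i => if i = n then 0 else fadingLoss α P₁ s ‖x i‖ := by
    refine .of_nonneg_of_le (fun i => ?_) (fun i => ?_)
      (hx.summable.mul_left (s * P₁ * ((1 + z) / z) ^ α))
    · split_ifs
      exacts [le_rfl, fadingLoss_nonneg hc₁ (norm_nonneg _)]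
    · split_ifs
      · positivity
      · exact fadingLoss_le (by linarith) hc₁ hz0 (hx.norm_nearest_le (by linarith) i)
  set A := ∑' i, if i = n then 0 else fadingLoss α P₁ s ‖x i‖ with hA
  -- At a fixed cut-off the fading is averaged first and the baseline process next.
  have hδ : ∀ k : ℕ, ∫⁻ w, μ {w' | ENNReal.ofReal γ ≤ sir α P₁ P₂ D x (fun j => Y j w)
      (fun i => h i w') (fun j => g j w')} ∂μ ≤ ENNReal.ofReal (Real.exp (-A +
        -(lam₂ * ∫ y in (holes D x)ᶜ ∩ {y | 1 / ((k : ℝ) + 1) ≤ ‖y‖},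
          lossKernel α (s * P₂) ‖y‖))) := by
    intro k
    have hk : (0 : ℝ) < 1 / ((k : ℝ) + 1) := by positivity
    have hsum := hY.ae_summable hlam₂.le (measurable_ite_fadingLoss α P₂ D s (1 / ((k : ℝ) + 1)) x)
      (integrable_ite_fadingLoss hα D hc hk x)
    rw [Real.exp_add, ENNReal.ofReal_mul (Real.exp_pos _).le]
    refine le_trans ?_ (mul_le_mul_right (lintegral_small_cells_le hlam₂.le hY hα hc hk x) _)
    rw [← lintegral_const_mul' _ _ ENNReal.ofReal_ne_top]
    refine lintegral_mono_ae ?_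
    filter_upwards [hsum] with w hw
    rw [← ENNReal.ofReal_mul (Real.exp_pos _).le, ← Real.exp_add, ← neg_add]
    exact measure_le_sir_le hind hh hg hP₁ hP₂ hγ _ (hx.ne_zero n) hs hsx hw.of_abs
  have hlim : ∫⁻ w, μ {w' | ENNReal.ofReal γ ≤ sir α P₁ P₂ D x (fun j => Y j w)
      (fun i => h i w') (fun j => g j w')} ∂μ ≤ ENNReal.ofReal (Real.exp (-A +
        -(lam₂ * ∫ y in (holes D x)ᶜ, lossKernel α (s * P₂) ‖y‖))) :=
    ge_of_tendsto' (ENNReal.tendsto_ofReal ((Real.continuous_exp.tendsto _).comp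
      (((tendsto_setIntegral_lossKernel_inter hα hc (holes D x)ᶜ
        (isOpen_holes D x).measurableSet.compl).const_mul lam₂).neg.const_add (-A)))) hδ
  refine hlim.trans (ENNReal.ofReal_le_ofReal ?_)
  rw [servingFactor, ← Real.exp_add, Real.exp_le_exp]
  have hmass : ∀ i, holeTerm lam₂ α P₂ D s ‖x i‖ = lam₂ * holeMass α D (s * P₂) (x i) :=
    fun i => holeTerm_eq_holeMass hD hc (hx.ne_zero i)
  have hms := hx.summable_holeMass hα hD hc
  have hht : Summable fun i => holeTerm lam₂ α P₂ D s ‖x i‖ := by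
    simp only [hmass]
    exact hms.mul_left lam₂
  have hht' : Summable fun i => if i = n then 0 else holeTerm lam₂ α P₂ D s ‖x i‖ := by
    refine hht.of_nonneg_of_le (fun i => ?_) fun i => ?_ <;>
    · have := (holeTerm_bounds hlam₂.le hα hD hc (norm_pos_iff.2 (hx.ne_zero i))).1
      split_ifs <;> linarith
  have hsplit := hht.tsum_eq_add_tsum_ite n
  have htot : ∑' i, holeTerm lam₂ α P₂ D s ‖x i‖ = lam₂ * ∑' i, holeMass α D (s * P₂) (x i) := by
    simp only [hmass]
    exact tsum_mul_left
  have hpot : (∑' i, if i = n then 0 else macroPotential lam₂ α P₁ P₂ D γ z ‖x i‖) =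
      (∑' i, if i = n then 0 else holeTerm lam₂ α P₂ D s ‖x i‖) - A := by
    rw [hA, ← hht'.tsum_sub hsx]
    refine tsum_congr fun i => ?_
    split_ifs
    · simp
    · rfl
  -- The server's own hole is split off the sum: it goes into `servingFactor`, while the other holes
  -- go into the macro potentials.
  have hgeo := mul_le_mul_of_nonneg_left (hx.farMass_le hα hD hc) hlam₂.le
  rw [mul_add, ← htot, hsplit] at hgeo
  rw [hpot]
  linarith

end Conditional

/-! ### Measurability of the SIR, successive averaging and conclusion. -/

theorem measurable_apply_nat {β δ : Type*} [MeasurableSpace β] [MeasurableSpace δ] {N : β → ℕ}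
    {F : ℕ → β → δ} (hN : Measurable N) (hF : ∀ n, Measurable (F n)) :
    Measurable fun b => F (N b) b := by
  have h : Measurable fun p : ℕ × β => F p.1 p.2 := measurable_from_prod_countable_right hF
  have h2 := h.comp (hN.prodMk measurable_id)
  simpa only [Function.comp_def, id] using h2

theorem measurable_sir (α P₁ P₂ D : ℝ) :
    Measurable fun q : ((ℕ → Plane) × (ℕ → Plane)) × ((ℕ → ℝ) × (ℕ → ℝ)) =>
      sir α P₁ P₂ D q.1.1 q.1.2 q.2.1 q.2.2 := by
  classical
  have hN : Measurable fun q : ((ℕ → Plane) × (ℕ → Plane)) × ((ℕ → ℝ) × (ℕ → ℝ)) =>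
      nearest q.1.1 := measurable_nearest.comp (measurable_fst.comp measurable_fst)
  have hx : ∀ i, Measurable fun q : ((ℕ → Plane) × (ℕ → Plane)) × ((ℕ → ℝ) × (ℕ → ℝ)) =>
      q.1.1 i := fun i => by fun_prop
  have hy : ∀ i, Measurable fun q : ((ℕ → Plane) × (ℕ → Plane)) × ((ℕ → ℝ) × (ℕ → ℝ)) =>
      q.1.2 i := fun i => by fun_prop
  have h1 : ∀ i, Measurable fun q : ((ℕ → Plane) × (ℕ → Plane)) × ((ℕ → ℝ) × (ℕ → ℝ)) =>
      rxPower α P₁ (q.2.1 i) (q.1.1 i) := fun i => by unfold rxPower; fun_prop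
  have h2 : ∀ i, Measurable fun q : ((ℕ → Plane) × (ℕ → Plane)) × ((ℕ → ℝ) × (ℕ → ℝ)) =>
      rxPower α P₂ (q.2.2 i) (q.1.2 i) := fun i => by unfold rxPower; fun_prop
  unfold sir
  simp only [interference_eq]
  refine (measurable_apply_nat hN h1).div (Measurable.add (Measurable.tsum fun i => ?_)
    (Measurable.tsum fun j => ?_))
  · exact Measurable.ite (measurableSet_eq_fun measurable_const hN) measurable_const (h1 i)
  · refine Measurable.ite ?_ measurable_const (h2 j)
    simp only [holes, mem_iUnion, Metric.mem_ball]
    rw [ofPred_exists]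
    exact MeasurableSet.iUnion fun i => measurableSet_lt ((hy j).dist (hx i)) measurable_const

section Coverage

variable {W : Type*} [MeasurableSpace W] {μ : Measure W} [IsProbabilityMeasure μ]
  {lam₁ lam₂ P₁ P₂ D α γ : ℝ} {X Y : ℕ → W → Plane} {h g : ℕ → W → ℝ}

/-- The two independence hypotheses make the joint law a product, so fading, baseline and macro
locations are averaged successively, from the inside out. No independence within a family is used
here. -/
theorem macroCoverage_eq (hnet : IsTwoTierNetwork lam₁ lam₂ X Y h g μ) :
    macroCoverage μ α P₁ P₂ D γ X Y h g =
      ∫⁻ w₁, ∫⁻ w₂, μ {w | ENNReal.ofReal γ ≤ sir α P₁ P₂ D (fun i => X i w₁) (fun j => Y j w₂)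
        (fun i => h i w) (fun j => g j w)} ∂μ ∂μ := by
  have hX : Measurable fun w i => X i w := measurable_pi_lambda _ hnet.macro_poisson.measurable
  have hY : Measurable fun w i => Y i w := measurable_pi_lambda _ hnet.baseline_poisson.measurable
  have hh : AEMeasurable (fun w i => h i w) μ :=
    aemeasurable_pi_lambda _ fun i => (hnet.macro_fading i).aemeasurable
  have hg : AEMeasurable (fun w i => g i w) μ :=
    aemeasurable_pi_lambda _ fun i => (hnet.small_fading i).aemeasurable
  set S : Set (((ℕ → Plane) × (ℕ → Plane)) × ((ℕ → ℝ) × (ℕ → ℝ))) :=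
    {q | ENNReal.ofReal γ ≤ sir α P₁ P₂ D q.1.1 q.1.2 q.2.1 q.2.2} with hS
  have hSm : MeasurableSet S := measurableSet_le measurable_const (measurable_sir α P₁ P₂ D)
  have : IsProbabilityMeasure (μ.map fun w => ((fun i => h i w), (fun i => g i w))) :=
    Measure.isProbabilityMeasure_map (hh.prodMk hg)
  have : IsProbabilityMeasure (μ.map fun w j => Y j w) :=
    Measure.isProbabilityMeasure_map hY.aemeasurable
  have hF : Measurable fun p : (ℕ → Plane) × (ℕ → Plane) =>
      (μ.map fun w => ((fun i => h i w), (fun i => g i w))) (Prod.mk p ⁻¹' S) :=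
    measurable_measure_prodMk_left hSm
  have hslice : ∀ p, (μ.map fun w => ((fun i => h i w), (fun i => g i w))) (Prod.mk p ⁻¹' S) =
      μ {w | ENNReal.ofReal γ ≤ sir α P₁ P₂ D p.1 p.2 (fun i => h i w) (fun j => g j w)} := by
    intro p
    rw [Measure.map_apply_of_aemeasurable (hh.prodMk hg) (measurable_prodMk_left hSm)]
    rfl
  calc macroCoverage μ α P₁ P₂ D γ X Y h g
      = (μ.map fun w => (((fun i => X i w), (fun j => Y j w)),
          ((fun i => h i w), (fun j => g j w)))) S := by
        rw [Measure.map_apply_of_aemeasurable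
          ((hX.prodMk hY).aemeasurable.prodMk (hh.prodMk hg)) hSm]
        rfl
    _ = (((μ.map fun w i => X i w).prod (μ.map fun w j => Y j w)).prod
          (μ.map fun w => ((fun i => h i w), (fun i => g i w)))) S := by
        rw [(indepFun_iff_map_prod_eq_prod_map_map (hX.prodMk hY).aemeasurable
          (hh.prodMk hg)).1 hnet.fading_locations_indep,
          (indepFun_iff_map_prod_eq_prod_map_map hX.aemeasurable hY.aemeasurable).1
            hnet.locations_indep]
    _ = _ := by
        rw [Measure.prod_apply hSm, lintegral_prod _ hF.aemeasurable,
          lintegral_map hF.lintegral_prod_right' hX]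
        refine lintegral_congr fun w₁ => ?_
        refine (lintegral_map ?_ hY).trans (lintegral_congr fun w₂ => hslice _)
        have hF' := hF.comp (measurable_prodMk_left (x := fun i => X i w₁))
        simpa only [Function.comp_def] using hF'

theorem macroCoverage_le (hlam₁ : 0 < lam₁) (hlam₂ : 0 < lam₂) (hP₁ : 0 < P₁)
    (hP₂ : 0 < P₂) (hD : 0 < D) (hα : 2 < α) (hγ : 0 < γ)
    (hnet : IsTwoTierNetwork lam₁ lam₂ X Y h g μ) :
    macroCoverage μ α P₁ P₂ D γ X Y h g ≤
      ∫⁻ z in Ioi 0, ENNReal.ofReal (servingFactor lam₂ α P₁ P₂ D γ z *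
        Real.exp (lam₁ * ∫ y in {y : Plane | z ≤ ‖y‖},
          (Real.exp (macroPotential lam₂ α P₁ P₂ D γ z ‖y‖) - 1))) *
        ENNReal.ofReal (servingPDF lam₁ z) := by
  classical
  rw [macroCoverage_eq hnet]
  refine le_trans (lintegral_mono_ae ?_) (hnet.macro_poisson.lintegral_nearest_le
    (C := servingFactor lam₂ α P₁ P₂ D γ) hlam₁ hα (fun z _ => (Real.exp_pos _).le)
    (continuousOn_servingFactor hα hP₁ hP₂ hD hγ)
    (isRadialPotential_macroPotential hlam₂.le hα hP₁ hP₂ hD hγ))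
  filter_upwards [hnet.macro_poisson.ae_isGood hlam₁.le hα] with w hw
  convert! lintegral_measure_le_sir_le hlam₂ hP₁ hP₂ hD hα hγ hnet.baseline_poisson
    hnet.fading_indep hnet.macro_fading hnet.small_fading hw using 8

end Coverage

end HoleNetwork

theorem theorem2 {W : Type*} [MeasurableSpace W] (μ : Measure W) [IsProbabilityMeasure μ]
    (lam₁ lam₂ P₁ P₂ D α γ : ℝ) (hlam₁ : 0 < lam₁) (hlam₂ : 0 < lam₂) (hP₁ : 0 < P₁)
    (hP₂ : 0 < P₂) (hD : 0 < D) (hα : 2 < α) (hγ : 0 < γ)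
    (X Y : ℕ → W → HoleNetwork.Plane) (h g : ℕ → W → ℝ)
    (hnet : HoleNetwork.IsTwoTierNetwork lam₁ lam₂ X Y h g μ) :
    (∀ z : ℝ, 0 < z →
      (∀ u : ℝ, 0 < u → IntervalIntegrable
        (HoleNetwork.holeIntegrand lam₂ α P₂ D (γ * z ^ α / P₁) u) volume |u - D| (u + D)) ∧
      (z ≤ D → IntegrableOn
        (HoleNetwork.farIntegrand lam₂ α P₂ (γ * z ^ α / P₁)) (Ioi (D - z))) ∧
      IntegrableOn
        (HoleNetwork.pgflIntegrand lam₂ α P₁ P₂ D (γ * z ^ α / P₁)) (Ioi z)) ∧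
    HoleNetwork.macroCoverage μ α P₁ P₂ D γ X Y h g ≤
      (∫⁻ z in Ioc 0 D, ENNReal.ofReal
        (HoleNetwork.G₁ lam₂ α P₂ D (γ * z ^ α / P₁) z *
          HoleNetwork.G₂ lam₂ α P₂ D (γ * z ^ α / P₁) z *
          HoleNetwork.G₄ lam₁ lam₂ α P₁ P₂ D (γ * z ^ α / P₁) z *
          HoleNetwork.servingPDF lam₁ z)) +
      ∫⁻ z in Ioi D, ENNReal.ofReal
        (HoleNetwork.G₁hat lam₂ α P₂ (γ * z ^ α / P₁) *
          HoleNetwork.G₂ lam₂ α P₂ D (γ * z ^ α / P₁) z *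
          HoleNetwork.G₄ lam₁ lam₂ α P₁ P₂ D (γ * z ^ α / P₁) z *
          HoleNetwork.servingPDF lam₁ z) := by
  refine ⟨fun z hz => ?_, ?_⟩
  · have hs : 0 < γ * z ^ α / P₁ := by positivity
    exact ⟨fun u hu => HoleNetwork.intervalIntegrable_holeIntegrand hα hD (mul_pos hs hP₂) hu,
      fun hzD => HoleNetwork.integrableOn_farIntegrand hα (mul_pos hs hP₂) (sub_nonneg.2 hzD),
      HoleNetwork.integrableOn_pgflIntegrand hlam₂.le hα hP₁ hP₂ hD hγ hz⟩
  · refine (HoleNetwork.macroCoverage_le hlam₁ hlam₂ hP₁ hP₂ hD hα hγ hnet).trans ?_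
    -- `servingFactor` is G₁ G₂ up to the distance `D` and Ĝ₁ G₂ beyond it.
    rw [← Ioc_union_Ioi_eq_Ioi hD.le]
    refine (lintegral_union_le _ _ _).trans_eq ?_
    congr 1
    · refine setLIntegral_congr_fun measurableSet_Ioc fun z hz => ?_
      rw [HoleNetwork.G₁_eq hz.2, HoleNetwork.G₄_eq hP₁ hγ hz.1, HoleNetwork.G₂,
        HoleNetwork.servingFactor, ← ENNReal.ofReal_mul (by positivity), Real.exp_add]
    · refine setLIntegral_congr_fun measurableSet_Ioi fun z hz => ?_
      have hz0 : 0 < z := hD.trans hz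
      rw [HoleNetwork.G₁hat_eq hα (by positivity) hz, HoleNetwork.G₄_eq hP₁ hγ hz0,
        HoleNetwork.G₂, HoleNetwork.servingFactor, ← ENNReal.ofReal_mul (by positivity),
        Real.exp_add]
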